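/- **Theorem 6.3 (fixed $t$, domain behavior).** Let $(\mathscr A,\tau)$ be a unital $C^*$-algebra with a state (for instance a $W^*$-probability space), let $y_0\in\mathscr A$ be self-adjoint with law $\nu$, and for every $u\ge 0$ let $\tilde\sigma_u\in\mathscr A$ be a semicircular element of variance $u$ that is freely independent of $y_0$. Put $m=\tau(y_0)$, $V=\tau(y_0^2)-\tau(y_0)^2$, and $D_\nu=\sup\{|x-y| : x,y\in\operatorname{supp}\nu\}$. *Notation.* For a compactly supported probability measure $\mu$ on $\mathbb R$ and $r\in\mathbb R$ let $G_\mu(z)=\int\frac{d\mu(x)}{z-x}$ and $H_{\mu,r}(z)=z+rG_\mu(z)$. For $t>0$ let $v_{\mu,t}(\alpha)=\inf\{v>0 : \int\frac{d\mu(x)}{(\alpha-x)^2+v^2}\le\frac1t\}$, $\Lambda_{\mu,t}=\{\alpha+i\beta : |\beta|<v_{\mu,t}(\alpha)\}$, $\Omega_{\mu,t}=[H_{\mu,-t}(\Lambda_{\mu,t}^c)]^c$ and $b_{\mu,t}=2\,v_{\mu,t}\circ a_{\mu,t}^{-1}$, where $a_{\mu,t}(\alpha)=\operatorname{Re}H_{\mu,-t}(\alpha+iv_{\mu,t}(\alpha))$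 (a homeomorphism of $\mathbb R$ when $\mu$ is not a point mass). For $s\ge t/2>0$ let $\mu_{s,t}$ be the law of $y_0+\tilde\sigma_{s-t/2}$, and put $\Omega_{s,t}=\Omega_{\mu_{s,t},t/2}$ and $b_{s,t}=b_{\mu_{s,t},t/2}$; thus $\Omega_{s,t}$ is the region $\{a+ib : |b|<b_{s,t}(a)\}$. Let $$U_{s,t}(\alpha+i\beta)=\operatorname{Re}H_{\nu,s-t}(\alpha+iv_{\nu,s}(\alpha))+i\tfrac ts\beta .$$ Fix $t>0$. Then: 1. If $s\ge t/2$, $s\ge 4D_\nu^2$, and either $s>t/2$ or $\nu$ is not a point mass, then $b_{s,t}$ is unimodal (nondecreasing up to some point and nonincreasing after it). In particular $\Omega_{s,t}\cap\mathbb R$ is a nonempty bounded open interval. 2. For every $K>|V-t|$ (so for $K=c|V-t|$ with any $c>1$, if $V\neq t$), for all sufficiently large $s$, $$\bigl|\sup(\Omega_{s,t}\cap\mathbb R)-(m+2\sqrt s)\bigr|<\frac{K}{\sqrt s},\qquad \bigl|\inf(\Omega_{s,t}\cap\mathbb R)-(m-2\sqrt s)\bigr|<\frac{K}{\sqrt s},$$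 and in particular $\Omega_{s,t}\cap\mathbb R\subset\bigl(m-2\sqrt s-\frac K{\sqrt s},\,m+2\sqrt s+\frac K{\sqrt s}\bigr)$. 3. Let $\varphi_0\in(0,\pi/2)$ and $C>V/2$ (so $C=1$ is allowed if $V=1$). For all sufficiently large $s$ and all $\varphi\in[0,\pi]$ with $|\cos\varphi|\le\cos\varphi_0$, there is a unique $\alpha\in\mathbb R$ with $H_{\nu,s}(\alpha+iv_{\nu,s}(\alpha))=m+2\sqrt s\cos\varphi$, and it satisfies $$\Bigl|U_{s,t}(\alpha+iv_{\nu,s}(\alpha))-\Bigl[m+\frac{2s-t}{\sqrt s}\cos\varphi+i\frac t{\sqrt s}\sin\varphi\Bigr]\Bigr|<\frac{C\,t}{(\sin\varphi_0)\,s^{3/2}} .$$ Furthermore, $\sup\{|\operatorname{Im}z| : z\in\Omega_{s,t}\}$ is finite for all large $s$ and tends to $0$ as $s\to\infty$. -/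

import Mathlib

open MeasureTheory Filter Topology Set

namespace FreeElliptic

/-! ### Noncommutative probability -/

section Algebra

variable {A : Type*} [CStarAlgebra A]

/-- `τ` is a state on the unital C⋆-algebra `A`: a unital positive linear functional. A normal
faithful tracial state on a von Neumann algebra (a W⋆-probability space) is a particular case. -/
structure IsState (τ : A →ₗ[ℂ] ℂ) : Prop where
  map_one : τ 1 = 1
  re_nonneg : ∀ a : A, 0 ≤ (τ (star a * a)).re
  im_eq_zero : ∀ a : A, (τ (star a * a)).im = 0

/-- `μ` is the law of `a`: the compactly supported probability measure on `ℝ` whose moments are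
those of `a`. (Compact support makes such a measure unique.) -/
structure IsLaw (τ : A →ₗ[ℂ] ℂ) (a : A) (μ : Measure ℝ) : Prop where
  isProbabilityMeasure : IsProbabilityMeasure μ
  exists_support_bound : ∃ R : ℝ, μ (Icc (-R) R)ᶜ = 0
  moment : ∀ n : ℕ, ((∫ x, x ^ n ∂μ : ℝ) : ℂ) = τ (a ^ n)

open Classical in
/-- The law of `a`. It exists and is unique for every self-adjoint `a`. -/
noncomputable def law (τ : A →ₗ[ℂ] ℂ) (a : A) : Measure ℝ :=
  if h : ∃ μ : Measure ℝ, IsLaw τ a μ then h.choose else 0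

/-- Free independence of a family of elements: whenever `a₁, …, aₘ` (`m ≥ 1`) are centered, each
`aⱼ` lies in the unital ⋆-algebra generated by `x (iⱼ)`, and neighbouring indices differ, then
`τ (a₁ ⋯ aₘ) = 0`. -/
def FreelyIndependent (τ : A →ₗ[ℂ] ℂ) {ι : Type*} (x : ι → A) : Prop :=
  ∀ l : List (ι × A), l ≠ [] →
    l.IsChain (fun p q => p.1 ≠ q.1) →
    (∀ p ∈ l, p.2 ∈ StarAlgebra.adjoin ℂ {x p.1} ∧ τ p.2 = 0) →
    τ (l.map Prod.snd).prod = 0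

end Algebra

/-- The semicircle law of variance `u ≥ 0` (the point mass at `0` when `u = 0`). -/
noncomputable def semicircleLaw (u : ℝ) : Measure ℝ :=
  if u = 0 then Measure.dirac 0
  else volume.withDensity
    (fun x => ENNReal.ofReal (Real.sqrt (4 * u - x ^ 2) / (2 * Real.pi * u)))

/-- `a` is a semicircular element of variance `u`. -/
def IsSemicircular {A : Type*} [CStarAlgebra A] (τ : A →ₗ[ℂ] ℂ) (u : ℝ) (a : A) : Prop :=
  IsSelfAdjoint a ∧ IsLaw τ a (semicircleLaw u)

/-! ### Functions and domains attached to a compactly supported probability measure -/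

section Measures

variable (μ : Measure ℝ)

/-- The Cauchy transform `G_μ(z) = ∫ (z - x)⁻¹ dμ(x)`. -/
noncomputable def cauchyTransform (z : ℂ) : ℂ := ∫ x : ℝ, (z - (x : ℂ))⁻¹ ∂μ

/-- `v_{μ,t}(a)`: the unique `v > 0` with `∫ ((a - x)² + v²)⁻¹ dμ(x) = 1 / t` if
`∫ (a - x)⁻² dμ(x) > 1 / t`, and `0` otherwise. -/
noncomputable def vFun (t a : ℝ) : ℝ :=
  sInf {v : ℝ | 0 < v ∧ ∫ x, 1 / ((a - x) ^ 2 + v ^ 2) ∂μ ≤ 1 / t}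

/-- `Λ_{μ,t}`, the set of points lying strictly between the graphs of `-v_{μ,t}` and `v_{μ,t}`. -/
def Lam (t : ℝ) : Set ℂ := {z | |z.im| < vFun μ t z.re}

/-- `H_{μ,r}(z) = z + r G_μ(z)`, used on the complement of `Λ_{μ,|r|}`. At the real points of this
closed set the integral converges absolutely and gives the continuous extension. -/
noncomputable def H (r : ℝ) (z : ℂ) : ℂ := z + (r : ℂ) * cauchyTransform μ z

/-- The domain `Ω_{μ,t} = [H_{μ,-t}(Λ_{μ,t}ᶜ)]ᶜ`. -/
noncomputable def Omega (t : ℝ) : Set ℂ := (H μ (-t) '' (Lam μ t)ᶜ)ᶜ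

/-- The map `a_{μ,t}(α) = Re H_{μ,-t}(α + i v_{μ,t}(α))`, a homeomorphism of `ℝ` when `μ` is not a
point mass. -/
noncomputable def aFun (t α : ℝ) : ℝ :=
  (H μ (-t) ((α : ℂ) + (vFun μ t α : ℂ) * Complex.I)).re

/-- `b_{μ,t}(a) = 2 v_{μ,t}(a_{μ,t}⁻¹(a))`. -/
noncomputable def bFun (t a : ℝ) : ℝ := 2 * vFun μ t (Function.invFun (aFun μ t) a)

/-- The two-parameter map `a_{s,t}(α) = Re H_{μ,s-t}(α + i v_{μ,s}(α))`. -/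
noncomputable def aST (s t α : ℝ) : ℝ :=
  (H μ (s - t) ((α : ℂ) + (vFun μ s α : ℂ) * Complex.I)).re

/-- The map `U_{s,t}(α + iβ) = a_{s,t}(α) + i (t / s) β`. -/
noncomputable def U (s t : ℝ) (z : ℂ) : ℂ :=
  (aST μ s t z.re : ℂ) + ((t / s * z.im : ℝ) : ℂ) * Complex.I

end Measures

/-! ### The objects attached to `y₀ + σ̃_{s - t/2} + i σ_{t/2}`

Here `σ u` is a semicircular element of variance `u` free from `y₀`. With
`x₀ = y₀ + σ (s - t/2)`, one has `Ω_{s,t} = Ω_{x₀,t/2}` and `b_{s,t} = b_{x₀,t/2}`. -/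

section Elliptic

variable {A : Type*} [CStarAlgebra A] (τ : A →ₗ[ℂ] ℂ) (y₀ : A) (σ : ℝ → A)

/-- The domain `Ω_{s,t}`. -/
noncomputable def OmegaST (s t : ℝ) : Set ℂ := Omega (law τ (y₀ + σ (s - t / 2))) (t / 2)

/-- The function `b_{s,t}`, whose graph is the upper boundary of `Ω_{s,t}`. -/
noncomputable def bST (s t : ℝ) : ℝ → ℝ := bFun (law τ (y₀ + σ (s - t / 2))) (t / 2)

/-- `Ω_{s,t} ∩ ℝ`, as a set of real numbers. -/
def OmegaReal (s t : ℝ) : Set ℝ := {a : ℝ | (a : ℂ) ∈ OmegaST τ y₀ σ s t}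

/-- The mean `τ(y₀)`. -/
noncomputable def mean : ℝ := (τ y₀).re

/-- The variance `τ((y₀ - τ(y₀))²) = τ(y₀²) - τ(y₀)²`. -/
noncomputable def variance : ℝ := (τ (y₀ ^ 2)).re - (τ y₀).re ^ 2

end Elliptic

/-- A real function is unimodal if it is nondecreasing up to some point and nonincreasing after
it. -/
def IsUnimodal (f : ℝ → ℝ) : Prop := ∃ c : ℝ, MonotoneOn f (Iic c) ∧ AntitoneOn f (Ici c)

end FreeElliptic

/-! Everything is pulled back to the law ν of y₀ by free subordination. Let μ be the law of y₀ +
σ̃_u with u = s - t/2, and put r = t/2, so that u + r = s and u - r = s - t. Biane's relation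
G_μ(H_{ν,u}(w)) = G_ν(w) holds near infinity (`subordinateAtInfinity_of_free`) and extends to all w
in the upper half-plane with Im H_{ν,u}(w) > 0. It shows that H_{ν,u} carries the graph of v_{ν,s}
onto the graph of v_{μ,r}, scaling heights by r/s, and that composing with H_{μ,-r} gives H_{ν,s-t}.
Hence Ω_{s,t} ∩ ℝ is the image of {v_{ν,s} > 0} under a_{s,t} = Re H_{ν,s-t}(α + i v_{ν,s}(α)), and
b_{s,t} ∘ a_{s,t} = (t/s) v_{ν,s}.

The basic estimate is that G_ν is 1/s-Lipschitz where ∫ |z-x|⁻² dν ≤ 1/s. It makes a_{s,t}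
increasing as soon as |s - t| ≤ s, that is s ≥ t/2. The equality case shows that injectivity fails
only for a point mass with s = t/2.

Unimodality amounts to quasi-concavity of v_{ν,s} (`min_vFun_le`). For R > 0 the set {v_{ν,s} > R}
is {∫ ((α-x)² + R²)⁻¹ dν > 1/s}. Outside the convex hull of the support this integral is monotone in
α. Inside the hull it exceeds 1/s when R² < 3D², and it is concave when R² ≥ 3D². Here D is the
length of the hull and s ≥ 4D².

At an end point b of {v_{ν,s} > 0}, ∫ (b-x)⁻² dν ≈ 1/s puts a = |b - m| within O(1/√s) of √s. Since
a + s/a - 2√s = (a - √s)²/a is negligible, the expansion of G_ν in inverse powers of b - m leaves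
the correction (V - t)/√s (`HasMoments.tendsto_endpoint`).

For the ellipse, put o = (w - m)/√s at a boundary point w with H_{ν,s}(w) = m + 2√s cos φ. Then o +
√s G_ν(w) = 2 cos φ, while the product of the two summands is 1 + O(1/s), so o is near e^{iφ}. The
error of U_{s,t} is exactly t times the error of G_ν (`norm_U_bdry_sub`).

For the height, a point z of Ω_{s,t} in the upper half-plane is H_{ν,s-t}(w) with w between the real
axis and the graph of v_{ν,s}, so Im w < √s. There the imaginary part shrinks by a factor at most
t/s, so Im z < t/√s. -/

namespace FreeElliptic

/-! ### Square integrals of the resolvent kernel -/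

section Kernel

/-- The integral `∫ |z - x|⁻² dμ(x)`, with value `∞` if it diverges. -/
noncomputable def invSq (μ : Measure ℝ) (z : ℂ) : ENNReal :=
  ∫⁻ x : ℝ, (‖z - (x : ℂ)‖ₑ ^ 2)⁻¹ ∂μ

/-- The set on which the Cauchy transform is `t⁻¹`-Lipschitz. -/
def regSet (μ : Measure ℝ) (t : ℝ) : Set ℂ := {z | invSq μ z ≤ ENNReal.ofReal (1 / t)}

variable {μ : Measure ℝ} {z w : ℂ} {t : ℝ}

lemma measurable_kernel (z : ℂ) : Measurable fun x : ℝ => (z - (x : ℂ))⁻¹ := by fun_prop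

/-- The inverse of 0 is ∞ in `ENNReal` but 0 in `ℂ`. Finiteness of `invSq` confines the junk value
of the complex kernel to a null set, so points on the real axis can be treated like the others. -/
lemma ae_ne_of_invSq (h : invSq μ z ≠ ⊤) : ∀ᵐ x : ℝ ∂μ, z - (x : ℂ) ≠ 0 := by
  have := ae_lt_top (μ := μ) (f := fun x : ℝ => (‖z - (x : ℂ)‖ₑ ^ 2)⁻¹) (by fun_prop) h
  filter_upwards [this] with x hx h0
  simp [h0] at hx

lemma ofReal_kernel {a : ℂ} (h : a ≠ 0) : ENNReal.ofReal (‖a⁻¹‖ ^ 2) = (‖a‖ₑ ^ 2)⁻¹ := by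
  have : 0 < ‖a‖ ^ 2 := by positivity
  rw [norm_inv, inv_pow, ENNReal.ofReal_inv_of_pos this, ENNReal.ofReal_pow (norm_nonneg _),
    ofReal_norm]

lemma lintegral_kernel (h : invSq μ z ≠ ⊤) :
    ∫⁻ x : ℝ, ENNReal.ofReal (‖(z - (x : ℂ))⁻¹‖ ^ 2) ∂μ = invSq μ z := by
  refine lintegral_congr_ae ?_
  filter_upwards [ae_ne_of_invSq h] with x hx using ofReal_kernel hx

lemma integrable_kernel_sq (h : invSq μ z ≠ ⊤) :
    Integrable (fun x : ℝ => ‖(z - (x : ℂ))⁻¹‖ ^ 2) μ := by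
  refine ⟨(by fun_prop : Measurable _).aestronglyMeasurable, ?_⟩
  rw [hasFiniteIntegral_iff_ofReal (ae_of_all _ fun x => by positivity), lintegral_kernel h]
  exact h.lt_top

lemma ofReal_integral_kernel (h : invSq μ z ≠ ⊤) :
    ENNReal.ofReal (∫ x : ℝ, ‖(z - (x : ℂ))⁻¹‖ ^ 2 ∂μ) = invSq μ z := by
  rw [ofReal_integral_eq_lintegral_ofReal (integrable_kernel_sq h)
    (ae_of_all _ fun x => by positivity), lintegral_kernel h]

lemma integral_kernel_nonneg : 0 ≤ ∫ x : ℝ, ‖(z - (x : ℂ))⁻¹‖ ^ 2 ∂μ :=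
  integral_nonneg fun x => by positivity

lemma ne_top_of_mem_regSet (h : z ∈ regSet μ t) : invSq μ z ≠ ⊤ :=
  ne_top_of_le_ne_top ENNReal.ofReal_ne_top h

lemma mem_regSet_iff (ht : 0 < t) (h : invSq μ z ≠ ⊤) :
    z ∈ regSet μ t ↔ ∫ x : ℝ, ‖(z - (x : ℂ))⁻¹‖ ^ 2 ∂μ ≤ 1 / t := by
  rw [regSet, mem_ofPred_eq, ← ofReal_integral_kernel h, ENNReal.ofReal_le_ofReal_iff (by positivity)]

lemma integral_kernel_le (ht : 0 < t) (h : z ∈ regSet μ t) :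
    ∫ x : ℝ, ‖(z - (x : ℂ))⁻¹‖ ^ 2 ∂μ ≤ 1 / t :=
  (mem_regSet_iff ht (ne_top_of_mem_regSet h)).1 h

lemma aestronglyMeasurable_kernel (z : ℂ) :
    AEStronglyMeasurable (fun x : ℝ => (z - (x : ℂ))⁻¹) μ :=
  (measurable_kernel z).aestronglyMeasurable

lemma integrable_kernel [IsFiniteMeasure μ] (h : invSq μ z ≠ ⊤) :
    Integrable (fun x : ℝ => (z - (x : ℂ))⁻¹) μ := by
  refine ((integrable_const (1 : ℝ)).add (integrable_kernel_sq h)).mono'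
    (aestronglyMeasurable_kernel z) (ae_of_all _ fun x => ?_)
  simp only [Pi.add_apply]
  nlinarith [sq_nonneg (‖(z - (x : ℂ))⁻¹‖ - 1)]

lemma integrable_kernel_mul (h : invSq μ z ≠ ⊤) (h' : invSq μ w ≠ ⊤) :
    Integrable (fun x : ℝ => (z - (x : ℂ))⁻¹ * (w - (x : ℂ))⁻¹) μ := by
  refine ((integrable_kernel_sq h).add (integrable_kernel_sq h')).mono'
    ((aestronglyMeasurable_kernel z).mul (aestronglyMeasurable_kernel w)) (ae_of_all _ fun x => ?_)
  simp only [Pi.add_apply]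
  rw [norm_mul]
  nlinarith [sq_nonneg (‖(z - (x : ℂ))⁻¹‖ - ‖(w - (x : ℂ))⁻¹‖), norm_nonneg (z - (x : ℂ))⁻¹,
    norm_nonneg (w - (x : ℂ))⁻¹]

lemma kernel_im (a : ℂ) : (a⁻¹).im = -a.im * ‖a⁻¹‖ ^ 2 := by
  rw [Complex.inv_im, norm_inv, inv_pow, Complex.normSq_eq_norm_sq]; rfl

lemma cauchyTransform_im [IsFiniteMeasure μ] (h : invSq μ z ≠ ⊤) :
    (cauchyTransform μ z).im = -z.im * ∫ x : ℝ, ‖(z - (x : ℂ))⁻¹‖ ^ 2 ∂μ := by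
  have := integral_im (integrable_kernel h)
  simp only [RCLike.im_to_complex] at this
  rw [cauchyTransform, ← this, ← integral_const_mul]
  congr 1; ext x
  rw [kernel_im]; simp

lemma norm_cauchyTransform_le [IsProbabilityMeasure μ] (ht : 0 < t) (h : z ∈ regSet μ t) :
    ‖cauchyTransform μ z‖ ≤ 1 / √t := by
  have hs : 0 < √t := Real.sqrt_pos.2 ht
  have h1 := ne_top_of_mem_regSet h
  have h2 := integral_kernel_le ht h
  calc ‖cauchyTransform μ z‖ ≤ ∫ x : ℝ, (1 / √t / 2 + √t / 2 * ‖(z - (x : ℂ))⁻¹‖ ^ 2) ∂μ := by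
        refine norm_integral_le_of_norm_le
          ((integrable_const _).add ((integrable_kernel_sq h1).const_mul _)) (ae_of_all _ fun x => ?_)
        set k := ‖(z - (x : ℂ))⁻¹‖
        -- The arithmetic–geometric mean inequality, with the weight that gives the sharp constant
        -- once ∫ k² ≤ 1/t.
        have : 1 / √t / 2 + √t / 2 * k ^ 2 - k = √t / 2 * (k - 1 / √t) ^ 2 := by
          field_simp; ring
        nlinarith [show 0 ≤ √t / 2 * (k - 1 / √t) ^ 2 by positivity]
    _ = 1 / √t / 2 + √t / 2 * ∫ x : ℝ, ‖(z - (x : ℂ))⁻¹‖ ^ 2 ∂μ := by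
        rw [integral_add (integrable_const _) ((integrable_kernel_sq h1).const_mul _),
          integral_const_mul]; simp
    _ ≤ 1 / √t / 2 + √t / 2 * (1 / t) := by gcongr
    _ = 1 / √t := by
        have : t = √t ^ 2 := (Real.sq_sqrt ht.le).symm
        rw [this, Real.sqrt_sq hs.le]; field_simp; ring

lemma cauchyTransform_sub [IsFiniteMeasure μ] (h : invSq μ z ≠ ⊤) (h' : invSq μ w ≠ ⊤) :
    cauchyTransform μ z - cauchyTransform μ w =
      -(z - w) * ∫ x : ℝ, (z - (x : ℂ))⁻¹ * (w - (x : ℂ))⁻¹ ∂μ := by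
  rw [cauchyTransform, cauchyTransform, ← integral_sub (integrable_kernel h) (integrable_kernel h'),
    ← integral_const_mul]
  refine integral_congr_ae ?_
  filter_upwards [ae_ne_of_invSq h, ae_ne_of_invSq h'] with x hx hx'
  field_simp; ring

lemma norm_integral_kernel_mul_le (ht : 0 < t) (h : z ∈ regSet μ t) (h' : w ∈ regSet μ t) :
    ‖∫ x : ℝ, (z - (x : ℂ))⁻¹ * (w - (x : ℂ))⁻¹ ∂μ‖ ≤ 1 / t := by
  have h1 := integrable_kernel_sq (ne_top_of_mem_regSet h)
  have h2 := integrable_kernel_sq (ne_top_of_mem_regSet h')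
  calc _ ≤ ∫ x : ℝ, (1 / 2 * ‖(z - (x : ℂ))⁻¹‖ ^ 2 + 1 / 2 * ‖(w - (x : ℂ))⁻¹‖ ^ 2) ∂μ := by
        refine norm_integral_le_of_norm_le ((h1.const_mul _).add (h2.const_mul _))
          (ae_of_all _ fun x => ?_)
        rw [norm_mul]
        nlinarith [sq_nonneg (‖(z - (x : ℂ))⁻¹‖ - ‖(w - (x : ℂ))⁻¹‖)]
    _ = 1 / 2 * (∫ x : ℝ, ‖(z - (x : ℂ))⁻¹‖ ^ 2 ∂μ) +
          1 / 2 * ∫ x : ℝ, ‖(w - (x : ℂ))⁻¹‖ ^ 2 ∂μ := by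
        rw [integral_add (h1.const_mul _) (h2.const_mul _), integral_const_mul, integral_const_mul]
    _ ≤ 1 / t := by linarith [integral_kernel_le ht h, integral_kernel_le ht h']

/-- The difference quotient is -∫ (z-x)⁻¹(w-x)⁻¹ dμ, and the product of kernels is at most the mean
of their squares. All monotonicity and injectivity statements below rest on this bound. -/
lemma norm_cauchyTransform_sub_le [IsFiniteMeasure μ] (ht : 0 < t) (h : z ∈ regSet μ t)
    (h' : w ∈ regSet μ t) :
    ‖cauchyTransform μ z - cauchyTransform μ w‖ ≤ ‖z - w‖ / t := by
  rw [cauchyTransform_sub (ne_top_of_mem_regSet h) (ne_top_of_mem_regSet h'), norm_mul, norm_neg,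
    div_eq_mul_one_div]
  gcongr
  exact norm_integral_kernel_mul_le ht h h'

/-- The equality case of the Lipschitz estimate for the Cauchy transform. -/
lemma eq_of_norm_cauchyTransform_sub_eq [IsFiniteMeasure μ] (ht : 0 < t) (h : z ∈ regSet μ t)
    (h' : w ∈ regSet μ t) (hne : z ≠ w)
    (heq : ‖cauchyTransform μ z - cauchyTransform μ w‖ = ‖z - w‖ / t) :
    ∃ c : ℂ, ‖c‖ = 1 ∧ (t : ℂ) * (cauchyTransform μ z - cauchyTransform μ w) = -(z - w) * c ∧
      ∀ᵐ x : ℝ ∂μ, (starRingEnd ℂ) w - x = c * (z - x) := by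
  have hz := ne_top_of_mem_regSet h
  have hw := ne_top_of_mem_regSet h'
  have h1 := integrable_kernel_sq hz
  have h2 := integrable_kernel_sq hw
  have h3 := integrable_kernel_mul hz hw
  set J := ∫ x : ℝ, (z - (x : ℂ))⁻¹ * (w - (x : ℂ))⁻¹ ∂μ with hJ
  rw [cauchyTransform_sub hz hw, ← hJ] at heq ⊢
  have hJn : ‖J‖ = 1 / t := by
    rw [norm_mul, norm_neg] at heq
    have : 0 < ‖z - w‖ := norm_pos_iff.2 (sub_ne_zero.2 hne)
    rw [div_eq_mul_one_div] at heq
    exact mul_left_cancel₀ this.ne' heq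
  refine ⟨t * J, ?_, by ring, ?_⟩
  · rw [norm_mul, hJn, Complex.norm_real, Real.norm_of_nonneg ht.le]; field_simp
  set c := (t : ℂ) * J with hc
  have hcn : ‖c‖ = 1 := by
    rw [norm_mul, hJn, Complex.norm_real, Real.norm_of_nonneg ht.le]; field_simp
  -- Equality in Cauchy–Schwarz is detected by integrating this square, with a and b the two
  -- kernels.
  have hpt : ∀ a b : ℂ, ‖a - c * (starRingEnd ℂ) b‖ ^ 2 =
      ‖a‖ ^ 2 + ‖b‖ ^ 2 - 2 * ((starRingEnd ℂ) c * (a * b)).re := by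
    intro a b
    have hcn' : c.re ^ 2 + c.im ^ 2 = 1 := by
      have := Complex.sq_norm c
      rw [hcn, Complex.normSq_apply] at this; nlinarith
    simp only [Complex.sq_norm, Complex.normSq_apply, Complex.sub_re, Complex.sub_im,
      Complex.mul_re, Complex.mul_im, Complex.conj_re, Complex.conj_im]
    linear_combination (b.re ^ 2 + b.im ^ 2) * hcn'
  have h4 : Integrable (fun x : ℝ => (starRingEnd ℂ) c * ((z - (x : ℂ))⁻¹ * (w - (x : ℂ))⁻¹)) μ :=
    h3.const_mul _
  have h5 : Integrable (fun x : ℝ =>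
      2 * ((starRingEnd ℂ) c * ((z - (x : ℂ))⁻¹ * (w - (x : ℂ))⁻¹)).re) μ := h4.re.const_mul 2
  -- The two squares contribute at most 1/t each, and the cross term contributes exactly -2/t
  -- because c = tJ and |J| = 1/t.
  have hint : ∫ x : ℝ, ‖(z - (x : ℂ))⁻¹ - c * (starRingEnd ℂ) (w - (x : ℂ))⁻¹‖ ^ 2 ∂μ ≤ 0 := by
    simp only [hpt]
    have h12 : Integrable (fun x : ℝ => ‖(z - (x : ℂ))⁻¹‖ ^ 2 + ‖(w - (x : ℂ))⁻¹‖ ^ 2) μ := h1.add h2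
    rw [integral_sub h12 h5, integral_add h1 h2, integral_const_mul]
    have hre := integral_re h4
    simp only [RCLike.re_to_complex] at hre
    rw [hre, integral_const_mul, ← hJ]
    have : ((starRingEnd ℂ) c * J).re = 1 / t := by
      have : (starRingEnd ℂ) c * J = ((t * ‖J‖ ^ 2 : ℝ) : ℂ) := by
        rw [hc, map_mul, Complex.conj_ofReal, mul_assoc, ← Complex.normSq_eq_conj_mul_self,
          Complex.normSq_eq_norm_sq]; push_cast; rfl
      rw [this, Complex.ofReal_re, hJn]; field_simp
    rw [this]
    linarith [integral_kernel_le ht h, integral_kernel_le ht h']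
  have hint0 : Integrable (fun x : ℝ =>
      ‖(z - (x : ℂ))⁻¹ - c * (starRingEnd ℂ) (w - (x : ℂ))⁻¹‖ ^ 2) μ := by
    simp only [hpt]
    exact (h1.add h2).sub h5
  have hzero := (integral_eq_zero_iff_of_nonneg_ae (ae_of_all _ fun x => by positivity) hint0).1
    (le_antisymm hint (integral_nonneg fun x => by positivity))
  filter_upwards [hzero, ae_ne_of_invSq hz, ae_ne_of_invSq hw] with x hx hxz hxw
  have hx' : (z - (x : ℂ))⁻¹ = c * (starRingEnd ℂ) (w - (x : ℂ))⁻¹ := by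
    simpa [sub_eq_zero] using hx
  have hxw' : (starRingEnd ℂ) w - (x : ℂ) ≠ 0 := by
    have := (map_ne_zero (starRingEnd ℂ)).2 hxw
    simpa using this
  rw [map_inv₀, map_sub, Complex.conj_ofReal] at hx'
  field_simp at hx'
  rw [hx', mul_comm]

/-- Fatou's lemma. The kernel is continuous in z with values in [0, ∞], including at points of the
support. -/
lemma isClosed_regSet : IsClosed (regSet μ t) := by
  refine IsSeqClosed.isClosed fun u z hu huz => ?_
  have hlim : ∀ x : ℝ, Tendsto (fun n => (‖u n - (x : ℂ)‖ₑ ^ 2)⁻¹) atTop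
      (𝓝 ((‖z - (x : ℂ)‖ₑ ^ 2)⁻¹)) := fun x => by
    have h1 : Tendsto (fun n => ‖u n - (x : ℂ)‖ₑ) atTop (𝓝 ‖z - (x : ℂ)‖ₑ) :=
      (continuous_enorm.tendsto _).comp (huz.sub_const _)
    exact ((ENNReal.continuous_pow 2).tendsto _ |>.comp h1).inv
  calc invSq μ z = ∫⁻ x : ℝ, liminf (fun n => (‖u n - (x : ℂ)‖ₑ ^ 2)⁻¹) atTop ∂μ := by
        simp only [fun x => (hlim x).liminf_eq]; rfl
    _ ≤ liminf (fun n => invSq μ (u n)) atTop := lintegral_liminf_le fun n => by fun_prop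
    _ ≤ liminf (fun _ : ℕ => ENNReal.ofReal (1 / t)) atTop :=
        liminf_le_liminf (Eventually.of_forall hu)
    _ = _ := by simp

lemma enorm_kernel_le {z w : ℂ} (hre : z.re = w.re) (him : |z.im| ≤ |w.im|) (x : ℝ) :
    (‖w - (x : ℂ)‖ₑ ^ 2)⁻¹ ≤ (‖z - (x : ℂ)‖ₑ ^ 2)⁻¹ := by
  gcongr
  rw [enorm_le_iff_norm_le, Complex.norm_def, Complex.norm_def]
  apply Real.sqrt_le_sqrt
  simp only [Complex.normSq_apply, Complex.sub_re, Complex.sub_im, Complex.ofReal_re,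
    Complex.ofReal_im, sub_zero, hre]
  nlinarith [sq_le_sq' (by linarith [abs_nonneg z.im, abs_nonneg w.im]) him, sq_abs z.im,
    sq_abs w.im]

lemma invSq_le_of_im_le {z w : ℂ} (hre : z.re = w.re) (him : |z.im| ≤ |w.im|) :
    invSq μ w ≤ invSq μ z := lintegral_mono (enorm_kernel_le hre him)

lemma regSet_of_im_le {z w : ℂ} (hz : z ∈ regSet μ t) (hre : z.re = w.re)
    (him : |z.im| ≤ |w.im|) : w ∈ regSet μ t := (invSq_le_of_im_le hre him).trans hz

lemma norm_kernel_le (hz : z.im ≠ 0) (x : ℝ) : ‖(z - (x : ℂ))⁻¹‖ ≤ 1 / |z.im| := by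
  rw [norm_inv, inv_eq_one_div]
  have := Complex.abs_im_le_norm (z - (x : ℂ))
  have h0 : 0 < |z.im| := abs_pos.2 hz
  apply one_div_le_one_div_of_le h0
  simpa using this

lemma sub_ofReal_ne_zero (hz : z.im ≠ 0) (x : ℝ) : z - (x : ℂ) ≠ 0 := fun h => by
  apply hz
  simpa using congrArg Complex.im h

lemma invSq_le_of_im [IsProbabilityMeasure μ] (hz : z.im ≠ 0) :
    invSq μ z ≤ ENNReal.ofReal (1 / z.im ^ 2) := by
  calc invSq μ z ≤ ∫⁻ _ : ℝ, ENNReal.ofReal (1 / z.im ^ 2) ∂μ := by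
        refine lintegral_mono fun x => ?_
        rw [← ofReal_kernel (sub_ofReal_ne_zero hz x)]
        apply ENNReal.ofReal_le_ofReal
        have := pow_le_pow_left₀ (norm_nonneg _) (norm_kernel_le hz x) 2
        simpa using this
    _ = _ := by simp

lemma invSq_ne_top_of_im [IsProbabilityMeasure μ] (hz : z.im ≠ 0) : invSq μ z ≠ ⊤ :=
  ne_top_of_le_ne_top ENNReal.ofReal_ne_top (invSq_le_of_im hz)

lemma mem_regSet_of_le_im [IsProbabilityMeasure μ] (ht : 0 < t) (hz : t ≤ z.im ^ 2) :
    z ∈ regSet μ t := by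
  have : z.im ≠ 0 := fun h => by rw [h] at hz; linarith
  exact (invSq_le_of_im this).trans (ENNReal.ofReal_le_ofReal (one_div_le_one_div_of_le ht hz))

lemma kernel_eq (α v x : ℝ) :
    ‖((α : ℂ) + (v : ℂ) * Complex.I - (x : ℂ))⁻¹‖ ^ 2 = 1 / ((α - x) ^ 2 + v ^ 2) := by
  rw [norm_inv, inv_pow, Complex.sq_norm, Complex.normSq_apply]
  simp; ring

end Kernel

/-! ### The boundary curve of `Λ_{μ,t}` -/

section Boundary

variable {μ : Measure ℝ} {z w : ℂ} {t α : ℝ}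

lemma differentiableAt_cauchyTransform [IsFiniteMeasure μ] (hz : z.im ≠ 0) :
    DifferentiableAt ℂ (cauchyTransform μ) z := by
  have hz' : z ∉ algebraMap ℝ ℂ '' μ.support := by
    rintro ⟨x, -, rfl⟩
    simp at hz
  have h := (hasDerivAt_resolventTransform (μ := μ) z hz').differentiableAt.neg
  have he : cauchyTransform μ = -resolventTransform μ := by
    ext w
    rw [Pi.neg_apply, resolventTransform_apply, cauchyTransform, ← integral_neg]
    congr 1; ext x
    simp [resolvent, ← inv_neg]
  rwa [he]

/-- Off the real axis the integral equals -Im G_μ(z) / Im z. -/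
lemma continuousAt_integral_kernel [IsProbabilityMeasure μ] (hz : z.im ≠ 0) :
    ContinuousAt (fun z : ℂ => ∫ x : ℝ, ‖(z - (x : ℂ))⁻¹‖ ^ 2 ∂μ) z := by
  have h1 : ContinuousAt (fun z : ℂ => -(cauchyTransform μ z).im / z.im) z :=
    ((Complex.continuous_im.continuousAt.comp
      (differentiableAt_cauchyTransform hz).continuousAt).neg).div
        Complex.continuous_im.continuousAt hz
  refine h1.congr ?_
  filter_upwards [Complex.continuous_im.continuousAt.eventually_ne hz] with w hw
  rw [cauchyTransform_im (invSq_ne_top_of_im hw)]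
  field_simp

lemma integral_kernel_lt [IsProbabilityMeasure μ] {a b : ℝ} (ha : 0 < a) (hab : a < b) :
    ∫ x : ℝ, ‖((α : ℂ) + (b : ℂ) * Complex.I - (x : ℂ))⁻¹‖ ^ 2 ∂μ <
      ∫ x : ℝ, ‖((α : ℂ) + (a : ℂ) * Complex.I - (x : ℂ))⁻¹‖ ^ 2 ∂μ := by
  have hb : 0 < b := ha.trans hab
  have h1 := integrable_kernel_sq (μ := μ) (z := (α : ℂ) + (b : ℂ) * Complex.I)
    (invSq_ne_top_of_im (by simpa using hb.ne'))
  have h2 := integrable_kernel_sq (μ := μ) (z := (α : ℂ) + (a : ℂ) * Complex.I)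
    (invSq_ne_top_of_im (by simpa using ha.ne'))
  have hpos : ∀ x : ℝ, 0 < ‖((α : ℂ) + (a : ℂ) * Complex.I - (x : ℂ))⁻¹‖ ^ 2 -
      ‖((α : ℂ) + (b : ℂ) * Complex.I - (x : ℂ))⁻¹‖ ^ 2 := fun x => by
    rw [kernel_eq, kernel_eq, sub_pos]
    apply one_div_lt_one_div_of_lt <;> nlinarith [sq_nonneg (α - x)]
  rw [← sub_pos, ← integral_sub h2 h1]
  rw [integral_pos_iff_support_of_nonneg (fun x => (hpos x).le) (h2.sub h1)]
  have : Function.support (fun x : ℝ => ‖((α : ℂ) + (a : ℂ) * Complex.I - (x : ℂ))⁻¹‖ ^ 2 -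
      ‖((α : ℂ) + (b : ℂ) * Complex.I - (x : ℂ))⁻¹‖ ^ 2) = univ :=
    eq_univ_of_forall fun x => (hpos x).ne'
  rw [this]; simp

lemma vFun_nonneg : 0 ≤ vFun μ t α := Real.sInf_nonneg fun _ h => h.1.le

lemma mem_vFun_set_iff [IsProbabilityMeasure μ] (ht : 0 < t) {v : ℝ} (hv : 0 < v) :
    ∫ x, 1 / ((α - x) ^ 2 + v ^ 2) ∂μ ≤ 1 / t ↔
      (α : ℂ) + (v : ℂ) * Complex.I ∈ regSet μ t := by
  rw [mem_regSet_iff ht (invSq_ne_top_of_im (by simpa using hv.ne'))]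
  simp only [kernel_eq]

/-- The kernel decreases as |Im z| grows and `regSet` is closed, so the upper half of `regSet` is
exactly the closed epigraph of v. In particular the infimum is attained, even when it is 0, where
the defining set itself contains only positive v. -/
lemma mem_regSet_iff_vFun_le [IsProbabilityMeasure μ] (ht : 0 < t) {v : ℝ} (hv : 0 ≤ v) :
    (α : ℂ) + (v : ℂ) * Complex.I ∈ regSet μ t ↔ vFun μ t α ≤ v := by
  have hbdd : BddBelow {v : ℝ | 0 < v ∧ ∫ x, 1 / ((α - x) ^ 2 + v ^ 2) ∂μ ≤ 1 / t} :=
    ⟨0, fun v hv => hv.1.le⟩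
  have hne : {v : ℝ | 0 < v ∧ ∫ x, 1 / ((α - x) ^ 2 + v ^ 2) ∂μ ≤ 1 / t}.Nonempty := by
    refine ⟨√t, Real.sqrt_pos.2 ht, ?_⟩
    rw [mem_vFun_set_iff ht (Real.sqrt_pos.2 ht)]
    apply mem_regSet_of_le_im ht
    simp [Real.sq_sqrt ht.le]
  have hmono : ∀ a b : ℝ, 0 ≤ a → a ≤ b → (α : ℂ) + (a : ℂ) * Complex.I ∈ regSet μ t →
      (α : ℂ) + (b : ℂ) * Complex.I ∈ regSet μ t := fun a b ha hab h => by
    refine regSet_of_im_le h (by simp) ?_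
    simpa [abs_of_nonneg ha, abs_of_nonneg (ha.trans hab)] using hab
  constructor
  · intro h
    refine le_of_forall_pos_le_add fun ε hε => csInf_le hbdd ⟨by positivity, ?_⟩
    rw [mem_vFun_set_iff ht (by positivity)]
    exact hmono v (v + ε) hv (by linarith) h
  · intro h
    have hev : ∀ b : ℝ, v < b → (α : ℂ) + (b : ℂ) * Complex.I ∈ regSet μ t := fun b hb => by
      obtain ⟨a, ha, hab⟩ := exists_lt_of_csInf_lt hne (lt_of_le_of_lt h hb)
      exact hmono a b ha.1.le hab.le ((mem_vFun_set_iff ht ha.1).1 ha.2)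
    have hlim : Tendsto (fun b : ℝ => (α : ℂ) + (b : ℂ) * Complex.I) (𝓝[>] v)
        (𝓝 ((α : ℂ) + (v : ℂ) * Complex.I)) :=
      (Continuous.tendsto (by fun_prop) v).mono_left nhdsWithin_le_nhds
    refine isClosed_regSet.mem_of_tendsto hlim ?_
    filter_upwards [self_mem_nhdsWithin] with b hb using hev b hb

/-- The boundary point `α + i v_{μ,t}(α)`. -/
noncomputable def bdry (μ : Measure ℝ) (t α : ℝ) : ℂ := (α : ℂ) + (vFun μ t α : ℂ) * Complex.I

@[simp] lemma bdry_re : (bdry μ t α).re = α := by simp [bdry]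

@[simp] lemma bdry_im : (bdry μ t α).im = vFun μ t α := by simp [bdry]

lemma bdry_mem [IsProbabilityMeasure μ] (ht : 0 < t) : bdry μ t α ∈ regSet μ t :=
  (mem_regSet_iff_vFun_le ht vFun_nonneg).2 le_rfl

lemma mem_regSet_iff_notMem_Lam [IsProbabilityMeasure μ] (ht : 0 < t) :
    z ∈ regSet μ t ↔ z ∉ Lam μ t := by
  rw [Lam, mem_ofPred_eq, not_lt, ← mem_regSet_iff_vFun_le ht (abs_nonneg _)]
  constructor <;> intro h <;> exact regSet_of_im_le h (by simp) (by simp)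

/-- Just below the curve the integral exceeds 1/t, and it is continuous off the axis, so it cannot
drop below 1/t on the curve. -/
lemma integral_kernel_bdry [IsProbabilityMeasure μ] (ht : 0 < t) (hv : 0 < vFun μ t α) :
    ∫ x : ℝ, ‖(bdry μ t α - (x : ℂ))⁻¹‖ ^ 2 ∂μ = 1 / t := by
  refine le_antisymm (integral_kernel_le ht (bdry_mem ht)) ?_
  set v := vFun μ t α with hvdef
  have hc : ContinuousAt (fun b : ℝ => ∫ x : ℝ, ‖((α : ℂ) + (b : ℂ) * Complex.I - (x : ℂ))⁻¹‖ ^ 2 ∂μ)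
      v := by
    have h1 : ContinuousAt (fun z : ℂ => ∫ x : ℝ, ‖(z - (x : ℂ))⁻¹‖ ^ 2 ∂μ)
      ((α : ℂ) + (v : ℂ) * Complex.I) := continuousAt_integral_kernel (by simpa using hv.ne')
    exact ContinuousAt.comp (f := fun b : ℝ => (α : ℂ) + (b : ℂ) * Complex.I) h1
      (Continuous.continuousAt (by fun_prop))
  refine ge_of_tendsto (hc.tendsto.mono_left (nhdsWithin_le_nhds (s := Iio v))) ?_
  filter_upwards [self_mem_nhdsWithin,
    mem_nhdsWithin_of_mem_nhds (Ioi_mem_nhds hv)] with b hb hb0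
  have hb' : ¬ (α : ℂ) + (b : ℂ) * Complex.I ∈ regSet μ t := by
    rw [mem_regSet_iff_vFun_le ht (le_of_lt hb0), not_le]; exact hb
  rw [mem_regSet_iff ht (invSq_ne_top_of_im (by simpa using (ne_of_gt hb0)))] at hb'
  exact (not_le.1 hb').le

lemma vFun_eq_of_integral_kernel_eq [IsProbabilityMeasure μ] (ht : 0 < t) {v : ℝ} (hv : 0 < v)
    (h : ∫ x : ℝ, ‖((α : ℂ) + (v : ℂ) * Complex.I - (x : ℂ))⁻¹‖ ^ 2 ∂μ = 1 / t) :
    vFun μ t α = v := by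
  refine le_antisymm ?_ ?_
  · rw [← mem_regSet_iff_vFun_le ht hv.le,
      mem_regSet_iff ht (invSq_ne_top_of_im (by simpa using hv.ne'))]
    exact h.le
  · by_contra! hlt
    obtain ⟨b, hb1, hb2⟩ := exists_between hlt
    have hb0 : 0 < b := vFun_nonneg.trans_lt hb1
    have := (mem_regSet_iff_vFun_le ht hb0.le).2 hb1.le
    rw [mem_regSet_iff ht (invSq_ne_top_of_im (by simpa using hb0.ne'))] at this
    linarith [integral_kernel_lt (μ := μ) (α := α) hb0 hb2]

/-- At a zero of v the integral may be smaller than 1/t, but then both sides vanish; the formula is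
uniform along the curve. -/
lemma cauchyTransform_bdry_im [IsProbabilityMeasure μ] (ht : 0 < t) :
    (cauchyTransform μ (bdry μ t α)).im = -vFun μ t α / t := by
  rw [cauchyTransform_im (ne_top_of_mem_regSet (bdry_mem ht)), bdry_im]
  rcases (vFun_nonneg (μ := μ) (t := t) (α := α)).eq_or_lt with h | h
  · rw [← h]; simp
  · rw [integral_kernel_bdry ht h]; ring

/-- Semicontinuity suffices for v to attain its maximum on a compact interval. -/
lemma upperSemicontinuous_vFun [IsProbabilityMeasure μ] (ht : 0 < t) :
    UpperSemicontinuous (vFun μ t) := by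
  intro α R hR
  obtain ⟨b, hb1, hb2⟩ := exists_between hR
  obtain ⟨a, ha1, ha2⟩ := exists_between hb1
  have ha0 : 0 < a := vFun_nonneg.trans_lt ha1
  have hb0 : 0 < b := ha0.trans ha2
  have hlt : ∫ x : ℝ, ‖((α : ℂ) + (b : ℂ) * Complex.I - (x : ℂ))⁻¹‖ ^ 2 ∂μ < 1 / t :=
    (integral_kernel_lt ha0 ha2).trans_le
      (integral_kernel_le ht ((mem_regSet_iff_vFun_le ht ha0.le).2 ha1.le))
  have h1 : ContinuousAt (fun z : ℂ => ∫ x : ℝ, ‖(z - (x : ℂ))⁻¹‖ ^ 2 ∂μ)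
      ((α : ℂ) + (b : ℂ) * Complex.I) := continuousAt_integral_kernel (by simpa using hb0.ne')
  have hc : ContinuousAt (fun α : ℝ => ∫ x : ℝ, ‖((α : ℂ) + (b : ℂ) * Complex.I - (x : ℂ))⁻¹‖ ^ 2 ∂μ)
      α := ContinuousAt.comp (f := fun α : ℝ => (α : ℂ) + (b : ℂ) * Complex.I) h1
      (Continuous.continuousAt (by fun_prop))
  filter_upwards [hc.eventually_lt continuousAt_const hlt] with α' h'
  refine lt_of_le_of_lt ?_ hb2
  rw [← mem_regSet_iff_vFun_le ht hb0.le,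
    mem_regSet_iff ht (invSq_ne_top_of_im (by simpa using hb0.ne'))]
  exact h'.le

/-! ### The real part of `H_{μ,q}` along the boundary curve -/

/-- The real part of `H_{μ,q}` at the boundary point `α + i v_{μ,t}(α)`. -/
noncomputable def bdryRe (μ : Measure ℝ) (t q α : ℝ) : ℝ := (H μ q (bdry μ t α)).re

variable {q : ℝ}

lemma bdryRe_eq : bdryRe μ t q α = α + q * (cauchyTransform μ (bdry μ t α)).re := by
  simp [bdryRe, H]

lemma H_bdry_im [IsProbabilityMeasure μ] (ht : 0 < t) :
    (H μ q (bdry μ t α)).im = (1 - q / t) * vFun μ t α := by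
  simp only [H, Complex.add_im, bdry_im, Complex.im_ofReal_mul,
    cauchyTransform_bdry_im ht]
  ring

lemma H_bdry_self [IsProbabilityMeasure μ] (ht : 0 < t) :
    H μ t (bdry μ t α) = (bdryRe μ t t α : ℂ) := by
  apply Complex.ext
  · rfl
  · rw [H_bdry_im ht, div_self ht.ne']; simp

lemma norm_sq_cauchyTransform_bdry_sub [IsProbabilityMeasure μ] (ht : 0 < t) (α β : ℝ) :
    ‖cauchyTransform μ (bdry μ t α) - cauchyTransform μ (bdry μ t β)‖ ^ 2 =
      ((cauchyTransform μ (bdry μ t α)).re - (cauchyTransform μ (bdry μ t β)).re) ^ 2 +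
        ((vFun μ t α - vFun μ t β) / t) ^ 2 := by
  rw [Complex.sq_norm, Complex.normSq_apply, Complex.sub_re, Complex.sub_im,
    cauchyTransform_bdry_im ht, cauchyTransform_bdry_im ht]
  ring

lemma norm_sq_bdry_sub (α β : ℝ) :
    ‖bdry μ t α - bdry μ t β‖ ^ 2 = (α - β) ^ 2 + (vFun μ t α - vFun μ t β) ^ 2 := by
  rw [Complex.sq_norm, Complex.normSq_apply, Complex.sub_re, Complex.sub_im]
  simp; ring

/-- In the squared Lipschitz estimate between two points of the curve, the imaginary parts
contribute ((v(α) - v(β))/t)² to both sides. Cancelling them leaves a bound for the real parts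
alone. -/
lemma abs_cauchyTransform_bdry_re_sub_le [IsProbabilityMeasure μ] (ht : 0 < t) (α β : ℝ) :
    |(cauchyTransform μ (bdry μ t α)).re - (cauchyTransform μ (bdry μ t β)).re| ≤ |α - β| / t := by
  have h := norm_cauchyTransform_sub_le ht (bdry_mem (μ := μ) ht (α := α))
    (bdry_mem (μ := μ) ht (α := β))
  have h2 := pow_le_pow_left₀ (norm_nonneg _) h 2
  rw [norm_sq_cauchyTransform_bdry_sub ht, div_pow, div_pow, norm_sq_bdry_sub, add_div] at h2
  rw [← abs_of_pos ht, ← abs_div, abs_of_pos ht]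
  apply sq_le_sq.1
  rw [div_pow]
  linarith

lemma continuous_bdryRe [IsProbabilityMeasure μ] (ht : 0 < t) (q : ℝ) :
    Continuous (bdryRe μ t q) := by
  have : LipschitzWith (1 / t).toNNReal
      fun α => (cauchyTransform μ (bdry μ t α)).re := by
    refine LipschitzWith.of_dist_le_mul fun α β => ?_
    rw [Real.dist_eq, Real.dist_eq]
    refine (abs_cauchyTransform_bdry_re_sub_le ht α β).trans_eq ?_
    rw [Real.coe_toNNReal _ (by positivity)]; ring
  have h : bdryRe μ t q = fun α => α + q * (cauchyTransform μ (bdry μ t α)).re := by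
    ext; exact bdryRe_eq
  rw [h]
  exact continuous_id.add (this.continuous.const_mul q)

lemma abs_bdryRe_sub_le [IsProbabilityMeasure μ] (ht : 0 < t) (q α : ℝ) :
    |bdryRe μ t q α - α| ≤ |q| / √t := by
  rw [bdryRe_eq, add_sub_cancel_left, abs_mul, div_eq_mul_one_div]
  gcongr
  exact (Complex.abs_re_le_norm _).trans (norm_cauchyTransform_le ht (bdry_mem ht))

lemma surjective_bdryRe [IsProbabilityMeasure μ] (ht : 0 < t) (q : ℝ) :
    Function.Surjective (bdryRe μ t q) := by
  refine (continuous_bdryRe ht q).surjective ?_ ?_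
  · refine tendsto_atTop_mono (fun α => ?_) (tendsto_atTop_add_const_right _ (-(|q| / √t)) tendsto_id)
    linarith [(abs_le.1 (abs_bdryRe_sub_le (μ := μ) ht q α)).1, id_eq α]
  · refine tendsto_atBot_mono (fun α => ?_) (tendsto_atBot_add_const_right _ (|q| / √t) tendsto_id)
    linarith [(abs_le.1 (abs_bdryRe_sub_le (μ := μ) ht q α)).2, id_eq α]

lemma monotone_bdryRe [IsProbabilityMeasure μ] (ht : 0 < t) (hq : |q| ≤ t) :
    Monotone (bdryRe μ t q) := by
  intro α β hαβ
  have h := abs_cauchyTransform_bdry_re_sub_le (μ := μ) ht β α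
  rw [abs_of_nonneg (sub_nonneg.2 hαβ)] at h
  rw [bdryRe_eq, bdryRe_eq]
  set d := (cauchyTransform μ (bdry μ t β)).re - (cauchyTransform μ (bdry μ t α)).re with hd
  have h2 : |q * d| ≤ β - α := by
    rw [abs_mul]
    calc |q| * |d| ≤ t * ((β - α) / t) := by gcongr
      _ = β - α := by field_simp
  have := (abs_le.1 h2).1
  have : q * d = q * (cauchyTransform μ (bdry μ t β)).re -
    q * (cauchyTransform μ (bdry μ t α)).re := by rw [hd]; ring
  linarith

lemma eq_dirac_of_ae_eq [IsProbabilityMeasure μ] {c : ℝ} (h : ∀ᵐ x ∂μ, x = c) :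
    μ = Measure.dirac c := by
  have h1 : μ.map id = μ.map fun _ => c := Measure.map_congr h
  simpa using h1

/-- Two points with the same image give equality in the Lipschitz bound and force |q| = t. The
equality case then ties μ-almost every x to one linear equation with coefficient 1 - c. If c ≠ 1
this makes μ a point mass; q = t would give c = 1, which is impossible for distinct α and β. -/
lemma injective_bdryRe [IsProbabilityMeasure μ] (ht : 0 < t) (hq : |q| ≤ t)
    (h : -t < q ∨ ¬ ∃ c : ℝ, μ = Measure.dirac c) : Function.Injective (bdryRe μ t q) := by
  intro α β hαβ
  by_contra hne
  have h1 := abs_cauchyTransform_bdry_re_sub_le (μ := μ) ht α β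
  rw [bdryRe_eq, bdryRe_eq] at hαβ
  set d := (cauchyTransform μ (bdry μ t α)).re - (cauchyTransform μ (bdry μ t β)).re with hd
  have h2 : q * d = -(α - β) := by rw [hd]; linarith
  have hpos : 0 < |α - β| := abs_pos.2 (sub_ne_zero.2 hne)
  have h3 : |q| * |d| = |α - β| := by rw [← abs_mul, h2, abs_neg]
  have hqt : |q| = t := by
    refine le_antisymm hq ?_
    have : |α - β| ≤ |q| * (|α - β| / t) := by
      rw [← h3]; exact mul_le_mul_of_nonneg_left (by rw [h3]; exact h1) (abs_nonneg q)
    rw [← mul_div_assoc, le_div_iff₀ ht] at this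
    nlinarith
  have hq0 : q ≠ 0 := fun h0 => by rw [h0, abs_zero] at hqt; exact ht.ne hqt
  have hq2 : q ^ 2 = t ^ 2 := by rw [← sq_abs, hqt]
  have hdsq : d ^ 2 = (α - β) ^ 2 / t ^ 2 := by
    rw [← hq2, eq_div_iff (pow_ne_zero 2 hq0)]; linear_combination (q * d - (α - β)) * h2
  have hbne : bdry μ t α ≠ bdry μ t β := fun h => hne (by simpa using congrArg Complex.re h)
  have heq : ‖cauchyTransform μ (bdry μ t α) - cauchyTransform μ (bdry μ t β)‖ =
      ‖bdry μ t α - bdry μ t β‖ / t := by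
    rw [← sq_eq_sq₀ (norm_nonneg _) (by positivity), norm_sq_cauchyTransform_bdry_sub ht, div_pow,
      div_pow, norm_sq_bdry_sub, ← hd, hdsq]
    ring
  obtain ⟨c, -, hc2, hc3⟩ := eq_of_norm_cauchyTransform_sub_eq ht (bdry_mem ht) (bdry_mem ht)
    hbne heq
  have hc1 : c ≠ 1 := by
    rintro rfl
    obtain ⟨x, hx⟩ := hc3.exists
    have := congrArg Complex.re hx
    simp at this
    exact hne this.symm
  have hdirac : ∃ c : ℝ, μ = Measure.dirac c := by
    refine ⟨((((starRingEnd ℂ) (bdry μ t β) - c * bdry μ t α) / (1 - c)).re),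
      eq_dirac_of_ae_eq ?_⟩
    filter_upwards [hc3] with x hx
    have hx' : (x : ℂ) = ((starRingEnd ℂ) (bdry μ t β) - c * bdry μ t α) / (1 - c) := by
      rw [eq_div_iff (sub_ne_zero.2 hc1.symm)]
      linear_combination -hx
    rw [← hx', Complex.ofReal_re]
  rcases h with h | h
  · have hqt' : q = t := by
      rcases abs_choice q with h' | h' <;> rw [hqt] at h' <;> linarith
    apply hc1
    rw [hqt'] at h2
    have hz : bdry μ t α - bdry μ t β ≠ 0 := sub_ne_zero.2 hbne
    have key : (t : ℂ) * (cauchyTransform μ (bdry μ t α) - cauchyTransform μ (bdry μ t β)) =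
        -(bdry μ t α - bdry μ t β) := by
      apply Complex.ext
      · rw [Complex.re_ofReal_mul, Complex.sub_re, ← hd, h2]; simp
      · rw [Complex.im_ofReal_mul, Complex.sub_im, cauchyTransform_bdry_im ht,
          cauchyTransform_bdry_im ht]
        simp; field_simp; ring
    rw [key] at hc2
    exact (mul_left_cancel₀ (neg_ne_zero.2 hz) (by rw [mul_one]; exact hc2)).symm
  · exact h hdirac

lemma bijective_bdryRe [IsProbabilityMeasure μ] (ht : 0 < t) (hq : |q| ≤ t)
    (h : -t < q ∨ ¬ ∃ c : ℝ, μ = Measure.dirac c) : Function.Bijective (bdryRe μ t q) :=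
  ⟨injective_bdryRe ht hq h, surjective_bdryRe ht q⟩

lemma strictMono_bdryRe [IsProbabilityMeasure μ] (ht : 0 < t) (hq : |q| ≤ t)
    (h : -t < q ∨ ¬ ∃ c : ℝ, μ = Measure.dirac c) : StrictMono (bdryRe μ t q) :=
  (monotone_bdryRe ht hq).strictMono_of_injective (injective_bdryRe ht hq h)

end Boundary

/-! ### Subordination -/

section Subordination

variable {μ ν : Measure ℝ} {z w : ℂ} {u s : ℝ}

lemma H_im [IsFiniteMeasure μ] (h : invSq μ z ≠ ⊤) (q : ℝ) :
    (H μ q z).im = z.im * (1 - q * ∫ x : ℝ, ‖(z - (x : ℂ))⁻¹‖ ^ 2 ∂μ) := by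
  rw [H, Complex.add_im, Complex.im_ofReal_mul, cauchyTransform_im h]; ring

lemma analyticOnNhd_cauchyTransform [IsFiniteMeasure μ] :
    AnalyticOnNhd ℂ (cauchyTransform μ) {z | 0 < z.im} := by
  refine DifferentiableOn.analyticOnNhd (fun z hz => ?_)
    (isOpen_lt continuous_const Complex.continuous_im)
  exact (differentiableAt_cauchyTransform (ne_of_gt hz)).differentiableWithinAt

lemma analyticOnNhd_H [IsFiniteMeasure μ] (q : ℝ) :
    AnalyticOnNhd ℂ (H μ q) {z | 0 < z.im} :=
  analyticOnNhd_id.add (analyticOnNhd_const.mul analyticOnNhd_cauchyTransform)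

lemma H_neg_im_pos [IsProbabilityMeasure μ] (hu : 0 ≤ u) (hz : 0 < z.im) :
    0 < (H μ (-u) z).im := by
  rw [H_im (invSq_ne_top_of_im hz.ne')]
  have := integral_kernel_nonneg (μ := μ) (z := z)
  have : 0 ≤ u * ∫ x : ℝ, ‖(z - (x : ℂ))⁻¹‖ ^ 2 ∂μ := by positivity
  apply mul_pos hz; linarith

/-- The perturbation uG_μ of the identity has Lipschitz constant u/s < 1. -/
lemma H_injOn_regSet [IsProbabilityMeasure μ] (hu : 0 ≤ u) (hus : u < s) :
    InjOn (H μ u) (regSet μ s) := by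
  intro z hz w hw h
  have hs : 0 < s := hu.trans_lt hus
  have h1 := norm_cauchyTransform_sub_le hs hz hw
  have h2 : z - w = -(u * (cauchyTransform μ z - cauchyTransform μ w)) := by
    simp only [H] at h; linear_combination h
  have h3 : ‖z - w‖ ≤ u * (‖z - w‖ / s) := by
    nth_rewrite 1 [h2]
    rw [norm_neg, norm_mul, Complex.norm_real, Real.norm_of_nonneg hu]
    gcongr
  by_contra hne
  have hpos : 0 < ‖z - w‖ := norm_pos_iff.2 (sub_ne_zero.2 hne)
  rw [← mul_div_assoc, le_div_iff₀ hs] at h3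
  nlinarith

/-- `μ` is subordinated to `ν` near infinity: `G_μ ∘ H_{ν,u} = G_ν`. -/
def SubordinateAtInfinity (μ ν : Measure ℝ) (u : ℝ) : Prop :=
  ∀ᶠ w in Bornology.cobounded ℂ, cauchyTransform μ (H ν u w) = cauchyTransform ν w

/-- Analytic continuation. The relation is rewritten through H_{μ,-u}, which maps the whole upper
half-plane into itself, whereas H_{ν,u} may leave it. The rewritten identity holds on the image
under H_{ν,u} of a neighbourhood of a high point, and this image is a neighbourhood of the image
point by the open mapping theorem. -/
theorem SubordinateAtInfinity.cauchyTransform_eq [IsProbabilityMeasure μ] [IsProbabilityMeasure ν]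
    (hsub : SubordinateAtInfinity μ ν u) (hu : 0 ≤ u) (hz : 0 < z.im) :
    cauchyTransform ν (H μ (-u) z) = cauchyTransform μ z := by
  obtain ⟨R, hR⟩ : ∃ R : ℝ, ∀ w : ℂ, R < ‖w‖ →
      cauchyTransform μ (H ν u w) = cauchyTransform ν w := by
    have := (hasBasis_cobounded_norm (E := ℂ)).eventually_iff.1 hsub
    obtain ⟨R, -, h⟩ := this
    exact ⟨R, fun w hw => h hw.le⟩
  -- Above height Y the relation at infinity applies. There also (Im w)² ≥ u + 1, so H_{ν,u} is
  -- injective and keeps positive imaginary part.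
  set Y := max R (u + 1) + 1 with hY
  have hYR : R < Y := by linarith [le_max_left R (u + 1)]
  have hYu : u + 1 < Y := by linarith [le_max_right R (u + 1)]
  set w₀ : ℂ := (Y + 1 : ℝ) * Complex.I with hw₀
  have hw₀im : w₀.im = Y + 1 := by simp [hw₀]
  have hnear : ∀ᶠ w in 𝓝 w₀, Y < w.im :=
    Complex.continuous_im.continuousAt.eventually (lt_mem_nhds (by rw [hw₀im]; linarith))
  have hreg : ∀ w : ℂ, Y < w.im → w ∈ regSet ν (u + 1) := fun w hw => by
    apply mem_regSet_of_le_im (by linarith)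
    nlinarith
  have himpos : ∀ w : ℂ, Y < w.im → 0 < (H ν u w).im := fun w hw => by
    rw [H_im (ne_top_of_mem_regSet (hreg w hw))]
    have h1 := integral_kernel_le (by linarith) (hreg w hw)
    have h2 : u * (1 / (u + 1)) < 1 := by
      rw [mul_one_div, div_lt_one (by linarith)]; linarith
    have h3 := mul_le_mul_of_nonneg_left h1 hu
    apply mul_pos (by linarith); linarith
  have hopen : 𝓝 (H ν u w₀) ≤ map (H ν u) (𝓝 w₀) := by
    rcases (analyticOnNhd_H (μ := ν) u w₀ (by
      show 0 < w₀.im; linarith)).eventually_constant_or_nhds_le_map_nhds with h | h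
    · exfalso
      have h1 := (h.and hnear)
      have h2 : ∀ᶠ w in 𝓝 w₀, w = w₀ := by
        filter_upwards [h1] with w hw
        exact H_injOn_regSet hu (by linarith : u < u + 1) (hreg w hw.2)
          (hreg w₀ (by rw [hw₀im]; linarith)) hw.1
      have h3 : ∀ᶠ w in 𝓝[≠] w₀, False := by
        filter_upwards [nhdsWithin_le_nhds h2, self_mem_nhdsWithin] with w h h' using h' h
      exact (NeBot.ne inferInstance (Filter.eventually_false_iff_eq_bot.1 h3))
    · exact h
  have hev : ∀ᶠ z in 𝓝 (H ν u w₀), cauchyTransform ν (H μ (-u) z) = cauchyTransform μ z := by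
    apply hopen
    rw [mem_map]
    filter_upwards [hnear] with w hw
    have h1 := hR w (by
      have := Complex.abs_im_le_norm w
      rw [abs_of_pos (by linarith)] at this; linarith)
    show cauchyTransform ν (H μ (-u) (H ν u w)) = cauchyTransform μ (H ν u w)
    rw [h1]
    congr 1
    rw [H, h1, H]; push_cast; ring
  have hA : AnalyticOnNhd ℂ (fun z => cauchyTransform ν (H μ (-u) z)) {z | 0 < z.im} :=
    analyticOnNhd_cauchyTransform.comp (analyticOnNhd_H (-u)) fun z hz => H_neg_im_pos hu hz
  exact hA.eqOn_of_preconnected_of_eventuallyEq analyticOnNhd_cauchyTransform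
    (convex_halfSpace_im_gt 0).isPreconnected
    (himpos w₀ (by rw [hw₀im]; linarith)) hev hz

theorem SubordinateAtInfinity.H_H_neg [IsProbabilityMeasure μ] [IsProbabilityMeasure ν]
    (hsub : SubordinateAtInfinity μ ν u) (hu : 0 ≤ u) (hz : 0 < z.im) :
    H ν u (H μ (-u) z) = z := by
  rw [H, hsub.cauchyTransform_eq hu hz, H]; push_cast; ring

/-- Positivity of Im H_{ν,u}(w) says that the square integral is strictly below 1/u, which leaves
room for a level s > u. -/
lemma mem_regSet_of_H_im_pos [IsProbabilityMeasure ν] (hu : 0 < u) (hw : 0 < w.im)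
    (h : 0 < (H ν u w).im) : ∃ s, u < s ∧ w ∈ regSet ν s := by
  have hfin := invSq_ne_top_of_im (μ := ν) hw.ne'
  rw [H_im hfin] at h
  set F := ∫ x : ℝ, ‖(w - (x : ℂ))⁻¹‖ ^ 2 ∂ν with hF
  have hF0 : 0 ≤ F := integral_kernel_nonneg
  have h1 : u * F < 1 := by
    by_contra! hc
    nlinarith [mul_nonneg hw.le (sub_nonneg.2 hc)]
  set F' := (F + 1 / u) / 2 with hF'
  have hFu : F < 1 / u := by rw [lt_div_iff₀ hu]; linarith
  have hF'0 : 0 < F' := by positivity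
  refine ⟨1 / F', ?_, ?_⟩
  · rw [lt_one_div hu hF'0]; linarith
  · rw [mem_regSet_iff (by positivity) hfin, ← hF, one_div_one_div]; linarith

/-- The points w and H_{μ,-u}(H_{ν,u}(w)) have the same image under H_{ν,u}. Both lie in a regular
set of level greater than u, where that map is injective, so they coincide. -/
theorem SubordinateAtInfinity.cauchyTransform_H [IsProbabilityMeasure μ] [IsProbabilityMeasure ν]
    (hsub : SubordinateAtInfinity μ ν u) (hu : 0 ≤ u) (hw : 0 < w.im) (h : 0 < (H ν u w).im) :
    cauchyTransform μ (H ν u w) = cauchyTransform ν w := by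
  have h1 := H_neg_im_pos (μ := μ) hu h
  have h2 := hsub.H_H_neg hu h
  have h3 : H μ (-u) (H ν u w) = w := by
    rcases hu.eq_or_lt with rfl | hu'
    · simp [H]
    · obtain ⟨s₁, hs₁, hm₁⟩ := mem_regSet_of_H_im_pos hu' h1 (by rw [h2]; exact h)
      obtain ⟨s₂, hs₂, hm₂⟩ := mem_regSet_of_H_im_pos hu' hw h
      have hmono : ∀ {a b : ℝ}, 0 < a → a ≤ b → regSet ν b ⊆ regSet ν a := fun ha hab x hx =>
        le_trans hx (ENNReal.ofReal_le_ofReal (one_div_le_one_div_of_le ha hab))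
      have hm : u < min s₁ s₂ := lt_min hs₁ hs₂
      exact H_injOn_regSet hu hm (hmono (by linarith) (min_le_left _ _) hm₁)
        (hmono (by linarith) (min_le_right _ _) hm₂) h2
  rw [← hsub.cauchyTransform_eq hu h, h3]

/-! ### Transport of the boundary curve -/

variable {r α : ℝ}

/-- Write F and F' for the square integrals of ν at w and of μ at H_{ν,u}(w). Comparing imaginary
parts in the subordination relation gives (1 - uF)F' = F, which turns F ≤ 1/(u + r) into F' ≤ 1/r.
-/
theorem SubordinateAtInfinity.H_mem_regSet [IsProbabilityMeasure μ] [IsProbabilityMeasure ν]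
    (hsub : SubordinateAtInfinity μ ν u) (hu : 0 ≤ u) (hr : 0 < r) (hwim : 0 < w.im)
    (hw : w ∈ regSet ν (u + r)) :
    0 < (H ν u w).im ∧ H ν u w ∈ regSet μ r ∧ cauchyTransform μ (H ν u w) = cauchyTransform ν w := by
  set s := u + r with hs
  have hs0 : 0 < s := by linarith
  have hfin := invSq_ne_top_of_im (μ := ν) hwim.ne'
  set F := ∫ x : ℝ, ‖(w - (x : ℂ))⁻¹‖ ^ 2 ∂ν with hF
  have hFle : F ≤ 1 / s := integral_kernel_le hs0 hw
  have hF0 : 0 ≤ F := integral_kernel_nonneg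
  have hsF : s * F ≤ 1 := by rw [le_div_iff₀ hs0] at hFle; linarith
  have huF : 0 < 1 - u * F := by
    rcases hF0.eq_or_lt with h | h
    · rw [← h]; simp
    · rw [hs] at hsF; nlinarith
  have him : (H ν u w).im = w.im * (1 - u * F) := H_im hfin u
  have hpos : 0 < (H ν u w).im := by rw [him]; positivity
  have hG := hsub.cauchyTransform_H hu hwim hpos
  refine ⟨hpos, ?_, hG⟩
  have hfin' := invSq_ne_top_of_im (μ := μ) hpos.ne'
  rw [mem_regSet_iff hr hfin']
  have h1 := congrArg Complex.im hG
  rw [cauchyTransform_im hfin', cauchyTransform_im hfin, him, ← hF] at h1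
  set F' := ∫ x : ℝ, ‖(H ν u w - (x : ℂ))⁻¹‖ ^ 2 ∂μ
  have h2 : (1 - u * F) * F' = F := by
    have : w.im * ((1 - u * F) * F' - F) = 0 := by linear_combination -h1
    rcases mul_eq_zero.1 this with h | h <;> linarith
  rw [le_div_iff₀ hr]
  have h3 : (1 - u * F) * (F' * r) ≤ (1 - u * F) * 1 := by
    rw [← mul_assoc, h2]; rw [hs] at hsF; linarith
  exact le_of_mul_le_mul_left h3 huF

/-- A boundary point may be real, outside the reach of the half-plane statement. It is approached
from above by adding iε; the limit exists because regular sets are closed and G is Lipschitz on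
them. -/
theorem SubordinateAtInfinity.H_bdry_mem_regSet [IsProbabilityMeasure μ] [IsProbabilityMeasure ν]
    (hsub : SubordinateAtInfinity μ ν u) (hu : 0 ≤ u) (hr : 0 < r) :
    H ν u (bdry ν (u + r) α) ∈ regSet μ r ∧
      cauchyTransform μ (H ν u (bdry ν (u + r) α)) = cauchyTransform ν (bdry ν (u + r) α) := by
  set s := u + r with hs
  have hs0 : 0 < s := by linarith
  have hGν : ∀ ε : ℝ, 0 < ε → (bdry ν s α + ε * Complex.I) ∈ regSet ν s := fun ε hε => by
    refine regSet_of_im_le (bdry_mem hs0 (α := α)) (by simp) ?_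
    have := vFun_nonneg (μ := ν) (t := s) (α := α)
    simp only [bdry_im, Complex.add_im, Complex.mul_im, Complex.ofReal_re, Complex.I_im,
      Complex.ofReal_im, Complex.I_re, mul_zero, add_zero, mul_one]
    rw [abs_of_nonneg this, abs_of_nonneg (by linarith)]; linarith
  have hε : ∀ ε : ℝ, 0 < ε → H ν u (bdry ν s α + ε * Complex.I) ∈ regSet μ r ∧
      cauchyTransform μ (H ν u (bdry ν s α + ε * Complex.I)) =
        cauchyTransform ν (bdry ν s α + ε * Complex.I) := fun ε hε =>
    (hsub.H_mem_regSet hu hr (by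
      have := vFun_nonneg (μ := ν) (t := s) (α := α)
      simp; linarith) (hGν ε hε)).2
  have hlim : Tendsto (fun ε : ℝ => bdry ν s α + ε * Complex.I) (𝓝[>] 0) (𝓝 (bdry ν s α)) := by
    have : Tendsto (fun ε : ℝ => bdry ν s α + ε * Complex.I) (𝓝 0)
        (𝓝 (bdry ν s α + (0 : ℝ) * Complex.I)) := Continuous.tendsto (by fun_prop) 0
    simp only [Complex.ofReal_zero, zero_mul, add_zero] at this
    exact this.mono_left nhdsWithin_le_nhds
  have hcont : ∀ {ρ : Measure ℝ} [IsProbabilityMeasure ρ] {c : ℝ} (_ : 0 < c),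
      ContinuousOn (cauchyTransform ρ) (regSet ρ c) := fun {ρ} _ {c} hc => by
    have : LipschitzOnWith (1 / c).toNNReal (cauchyTransform ρ) (regSet ρ c) := by
      refine LipschitzOnWith.of_dist_le_mul fun x hx y hy => ?_
      rw [dist_eq_norm, dist_eq_norm, Real.coe_toNNReal _ (by positivity)]
      refine (norm_cauchyTransform_sub_le hc hx hy).trans_eq (by ring)
    exact this.continuousOn
  have hlimν : Tendsto (fun ε : ℝ => cauchyTransform ν (bdry ν s α + ε * Complex.I)) (𝓝[>] 0)
      (𝓝 (cauchyTransform ν (bdry ν s α))) :=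
    (hcont hs0 _ (bdry_mem hs0)).tendsto.comp (tendsto_nhdsWithin_iff.2 ⟨hlim, by
      filter_upwards [self_mem_nhdsWithin] with ε hε' using hGν ε hε'⟩)
  have hlimH : Tendsto (fun ε : ℝ => H ν u (bdry ν s α + ε * Complex.I)) (𝓝[>] 0)
      (𝓝 (H ν u (bdry ν s α))) := hlim.add (hlimν.const_mul _)
  have hmem : H ν u (bdry ν s α) ∈ regSet μ r := by
    refine isClosed_regSet.mem_of_tendsto hlimH ?_
    filter_upwards [self_mem_nhdsWithin] with ε hε' using (hε ε hε').1
  refine ⟨hmem, ?_⟩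
  have hlimμ : Tendsto (fun ε : ℝ => cauchyTransform μ (H ν u (bdry ν s α + ε * Complex.I)))
      (𝓝[>] 0) (𝓝 (cauchyTransform μ (H ν u (bdry ν s α)))) :=
    (hcont hr _ hmem).tendsto.comp (tendsto_nhdsWithin_iff.2 ⟨hlimH, by
      filter_upwards [self_mem_nhdsWithin] with ε hε' using (hε ε hε').1⟩)
  refine tendsto_nhds_unique (hlimμ.congr' ?_) hlimν
  filter_upwards [self_mem_nhdsWithin] with ε hε' using (hε ε hε').2

theorem SubordinateAtInfinity.vFun_bdryRe [IsProbabilityMeasure μ] [IsProbabilityMeasure ν]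
    (hsub : SubordinateAtInfinity μ ν u) (hu : 0 ≤ u) (hr : 0 < r) :
    vFun μ r (bdryRe ν (u + r) u α) = r / (u + r) * vFun ν (u + r) α := by
  have hs0 : 0 < u + r := by linarith
  obtain ⟨hmem, hG⟩ := hsub.H_bdry_mem_regSet hu hr (α := α)
  have him : (H ν u (bdry ν (u + r) α)).im = r / (u + r) * vFun ν (u + r) α := by
    rw [H_bdry_im hs0]; field_simp; ring
  have heq : H ν u (bdry ν (u + r) α) = ((bdryRe ν (u + r) u α : ℝ) : ℂ) +
      ((r / (u + r) * vFun ν (u + r) α : ℝ) : ℂ) * Complex.I := by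
    rw [← him]; exact (Complex.re_add_im _).symm
  rcases (vFun_nonneg (μ := ν) (t := u + r) (α := α)).eq_or_lt with h0 | hpos
  · rw [← h0, mul_zero] at heq ⊢
    rw [heq] at hmem
    exact le_antisymm ((mem_regSet_iff_vFun_le hr le_rfl).1 hmem) vFun_nonneg
  · have hv : 0 < r / (u + r) * vFun ν (u + r) α := by positivity
    apply vFun_eq_of_integral_kernel_eq hr hv
    rw [← heq]
    have h1 := congrArg Complex.im hG
    rw [cauchyTransform_im (ne_top_of_mem_regSet hmem), cauchyTransform_bdry_im hs0, him] at h1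
    have hne := hpos.ne'
    field_simp at h1 ⊢
    linarith

theorem SubordinateAtInfinity.bdry_bdryRe [IsProbabilityMeasure μ] [IsProbabilityMeasure ν]
    (hsub : SubordinateAtInfinity μ ν u) (hu : 0 ≤ u) (hr : 0 < r) :
    bdry μ r (bdryRe ν (u + r) u α) = H ν u (bdry ν (u + r) α) := by
  have hs0 : 0 < u + r := by linarith
  apply Complex.ext
  · rw [bdry_re]; rfl
  · rw [bdry_im, hsub.vFun_bdryRe hu hr, H_bdry_im hs0]; field_simp; ring

/-- H_{ν,u} adds u times G_ν and H_{μ,-r} subtracts r times G_μ. Along the curve these are values of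
the same function, so the composition is H_{ν,u-r}. -/
theorem SubordinateAtInfinity.aFun_bdryRe [IsProbabilityMeasure μ] [IsProbabilityMeasure ν]
    (hsub : SubordinateAtInfinity μ ν u) (hu : 0 ≤ u) (hr : 0 < r) :
    aFun μ r (bdryRe ν (u + r) u α) = bdryRe ν (u + r) (u - r) α := by
  show bdryRe μ r (-r) (bdryRe ν (u + r) u α) = _
  rw [bdryRe_eq, hsub.bdry_bdryRe hu hr, (hsub.H_bdry_mem_regSet hu hr).2, bdryRe_eq, bdryRe_eq]
  ring

end Subordination

/-! ### The Cauchy transform of the semicircle law -/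

section Semicircle

/-- The generating function of the Chebyshev polynomials of the second kind, multiplied by sin θ.
The denominator factors as (1 - ζe^{iθ})(1 - ζe^{-iθ}). -/
lemma hasSum_sin_geometric {ζ : ℂ} (hζ : ‖ζ‖ < 1) (θ : ℝ) :
    HasSum (fun n : ℕ => ζ ^ n * (Real.sin ((n + 1) * θ) : ℂ))
      ((Real.sin θ : ℂ) * (1 - 2 * ζ * (Real.cos θ : ℂ) + ζ ^ 2)⁻¹) := by
  set e : ℂ := Complex.exp (θ * Complex.I) with he
  set e' : ℂ := Complex.exp (-θ * Complex.I) with he'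
  have hee : e * e' = 1 := by rw [he, he', ← Complex.exp_add]; simp
  have hne : ‖e‖ = 1 := Complex.norm_exp_ofReal_mul_I θ
  have hne' : ‖e'‖ = 1 := by
    have := Complex.norm_exp_ofReal_mul_I (-θ)
    rwa [Complex.ofReal_neg] at this
  have h1 : ‖ζ * e‖ < 1 := by rwa [norm_mul, hne, mul_one]
  have h2 : ‖ζ * e'‖ < 1 := by rwa [norm_mul, hne', mul_one]
  have hd1 : 1 - ζ * e ≠ 0 := fun h => by
    rw [sub_eq_zero] at h; rw [← h] at h1; simp at h1
  have hd2 : 1 - ζ * e' ≠ 0 := fun h => by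
    rw [sub_eq_zero] at h; rw [← h] at h2; simp at h2
  have hs := (((hasSum_geometric_of_norm_lt_one h2).mul_left e').sub
    ((hasSum_geometric_of_norm_lt_one h1).mul_left e)).mul_right (Complex.I / 2)
  have hsin : (Real.sin θ : ℂ) = (e' - e) * Complex.I / 2 := by
    rw [Complex.ofReal_sin, Complex.sin]
  have hcos : (Real.cos θ : ℂ) = (e + e') / 2 := by
    rw [Complex.ofReal_cos, Complex.cos]
  have hfun : ∀ n : ℕ, ζ ^ n * (Real.sin ((n + 1) * θ) : ℂ) =
      (e' * (ζ * e') ^ n - e * (ζ * e) ^ n) * (Complex.I / 2) := fun n => by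
    have h3 : Complex.exp (-(((n : ℂ) + 1) * θ) * Complex.I) = e' ^ (n + 1) := by
      rw [he', ← Complex.exp_nat_mul]; congr 1; push_cast; ring
    have h4 : Complex.exp (((n : ℂ) + 1) * θ * Complex.I) = e ^ (n + 1) := by
      rw [he, ← Complex.exp_nat_mul]; congr 1; push_cast; ring
    rw [Complex.ofReal_sin, Complex.sin]
    push_cast
    rw [h3, h4]
    ring
  have hval : (Real.sin θ : ℂ) * (1 - 2 * ζ * (Real.cos θ : ℂ) + ζ ^ 2)⁻¹ =
      (e' * (1 - ζ * e')⁻¹ - e * (1 - ζ * e)⁻¹) * (Complex.I / 2) := by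
    have hden : 1 - 2 * ζ * (Real.cos θ : ℂ) + ζ ^ 2 = (1 - ζ * e) * (1 - ζ * e') := by
      rw [hcos]; linear_combination (-ζ ^ 2) * hee
    rw [hden, hsin, mul_inv]
    have h3 : e' * (1 - ζ * e')⁻¹ - e * (1 - ζ * e)⁻¹ =
        (e' - e) * ((1 - ζ * e)⁻¹ * (1 - ζ * e')⁻¹) := by
      linear_combination (-e' * (1 - ζ * e')⁻¹) * mul_inv_cancel₀ hd1 +
        (e * (1 - ζ * e)⁻¹) * mul_inv_cancel₀ hd2
    rw [h3]; ring
  simp only [hfun, hval]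
  exact hs

lemma integral_cos_nat_mul {k : ℕ} (hk : k ≠ 0) : ∫ θ in (0 : ℝ)..Real.pi, Real.cos (k * θ) = 0 := by
  have hk' : (k : ℝ) ≠ 0 := by exact_mod_cast hk
  rw [intervalIntegral.integral_comp_mul_left (fun x => Real.cos x) hk']
  simp [Real.sin_nat_mul_pi]

lemma integral_sin_mul_sin (n : ℕ) :
    ∫ θ in (0 : ℝ)..Real.pi, Real.sin θ * Real.sin ((n + 1) * θ) =
      if n = 0 then Real.pi / 2 else 0 := by
  have h : ∀ θ : ℝ, Real.sin θ * Real.sin ((n + 1) * θ) =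
      Real.cos (n * θ) / 2 - Real.cos ((n + 2 : ℕ) * θ) / 2 := fun θ => by
    have h1 : (n : ℝ) * θ = (n + 1) * θ - θ := by ring
    have h2 : ((n + 2 : ℕ) : ℝ) * θ = (n + 1) * θ + θ := by push_cast; ring
    rw [h1, h2, Real.cos_sub, Real.cos_add]; ring
  simp only [h]
  rw [intervalIntegral.integral_sub (Continuous.intervalIntegrable (by fun_prop) _ _)
    (Continuous.intervalIntegrable (by fun_prop) _ _), intervalIntegral.integral_div,
    intervalIntegral.integral_div, integral_cos_nat_mul (Nat.succ_ne_zero _)]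
  split_ifs with hn
  · subst hn; simp
  · rw [integral_cos_nat_mul hn]; simp

/-- By orthogonality of the sines only the term n = 0 of the series survives, so the value does not
depend on ζ. -/
lemma integral_sin_sq_div {ζ : ℂ} (hζ : ‖ζ‖ < 1) :
    ∫ θ in (0 : ℝ)..Real.pi,
      (Real.sin θ : ℂ) * ((Real.sin θ : ℂ) * (1 - 2 * ζ * (Real.cos θ : ℂ) + ζ ^ 2)⁻¹) =
        Real.pi / 2 := by
  have h := intervalIntegral.hasSum_integral_of_dominated_convergence (μ := volume)
    (a := 0) (b := Real.pi)
    (F := fun (n : ℕ) (θ : ℝ) => (Real.sin θ : ℂ) * (ζ ^ n * (Real.sin ((n + 1) * θ) : ℂ)))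
    (f := fun θ : ℝ =>
      (Real.sin θ : ℂ) * ((Real.sin θ : ℂ) * (1 - 2 * ζ * (Real.cos θ : ℂ) + ζ ^ 2)⁻¹))
    (fun n _ => ‖ζ‖ ^ n) (fun n => (by fun_prop : Continuous _).aestronglyMeasurable)
    (fun n => ae_of_all _ fun θ _ => by
      rw [norm_mul, norm_mul, norm_pow, Complex.norm_real, Complex.norm_real]
      have h1 := Real.abs_sin_le_one θ
      have h2 := Real.abs_sin_le_one ((n + 1) * θ)
      rw [Real.norm_eq_abs, Real.norm_eq_abs]
      calc _ ≤ 1 * (‖ζ‖ ^ n * 1) := by gcongr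
        _ = _ := by ring)
    (ae_of_all _ fun θ _ => summable_geometric_of_lt_one (norm_nonneg _) hζ)
    (by simp)
    (ae_of_all _ fun θ _ => (hasSum_sin_geometric hζ θ).mul_left _)
  refine h.unique ?_
  have h2 : ∀ n : ℕ, ∫ θ in (0 : ℝ)..Real.pi,
      (Real.sin θ : ℂ) * (ζ ^ n * (Real.sin ((n + 1) * θ) : ℂ)) =
        if n = 0 then (Real.pi / 2 : ℂ) else 0 := fun n => by
    have : ∀ θ : ℝ, (Real.sin θ : ℂ) * (ζ ^ n * (Real.sin ((n + 1) * θ) : ℂ)) =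
        ζ ^ n * ((Real.sin θ * Real.sin ((n + 1) * θ) : ℝ) : ℂ) := fun θ => by push_cast; ring
    simp only [this]
    rw [intervalIntegral.integral_const_mul, intervalIntegral.integral_ofReal, integral_sin_mul_sin]
    split_ifs with hn
    · subst hn; simp
    · simp
  simp only [h2]
  exact hasSum_ite_eq 0 _

/-- The Cauchy transform of the semicircle law of variance `u` is inverse to `g ↦ g⁻¹ + u g`. -/
theorem cauchyTransform_semicircleLaw {u : ℝ} (hu : 0 ≤ u) {g : ℂ} (hg0 : g ≠ 0)
    (hg : u * ‖g‖ ^ 2 < 1) : cauchyTransform (semicircleLaw u) (g⁻¹ + u * g) = g := by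
  rcases hu.eq_or_lt with rfl | hu
  · simp [cauchyTransform, semicircleLaw]
  set r := √u with hr
  have hr0 : 0 < r := Real.sqrt_pos.2 hu
  have hr2 : r ^ 2 = u := Real.sq_sqrt hu.le
  set ω : ℂ := g⁻¹ + u * g with hω
  set ζ : ℂ := r * g with hζdef
  have hζ : ‖ζ‖ < 1 := by
    rw [hζdef, norm_mul, Complex.norm_real, Real.norm_of_nonneg hr0.le]
    rw [← hr2, ← mul_pow] at hg
    exact (sq_lt_one_iff₀ (by positivity)).1 hg
  have hden : ∀ θ : ℝ, 1 - 2 * ζ * (Real.cos θ : ℂ) + ζ ^ 2 ≠ 0 := fun θ h => by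
    have h1 : ω - ((2 * r * Real.cos θ : ℝ) : ℂ) = 0 := by
      have hu' : (u : ℂ) = (r : ℂ) ^ 2 := by rw [← hr2]; push_cast; rfl
      rw [hω, hu']
      have : g * (g⁻¹ + (r : ℂ) ^ 2 * g - ((2 * r * Real.cos θ : ℝ) : ℂ)) =
          1 - 2 * ζ * (Real.cos θ : ℂ) + ζ ^ 2 := by
        push_cast; rw [hζdef]; field_simp; ring
      rw [h] at this
      exact (mul_eq_zero.1 this).resolve_left hg0
    set e : ℂ := Complex.exp (θ * Complex.I) with he
    set e' : ℂ := Complex.exp (-θ * Complex.I) with he'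
    have hee : e * e' = 1 := by rw [he, he', ← Complex.exp_add]; simp
    have hne : ‖e‖ = 1 := Complex.norm_exp_ofReal_mul_I θ
    have hne' : ‖e'‖ = 1 := by
      have := Complex.norm_exp_ofReal_mul_I (-θ)
      rwa [Complex.ofReal_neg] at this
    have hcos : (Real.cos θ : ℂ) = (e + e') / 2 := by
      rw [Complex.ofReal_cos, Complex.cos]
    have hf : (1 - ζ * e) * (1 - ζ * e') = 0 := by
      rw [← h, hcos]; linear_combination (ζ ^ 2) * hee
    rcases mul_eq_zero.1 hf with h' | h' <;> rw [sub_eq_zero] at h' <;>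
      have h'' := congrArg norm h' <;> rw [norm_mul] at h'' <;>
      simp only [hne, hne', norm_one, mul_one] at h'' <;> linarith
  have hker : ∀ θ : ℝ, (ω - ((2 * r * Real.cos θ : ℝ) : ℂ))⁻¹ =
      g * (1 - 2 * ζ * (Real.cos θ : ℂ) + ζ ^ 2)⁻¹ := fun θ => by
    have hu' : (u : ℂ) = (r : ℂ) ^ 2 := by rw [← hr2]; push_cast; rfl
    have : g * (ω - ((2 * r * Real.cos θ : ℝ) : ℂ)) =
        1 - 2 * ζ * (Real.cos θ : ℂ) + ζ ^ 2 := by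
      rw [hω, hu']; push_cast; rw [hζdef]; field_simp; ring
    rw [← this, mul_inv, mul_inv_cancel_left₀ hg0]
  set G : ℝ → ℂ := fun x => (√(4 * u - x ^ 2) / (2 * Real.pi * u)) • (ω - (x : ℂ))⁻¹ with hG
  have hstep1 : cauchyTransform (semicircleLaw u) ω = ∫ x, G x := by
    rw [cauchyTransform, semicircleLaw, if_neg hu.ne',
      integral_withDensity_eq_integral_toReal_smul (by fun_prop) (by simp)]
    congr 1; ext x
    rw [hG, ENNReal.toReal_ofReal (by positivity)]
  have hsupp : ∀ x, x ∉ Ioc (-(2 * r)) (2 * r) → G x = 0 := fun x hx => by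
    have : 4 * u - x ^ 2 ≤ 0 := by
      rw [mem_Ioc, not_and_or, not_lt, not_le] at hx
      rw [← hr2]
      rcases hx with hx | hx <;> nlinarith
    simp [hG, Real.sqrt_eq_zero_of_nonpos this]
  have hstep2 : ∫ x, G x = ∫ x in (-(2 * r))..(2 * r), G x := by
    rw [intervalIntegral.integral_of_le (by linarith), setIntegral_eq_integral_of_forall_compl_eq_zero]
    exact hsupp
  -- The substitution x = 2√u cos θ turns the density into sin² θ. The limits run from π to 0
  -- because cosine decreases.
  have hsub := intervalIntegral.integral_deriv_smul_comp'' (a := Real.pi) (b := 0)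
    (f := fun θ => 2 * r * Real.cos θ) (f' := fun θ => 2 * r * -Real.sin θ) (g := G)
    (by fun_prop)
    (fun θ _ => ((Real.hasDerivAt_cos θ).const_mul (2 * r)).hasDerivWithinAt) (by fun_prop) (by
      rintro x ⟨θ, -, rfl⟩
      have hc : Continuous fun x : ℝ => √(4 * u - x ^ 2) / (2 * Real.pi * u) := by fun_prop
      refine hc.continuousWithinAt.smul ?_
      refine ContinuousWithinAt.inv₀ (Continuous.continuousWithinAt (by fun_prop)) ?_
      intro h0
      have := hker θ
      rw [h0, inv_zero] at this
      exact (mul_ne_zero hg0 (inv_ne_zero (hden θ))) this.symm)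
  have hlast : ∀ θ ∈ uIcc 0 Real.pi, (2 * r * -Real.sin θ) • (G ∘ fun θ => 2 * r * Real.cos θ) θ =
      (-(2 * g / Real.pi)) * ((Real.sin θ : ℂ) *
        ((Real.sin θ : ℂ) * (1 - 2 * ζ * (Real.cos θ : ℂ) + ζ ^ 2)⁻¹)) := fun θ hθ => by
    rw [uIcc_of_le Real.pi_pos.le] at hθ
    have hsin := Real.sin_nonneg_of_mem_Icc hθ
    have hsq : √(4 * u - (2 * r * Real.cos θ) ^ 2) = 2 * r * Real.sin θ := by
      rw [← Real.sqrt_sq (by positivity : 0 ≤ 2 * r * Real.sin θ)]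
      congr 1
      rw [← hr2]
      nlinarith [Real.sin_sq_add_cos_sq θ]
    simp only [Function.comp, hG, hker, hsq, Complex.real_smul]
    have hu' : (u : ℂ) = (r : ℂ) ^ 2 := by rw [← hr2]; push_cast; rfl
    push_cast
    rw [hu']
    have : (r : ℂ) ≠ 0 := by exact_mod_cast hr0.ne'
    have : (Real.pi : ℂ) ≠ 0 := by exact_mod_cast Real.pi_ne_zero
    field_simp
  rw [hstep1, hstep2]
  simp only [Real.cos_pi, Real.cos_zero, mul_neg, mul_one] at hsub
  rw [← hsub, intervalIntegral.integral_symm]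
  simp only [mul_neg] at hlast
  rw [intervalIntegral.integral_congr hlast, intervalIntegral.integral_const_mul,
    integral_sin_sq_div hζ]
  have : (Real.pi : ℂ) ≠ 0 := by exact_mod_cast Real.pi_ne_zero
  field_simp

end Semicircle

/-! ### States on C⋆-algebras and laws of self-adjoint elements -/

section Law

variable {A : Type*} [CStarAlgebra A] {τ : A →ₗ[ℂ] ℂ}

open scoped ComplexOrder in
-- Positive functionals on a C⋆-algebra are automatically bounded; in the spectral order the
-- nonnegative elements are exactly those of the form b⋆b.
lemma IsState.continuous (hτ : IsState τ) : Continuous τ := by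
  let _ := CStarAlgebra.spectralOrder A
  have := CStarAlgebra.spectralOrderedRing A
  let f : A →ₚ[ℂ] ℂ := PositiveLinearMap.mk₀ τ fun x hx => by
    obtain ⟨b, rfl⟩ := CStarAlgebra.nonneg_iff_eq_star_mul_self.1 hx
    exact Complex.nonneg_iff.2 ⟨hτ.re_nonneg b, (hτ.im_eq_zero b).symm⟩
  exact map_continuous f

/-- Polarization: (a + 1)⋆(a + 1) = a⋆a + 1 + 2a for self-adjoint a. -/
lemma IsState.im_eq_zero_of_isSelfAdjoint (hτ : IsState τ) {a : A} (ha : IsSelfAdjoint a) :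
    (τ a).im = 0 := by
  have h1 := hτ.im_eq_zero (a + 1)
  have h2 := hτ.im_eq_zero a
  have h3 := hτ.im_eq_zero 1
  have h4 : star (a + 1) * (a + 1) = star a * a + star 1 * 1 + (2 : ℂ) • a := by
    rw [star_add, ha.star_eq, star_one, two_smul]; noncomm_ring
  rw [h4, map_add, map_add, map_smul, Complex.add_im, Complex.add_im, h2, h3] at h1
  simpa using h1

/-- The state composed with the continuous functional calculus is a positive functional on
C(spectrum a). The Riesz–Markov theorem represents it by a measure, which is pushed forward to ℝ. -/
theorem IsState.exists_isLaw (hτ : IsState τ) {a : A} (ha : IsSelfAdjoint a) :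
    ∃ μ : Measure ℝ, IsLaw τ a μ := by
  let S := spectrum ℝ a
  let φ : C(S, ℝ) →⋆ₐ[ℝ] A := cfcHom ha
  let L : CompactlySupportedContinuousMap S ℝ →ₗ[ℝ] ℝ :=
    { toFun := fun f => (τ (φ f.toContinuousMap)).re
      map_add' := fun f g => by
        have : (f + g).toContinuousMap = f.toContinuousMap + g.toContinuousMap := rfl
        rw [this, map_add, map_add, Complex.add_re]
      map_smul' := fun c f => by
        have : (c • f).toContinuousMap = c • f.toContinuousMap := rfl
        have h2 : φ (c • f.toContinuousMap) = (c : ℂ) • φ f.toContinuousMap := by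
          rw [map_smul, Complex.coe_smul]
        rw [this, h2, map_smul]; simp }
  let Λ : CompactlySupportedContinuousMap S ℝ →ₚ[ℝ] ℝ := PositiveLinearMap.mk₀ L fun f hf => by
    let g : C(S, ℝ) := ⟨fun x => √(f x), by fun_prop⟩
    have hfg : f.toContinuousMap = star g * g := by
      ext x
      have := hf x
      exact (Real.mul_self_sqrt this).symm
    show 0 ≤ (τ (φ f.toContinuousMap)).re
    rw [hfg, map_mul, map_star]
    exact hτ.re_nonneg _
  let ρ := RealRMK.rieszMeasure Λ
  have hint : ∀ f : C(S, ℝ), ∫ x, f x ∂ρ = (τ (φ f)).re := fun f =>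
    RealRMK.integral_rieszMeasure Λ (CompactlySupportedContinuousMap.continuousMapEquiv f)
  have hprob : IsProbabilityMeasure ρ := by
    have h1 := hint 1
    rw [_root_.map_one, hτ.map_one] at h1
    simp only [ContinuousMap.one_apply, integral_const, smul_eq_mul, mul_one, Complex.one_re] at h1
    constructor
    rw [measureReal_def, ENNReal.toReal_eq_one_iff] at h1
    exact h1
  have hmeas : Measurable (Subtype.val : S → ℝ) := measurable_subtype_coe
  refine ⟨ρ.map Subtype.val, Measure.isProbabilityMeasure_map hmeas.aemeasurable, ?_, ?_⟩
  · obtain ⟨R, hR⟩ := (spectrum.isBounded (𝕜 := ℝ) a).subset_closedBall 0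
    refine ⟨R, ?_⟩
    rw [Measure.map_apply hmeas measurableSet_Icc.compl]
    convert measure_empty (μ := ρ)
    ext x
    have := hR x.2
    rw [Real.closedBall_eq_Icc] at this
    simpa using this
  · intro n
    rw [integral_map hmeas.aemeasurable (by fun_prop)]
    let f : C(S, ℝ) := ((ContinuousMap.id ℝ).restrict S) ^ n
    have h1 : φ f = a ^ n := by
      rw [map_pow]; congr 1; exact cfcHom_id ha
    have h2 := hint f
    rw [h1] at h2
    have h3 : ∫ x : S, (x : ℝ) ^ n ∂ρ = (τ (a ^ n)).re := h2
    rw [h3]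
    apply Complex.ext
    · simp
    · simp [hτ.im_eq_zero_of_isSelfAdjoint (ha.pow n)]

lemma IsState.isLaw_law (hτ : IsState τ) {a : A} (ha : IsSelfAdjoint a) : IsLaw τ a (law τ a) := by
  have h := hτ.exists_isLaw ha
  rw [law, dif_pos h]
  exact h.choose_spec

/-! ### Resolvents -/

/-- The resolvent `(w - a)⁻¹` for large `w`. -/
noncomputable def resolventAt (a : A) (w : ℂ) : A := w⁻¹ • ∑' n : ℕ, (w⁻¹ • a) ^ n

variable {a : A} {w : ℂ} {μ : Measure ℝ}

lemma norm_inv_smul_lt_one (hw : ‖a‖ < ‖w‖) : ‖w⁻¹ • a‖ < 1 := by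
  rw [norm_smul, norm_inv, inv_mul_lt_iff₀ ((norm_nonneg a).trans_lt hw)]; simpa using hw

lemma ne_zero_of_norm_lt (hw : ‖a‖ < ‖w‖) : w ≠ 0 := fun h => by
  rw [h, norm_zero] at hw; exact hw.not_ge (norm_nonneg a)

lemma smul_sub_eq (hw : ‖a‖ < ‖w‖) : w • (1 : A) - a = w • (1 - w⁻¹ • a) := by
  rw [smul_sub, smul_inv_smul₀ (ne_zero_of_norm_lt hw)]

lemma resolventAt_mul (hw : ‖a‖ < ‖w‖) : resolventAt a w * (w • (1 : A) - a) = 1 := by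
  rw [smul_sub_eq hw, resolventAt, smul_mul_smul_comm, inv_mul_cancel₀ (ne_zero_of_norm_lt hw),
    geom_series_mul_neg _ (norm_inv_smul_lt_one hw), one_smul]

lemma mul_resolventAt (hw : ‖a‖ < ‖w‖) : (w • (1 : A) - a) * resolventAt a w = 1 := by
  rw [smul_sub_eq hw, resolventAt, smul_mul_smul_comm, mul_inv_cancel₀ (ne_zero_of_norm_lt hw),
    mul_neg_geom_series _ (norm_inv_smul_lt_one hw), one_smul]

lemma hasSum_resolventAt (hw : ‖a‖ < ‖w‖) :
    HasSum (fun n : ℕ => w⁻¹ • (w⁻¹ • a) ^ n) (resolventAt a w) :=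
  (summable_geometric_of_norm_lt_one (norm_inv_smul_lt_one hw)).hasSum.const_smul _

/-- Freeness is assumed only for the algebraic ⋆-algebras. Resolvents are norm limits of
polynomials, so freeness must be extended to closures. -/
lemma resolventAt_mem_closure (hw : ‖a‖ < ‖w‖) :
    resolventAt a w ∈ closure (StarAlgebra.adjoin ℂ {a} : Set A) := by
  refine mem_closure_of_tendsto (hasSum_resolventAt hw) (Eventually.of_forall fun s => ?_)
  have ha : a ∈ StarAlgebra.adjoin ℂ {a} := StarAlgebra.self_mem_adjoin_singleton ℂ a
  exact sum_mem fun n _ => SMulMemClass.smul_mem _ (pow_mem (SMulMemClass.smul_mem _ ha) n)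

lemma tendsto_smul_resolventAt (a : A) :
    Tendsto (fun w : ℂ => w • resolventAt a w) (Bornology.cobounded ℂ) (𝓝 1) := by
  have h1 : Tendsto (fun w : ℂ => 1 - w⁻¹ • a) (Bornology.cobounded ℂ) (𝓝 ((1 : Aˣ) : A)) := by
    have := (tendsto_inv₀_cobounded (α := ℂ)).smul_const a
    simpa using this.const_sub 1
  have h2 := (NormedRing.inverse_continuousAt (1 : Aˣ)).tendsto.comp h1
  simp only [Units.val_one, Ring.inverse_one] at h2
  refine h2.congr' ?_
  filter_upwards [tendsto_norm_cobounded_atTop.eventually_gt_atTop ‖a‖] with w hw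
  have hn := norm_inv_smul_lt_one hw
  rw [resolventAt, smul_inv_smul₀ (ne_zero_of_norm_lt hw), Function.comp,
    NormedRing.inverse_one_sub _ hn]
  rfl

lemma IsLaw.hasSum_cauchyTransform (hμ : IsLaw τ a μ) :
    ∀ᶠ w in Bornology.cobounded ℂ,
      HasSum (fun n : ℕ => w⁻¹ * ((w⁻¹) ^ n * τ (a ^ n))) (cauchyTransform μ w) := by
  have := hμ.isProbabilityMeasure
  obtain ⟨R, hR⟩ := hμ.exists_support_bound
  filter_upwards [tendsto_norm_cobounded_atTop.eventually_gt_atTop (max R 1)] with w hw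
  have hae : ∀ᵐ x ∂μ, |x| ≤ max R 1 := by
    have : ∀ᵐ x ∂μ, x ∈ Icc (-R) R := hR
    filter_upwards [this] with x hx
    exact (abs_le.2 hx).trans (le_max_left _ _)
  have hR0 : 0 < max R 1 := by positivity
  have hw0 : 0 < ‖w‖ := hR0.trans hw
  have hwne : w ≠ 0 := norm_pos_iff.1 hw0
  have hq : ‖w‖⁻¹ * max R 1 < 1 := by rwa [inv_mul_lt_iff₀ hw0, mul_one]
  have h := hasSum_integral_of_dominated_convergence (μ := μ)
    (F := fun (n : ℕ) (x : ℝ) => w⁻¹ * (w⁻¹ * (x : ℂ)) ^ n) (f := fun x : ℝ => (w - (x : ℂ))⁻¹)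
    (fun n _ => ‖w‖⁻¹ * (‖w‖⁻¹ * max R 1) ^ n)
    (fun n => (by fun_prop : Continuous _).aestronglyMeasurable)
    (fun n => by
      filter_upwards [hae] with x hx
      rw [norm_mul, norm_pow, norm_mul, norm_inv, Complex.norm_real, Real.norm_eq_abs]
      gcongr)
    (ae_of_all _ fun x => (summable_geometric_of_lt_one (by positivity) hq).mul_left _)
    (integrable_const _)
    (by
      filter_upwards [hae] with x hx
      have hx1 : ‖w⁻¹ * (x : ℂ)‖ < 1 := by
        rw [norm_mul, norm_inv, Complex.norm_real, Real.norm_eq_abs]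
        exact lt_of_le_of_lt (by gcongr) hq
      have h1 := (hasSum_geometric_of_norm_lt_one hx1).mul_left w⁻¹
      have h2 : (w - (x : ℂ))⁻¹ = w⁻¹ * (1 - w⁻¹ * (x : ℂ))⁻¹ := by
        rw [← mul_inv, mul_sub, mul_one, mul_inv_cancel_left₀ hwne]
      rw [h2]; exact h1)
  refine h.congr_fun fun n => ?_
  have h3 : ∀ x : ℝ, w⁻¹ * (w⁻¹ * (x : ℂ)) ^ n = w⁻¹ * ((w⁻¹) ^ n * ((x ^ n : ℝ) : ℂ)) := fun x => by
    push_cast; ring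
  simp only [h3]
  have h4 : ∫ x : ℝ, ((x ^ n : ℝ) : ℂ) ∂μ = τ (a ^ n) := integral_ofReal.trans (hμ.moment n)
  rw [integral_const_mul, integral_const_mul, h4]

lemma IsLaw.apply_resolventAt (hτ : IsState τ) (hμ : IsLaw τ a μ) :
    ∀ᶠ w in Bornology.cobounded ℂ, τ (resolventAt a w) = cauchyTransform μ w := by
  filter_upwards [hμ.hasSum_cauchyTransform,
    tendsto_norm_cobounded_atTop.eventually_gt_atTop ‖a‖] with w hw hwa
  have h := (hasSum_resolventAt hwa).mapL (⟨τ, hτ.continuous⟩ : A →L[ℂ] ℂ)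
  refine HasSum.unique ?_ hw
  refine h.congr_fun fun n => ?_
  simp [smul_pow]

lemma IsLaw.tendsto_mul_cauchyTransform (hτ : IsState τ) (hμ : IsLaw τ a μ) :
    Tendsto (fun w => w * cauchyTransform μ w) (Bornology.cobounded ℂ) (𝓝 1) := by
  have h := (hτ.continuous.tendsto 1).comp (tendsto_smul_resolventAt a)
  rw [hτ.map_one] at h
  refine h.congr' ?_
  filter_upwards [hμ.apply_resolventAt hτ] with w hw
  simp [hw]

end Law

/-! ### Freeness -/

section Free

variable {A : Type*} [CStarAlgebra A] {τ : A →ₗ[ℂ] ℂ}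

/-- Approximants from the algebra need not be centered. Subtracting their expectations repairs this
without changing the limit. -/
lemma FreelyIndependent.apply_prod_closure {ι : Type*} {x : ι → A} (hτ : IsState τ)
    (hx : FreelyIndependent τ x) (f : ι → A)
    (hf : ∀ i, f i ∈ closure (StarAlgebra.adjoin ℂ {x i} : Set A)) (hf0 : ∀ i, τ (f i) = 0)
    {l : List ι} (hl : l ≠ []) (hchain : l.IsChain (· ≠ ·)) : τ (l.map f).prod = 0 := by
  choose g hg hgf using fun i => mem_closure_iff_seq_limit.1 (hf i)
  let g' : ι → ℕ → A := fun i n => g i n - τ (g i n) • 1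
  have hg' : ∀ i, Tendsto (g' i) atTop (𝓝 (f i)) := fun i => by
    have h1 : Tendsto (fun n => τ (g i n)) atTop (𝓝 0) := by
      rw [← hf0 i]; exact (hτ.continuous.tendsto _).comp (hgf i)
    simpa using (hgf i).sub (h1.smul_const (1 : A))
  have hzero : ∀ n, τ (l.map fun i => g' i n).prod = 0 := fun n => by
    have := hx (l.map fun i => (i, g' i n)) (by simpa using hl)
      ((List.isChain_map _).2 hchain) (by
        intro p hp
        obtain ⟨i, -, rfl⟩ := List.mem_map.1 hp
        refine ⟨sub_mem (hg i n) (SMulMemClass.smul_mem _ (one_mem _)), ?_⟩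
        simp [g', hτ.map_one])
    rwa [List.map_map] at this
  have hlim : Tendsto (fun n => (l.map fun i => g' i n).prod) atTop (𝓝 (l.map f).prod) :=
    tendsto_list_prod l fun i _ => hg' i
  have h2 := (hτ.continuous.tendsto _).comp hlim
  refine tendsto_nhds_unique h2 ?_
  simp only [Function.comp_def, hzero]
  exact tendsto_const_nhds

/-- The alternating word `0, 1, 0, 1, …` of length `2 n`. -/
def altWord (n : ℕ) : List (Fin 2) := (List.replicate n [0, 1]).flatten

lemma altWord_succ (n : ℕ) : altWord (n + 1) = 0 :: 1 :: altWord n := by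
  simp [altWord, List.replicate_succ]

lemma prod_altWord {M : Type*} [Monoid M] (f : Fin 2 → M) (n : ℕ) :
    ((altWord n).map f).prod = (f 0 * f 1) ^ n := by
  induction n with
  | zero => simp [altWord]
  | succ n ih => rw [altWord_succ, List.map_cons, List.map_cons, List.prod_cons, List.prod_cons, ih,
      pow_succ', mul_assoc]

/-- This is the longest word in the expansion of (1 + b)(ab)ⁿ(1 + a); the others arise by deleting
letters at its ends and inherit alternation. -/
lemma isChain_cons_altWord (n : ℕ) : (1 :: (altWord n ++ [0])).IsChain (· ≠ ·) := by
  induction n with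
  | zero => simp [altWord]
  | succ n ih =>
    rw [altWord_succ]
    simp only [List.cons_append]
    exact List.IsChain.cons_cons (by decide) (List.IsChain.cons_cons (by decide) ih)

/-- If `a` and `b` are centered elements of the closed algebras generated by two free elements,
then `τ((1 + b) (a b)ⁿ (1 + a))` vanishes for `n ≥ 1`, and is `1` for `n = 0`. -/
lemma FreelyIndependent.apply_alternating {x : Fin 2 → A} (hτ : IsState τ)
    (hx : FreelyIndependent τ x) {a b : A}
    (ha : a ∈ closure (StarAlgebra.adjoin ℂ {x 0} : Set A)) (ha0 : τ a = 0)
    (hb : b ∈ closure (StarAlgebra.adjoin ℂ {x 1} : Set A)) (hb0 : τ b = 0) (n : ℕ) :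
    τ ((1 + b) * (a * b) ^ n * (1 + a)) = if n = 0 then 1 else 0 := by
  have key : ∀ l : List (Fin 2), l ≠ [] → l.IsChain (· ≠ ·) → τ (l.map ![a, b]).prod = 0 :=
    fun l hl hc => hx.apply_prod_closure hτ ![a, b]
      (by intro i; fin_cases i <;> assumption) (by intro i; fin_cases i <;> assumption) hl hc
  have hfull := isChain_cons_altWord n
  have h4 : τ (b * (a * b) ^ n * a) = 0 := by
    have := key _ (by simp) hfull
    simpa [prod_altWord, mul_assoc] using this
  have h3 : τ ((a * b) ^ n * a) = 0 := by
    have := key _ (by simp) hfull.tail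
    simpa [prod_altWord] using this
  have h2 : τ (b * (a * b) ^ n) = 0 := by
    have hc : (1 :: altWord n).IsChain (· ≠ ·) := by
      have := hfull.left_of_append (l₁ := 1 :: altWord n) (l₂ := [0])
      exact this
    have := key _ (by simp) hc
    simpa [prod_altWord] using this
  have h1 : τ ((a * b) ^ n) = if n = 0 then 1 else 0 := by
    split_ifs with hn
    · rw [hn, pow_zero, hτ.map_one]
    · have hc : (1 :: altWord n).IsChain (· ≠ ·) := by
        exact hfull.left_of_append (l₁ := 1 :: altWord n) (l₂ := [0])
      have := key (altWord n) (by
        obtain ⟨m, rfl⟩ := Nat.exists_eq_succ_of_ne_zero hn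
        rw [altWord_succ]; simp) hc.tail
      simpa [prod_altWord] using this
  have hexp : (1 + b) * (a * b) ^ n * (1 + a) =
      (a * b) ^ n + b * (a * b) ^ n + (a * b) ^ n * a + b * (a * b) ^ n * a := by noncomm_ring
  rw [hexp, map_add, map_add, map_add, h1, h2, h3, h4]
  simp

end Free

/-! ### Free convolution with a semicircle law. -/

section FreeConvolution

variable {A : Type*} [CStarAlgebra A] {τ : A →ₗ[ℂ] ℂ}

/-- If the resolvents `P⁻¹`, `Q⁻¹` of two free elements, taken at points where they have the same
expectation `g`, are close to `g`, then so is the expectation of `(P + Q - g⁻¹)⁻¹`. -/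
lemma FreelyIndependent.apply_inverse {x : Fin 2 → A} (hτ : IsState τ)
    (hx : FreelyIndependent τ x) {P Q R S T : A} {g : ℂ} (hg : g ≠ 0)
    (hR : R ∈ closure (StarAlgebra.adjoin ℂ {x 0} : Set A)) (hRP : R * P = 1) (hPR : P * R = 1)
    (hτR : τ R = g)
    (hS : S ∈ closure (StarAlgebra.adjoin ℂ {x 1} : Set A)) (hSQ : S * Q = 1)
    (hτS : τ S = g) (hRn : ‖g⁻¹ • R - 1‖ < 1) (hSn : ‖g⁻¹ • S - 1‖ < 1)
    (hT : (P + Q - g⁻¹ • (1 : A)) * T = 1) : τ T = g := by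
  set a := g⁻¹ • R - 1 with ha
  set b := g⁻¹ • S - 1 with hb
  have hmem : ∀ {i : Fin 2} {c : A}, c ∈ closure (StarAlgebra.adjoin ℂ {x i} : Set A) →
      g⁻¹ • c - 1 ∈ closure (StarAlgebra.adjoin ℂ {x i} : Set A) := fun {i} {c} hc => by
    have hc' : c ∈ (StarAlgebra.adjoin ℂ {x i}).topologicalClosure := hc
    exact sub_mem (SMulMemClass.smul_mem g⁻¹ hc') (one_mem _)
  have ha0 : τ a = 0 := by simp [ha, hτR, hτ.map_one, hg]
  have hb0 : τ b = 0 := by simp [hb, hτS, hτ.map_one, hg]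
  have hab : ‖a * b‖ < 1 := (norm_mul_le _ _).trans_lt
    (mul_lt_one_of_nonneg_of_lt_one_left (norm_nonneg _) hRn hSn.le)
  set N := ∑' n : ℕ, (a * b) ^ n with hN
  have hsum : HasSum (fun n : ℕ => (1 + b) * (a * b) ^ n * (1 + a)) ((1 + b) * N * (1 + a)) :=
    (((summable_geometric_of_norm_lt_one hab).hasSum).mul_left _).mul_right _
  have hτX : τ ((1 + b) * N * (1 + a)) = 1 := by
    have h1 := hsum.mapL (⟨τ, hτ.continuous⟩ : A →L[ℂ] ℂ)
    refine h1.unique ?_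
    have h2 : ∀ n : ℕ, (⟨τ, hτ.continuous⟩ : A →L[ℂ] ℂ) ((1 + b) * (a * b) ^ n * (1 + a)) =
      if n = 0 then 1 else 0 := hx.apply_alternating hτ (hmem hR) ha0 (hmem hS) hb0
    simp only [h2]
    exact hasSum_ite_eq 0 1
  -- With P⁻¹ = g(1 + a) and Q⁻¹ = g(1 + b) for centered a and b, the sum factors through 1 - ab.
  -- Its inverse is therefore g(1 + b)(∑ (ab)ⁿ)(1 + a), a series of alternating words in which only
  -- n = 0 has nonzero expectation.
  have hfac : g • (P * (1 - a * b) * Q) = P + Q - g⁻¹ • (1 : A) := by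
    have h1 : 1 - a * b = (1 + a) + (1 + b) - (1 + a) * (1 + b) := by noncomm_ring
    have h2 : (1 + a) = g⁻¹ • R := by rw [ha]; abel
    have h3 : (1 + b) = g⁻¹ • S := by rw [hb]; abel
    rw [h1, h2, h3]
    simp only [mul_sub, mul_add, sub_mul, add_mul, mul_smul_comm, smul_mul_assoc, hPR]
    have h4 : P * (R * S) * Q = 1 := by rw [← mul_assoc, hPR, one_mul, hSQ]
    have h5 : P * S * Q = P := by rw [mul_assoc, hSQ, mul_one]
    rw [h4, h5, one_mul, smul_sub, smul_add, smul_inv_smul₀ hg, smul_inv_smul₀ hg,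
      smul_inv_smul₀ hg]
    abel
  have hleft : (g • ((1 + b) * N * (1 + a))) * (P + Q - g⁻¹ • (1 : A)) = 1 := by
    have h2 : (1 + a) * P = g⁻¹ • (1 : A) := by
      have : 1 + a = g⁻¹ • R := by rw [ha]; abel
      rw [this, smul_mul_assoc, hRP]
    have h3 : (1 + b) * Q = g⁻¹ • (1 : A) := by
      have : 1 + b = g⁻¹ • S := by rw [hb]; abel
      rw [this, smul_mul_assoc, hSQ]
    have h4 : N * (1 - a * b) = 1 := geom_series_mul_neg _ hab
    rw [← hfac, smul_mul_smul_comm]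
    have h5 : (1 + b) * N * (1 + a) * (P * (1 - a * b) * Q) =
        (1 + b) * (N * (((1 + a) * P) * (1 - a * b))) * Q := by simp only [mul_assoc]
    rw [h5, h2, smul_mul_assoc, one_mul, mul_smul_comm, h4, mul_smul_comm, mul_one, smul_mul_assoc,
      h3, smul_smul, smul_smul]
    rw [show g * g * g⁻¹ * g⁻¹ = 1 by field_simp, one_smul]
  have hTX : T = g • ((1 + b) * N * (1 + a)) := (left_inv_eq_right_inv hleft hT).symm
  rw [hTX, map_smul, hτX, smul_eq_mul, mul_one]

lemma IsState.tendsto_H (hτ : IsState τ) {y : A} {ν : Measure ℝ} (hν : IsLaw τ y ν) (u : ℝ) :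
    Tendsto (cauchyTransform ν) (Bornology.cobounded ℂ) (𝓝 0) ∧
      Tendsto (H ν u) (Bornology.cobounded ℂ) (Bornology.cobounded ℂ) := by
  have h1 : Tendsto (cauchyTransform ν) (Bornology.cobounded ℂ) (𝓝 0) := by
    have := (tendsto_inv₀_cobounded (α := ℂ)).mul (hν.tendsto_mul_cauchyTransform hτ)
    rw [zero_mul] at this
    refine this.congr' ?_
    filter_upwards [tendsto_norm_cobounded_atTop.eventually_gt_atTop 0] with w hw
    rw [inv_mul_cancel_left₀ (norm_pos_iff.1 hw)]
  refine ⟨h1, ?_⟩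
  rw [← tendsto_norm_atTop_iff_cobounded]
  have h2 : Tendsto (fun w => ‖(u : ℂ) * cauchyTransform ν w‖) (Bornology.cobounded ℂ) (𝓝 0) := by
    have := (h1.const_mul (u : ℂ)).norm
    simpa using this
  refine tendsto_atTop_mono (fun w => ?_)
    (tendsto_norm_cobounded_atTop.atTop_add h2.neg)
  have := norm_sub_norm_le w (-((u : ℂ) * cauchyTransform ν w))
  rw [norm_neg, sub_neg_eq_add] at this
  rw [H]; linarith

/-- Biane's subordination relation for the free convolution with a semicircle law. -/
theorem subordinateAtInfinity_of_free (hτ : IsState τ) {y c : A} {u : ℝ} (hu : 0 ≤ u)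
    {μ ν : Measure ℝ} (hν : IsLaw τ y ν) (hc : IsSemicircular τ u c) (hμ : IsLaw τ (y + c) μ)
    (hfree : FreelyIndependent τ ![y, c]) : SubordinateAtInfinity μ ν u := by
  obtain ⟨hG0, hH⟩ := hτ.tendsto_H hν u
  have hwG := hν.tendsto_mul_cauchyTransform hτ
  have hGne : ∀ᶠ w in Bornology.cobounded ℂ, cauchyTransform ν w ≠ 0 := by
    filter_upwards [hwG.eventually_ne one_ne_zero] with w hw h
    exact hw (by rw [h, mul_zero])
  -- ω(w) is the point where the semicircle law has Cauchy transform G_ν(w), so the resolvents of y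
  -- at w and of c at ω(w) have the same expectation. Moreover w + ω(w) - G_ν(w)⁻¹ = H_{ν,u}(w).
  set ω : ℂ → ℂ := fun w => (cauchyTransform ν w)⁻¹ + u * cauchyTransform ν w with hω
  have hωt : Tendsto ω (Bornology.cobounded ℂ) (Bornology.cobounded ℂ) := by
    have hinv : Tendsto (fun w => (cauchyTransform ν w)⁻¹) (Bornology.cobounded ℂ)
        (Bornology.cobounded ℂ) :=
      tendsto_inv₀_nhdsNE_zero.comp (tendsto_nhdsWithin_iff.2 ⟨hG0, hGne⟩)
    rw [← tendsto_norm_atTop_iff_cobounded] at hinv ⊢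
    have h2 : Tendsto (fun w => ‖(u : ℂ) * cauchyTransform ν w‖) (Bornology.cobounded ℂ) (𝓝 0) := by
      have := (hG0.const_mul (u : ℂ)).norm
      simpa using this
    refine tendsto_atTop_mono (fun w => ?_) (hinv.atTop_add h2.neg)
    have := norm_sub_norm_le (cauchyTransform ν w)⁻¹ (-((u : ℂ) * cauchyTransform ν w))
    rw [norm_neg, sub_neg_eq_add] at this
    linarith
  have hRlim : Tendsto (fun w => (cauchyTransform ν w)⁻¹ • resolventAt y w)
      (Bornology.cobounded ℂ) (𝓝 1) := by
    have := (hwG.inv₀ one_ne_zero).smul (tendsto_smul_resolventAt y)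
    rw [inv_one, one_smul] at this
    refine this.congr' ?_
    filter_upwards [tendsto_norm_cobounded_atTop.eventually_gt_atTop 0] with w hw
    rw [smul_smul, mul_inv_rev, mul_assoc, inv_mul_cancel₀ (norm_pos_iff.1 hw), mul_one]
  have hSlim : Tendsto (fun w => (cauchyTransform ν w)⁻¹ • resolventAt c (ω w))
      (Bornology.cobounded ℂ) (𝓝 1) := by
    have hωG : Tendsto (fun w => ω w * cauchyTransform ν w) (Bornology.cobounded ℂ) (𝓝 1) := by
      have h1 : Tendsto (fun w => 1 + u * (cauchyTransform ν w) ^ 2) (Bornology.cobounded ℂ)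
          (𝓝 (1 + (u : ℂ) * 0 ^ 2)) := ((hG0.pow 2).const_mul _).const_add _
      simp only [ne_eq, OfNat.ofNat_ne_zero, not_false_eq_true, zero_pow, mul_zero, add_zero] at h1
      refine h1.congr' ?_
      filter_upwards [hGne] with w hw
      simp only [hω]; field_simp
    have := (hωG.inv₀ one_ne_zero).smul ((tendsto_smul_resolventAt c).comp hωt)
    rw [inv_one, one_smul] at this
    refine this.congr' ?_
    filter_upwards [(tendsto_norm_cobounded_atTop.comp hωt).eventually_gt_atTop 0] with w hw
    rw [Function.comp, smul_smul, mul_inv_rev, mul_assoc, inv_mul_cancel₀ (norm_pos_iff.1 hw),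
      mul_one]
  have hclose : ∀ {f : ℂ → A}, Tendsto f (Bornology.cobounded ℂ) (𝓝 1) →
      ∀ᶠ w in Bornology.cobounded ℂ, ‖f w - 1‖ < 1 := fun hf => by
    have := (hf.sub_const 1).norm
    rw [sub_self, norm_zero] at this
    exact this.eventually_lt_const one_pos
  have hsmall : ∀ᶠ w in Bornology.cobounded ℂ, u * ‖cauchyTransform ν w‖ ^ 2 < 1 := by
    have := (hG0.norm.pow 2).const_mul u
    simp only [norm_zero, ne_eq, OfNat.ofNat_ne_zero, not_false_eq_true, zero_pow, mul_zero] at this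
    exact this.eventually_lt_const one_pos
  filter_upwards [hGne, hclose hRlim, hclose hSlim, hsmall, hν.apply_resolventAt hτ,
    hωt.eventually (hc.2.apply_resolventAt hτ), hH.eventually (hμ.apply_resolventAt hτ),
    tendsto_norm_cobounded_atTop.eventually_gt_atTop ‖y‖,
    (tendsto_norm_cobounded_atTop.comp hωt).eventually_gt_atTop ‖c‖,
    (tendsto_norm_cobounded_atTop.comp hH).eventually_gt_atTop ‖y + c‖]
    with w hg hR1 hS1 hsm hτR hτS hτT hny hnc hnyc
  rw [← hτT]
  have hτS' : τ (resolventAt c (ω w)) = cauchyTransform ν w := by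
    rw [hτS, hω]; exact cauchyTransform_semicircleLaw hu hg hsm
  refine hfree.apply_inverse hτ hg (resolventAt_mem_closure hny) (resolventAt_mul hny)
    (mul_resolventAt hny) hτR (resolventAt_mem_closure hnc) (resolventAt_mul hnc)
    hτS' hR1 hS1 ?_
  have h1 : H ν u w = w + ω w - (cauchyTransform ν w)⁻¹ := by rw [H, hω]; ring
  have h2 : w • (1 : A) - y + (ω w • (1 : A) - c) - (cauchyTransform ν w)⁻¹ • (1 : A) =
      H ν u w • (1 : A) - (y + c) := by
    rw [h1, sub_smul (w + ω w), add_smul w (ω w)]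
    generalize ω w = o
    abel
  exact (congrArg (· * resolventAt (y + c) (H ν u w)) h2).trans (mul_resolventAt hnyc)

end FreeConvolution

/-! ### Shape of `v_{ν,s}` for large `s` -/

section Shape

variable {ν : Measure ℝ} {s p q : ℝ}

lemma exists_hull [IsProbabilityMeasure ν] (hbdd : ∃ R : ℝ, ν (Icc (-R) R)ᶜ = 0) :
    ∃ p q : ℝ, p ≤ q ∧ q - p ≤ Metric.diam ν.support ∧ ∀ᵐ x ∂ν, x ∈ Icc p q := by
  obtain ⟨R, hR⟩ := hbdd
  have hsub : ν.support ⊆ Icc (-R) R := Measure.support_subset_of_isClosed isClosed_Icc hR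
  have hcomp : IsCompact ν.support :=
    isCompact_Icc.of_isClosed_subset Measure.isClosed_support hsub
  have hne : ν.support.Nonempty := Measure.nonempty_support (IsProbabilityMeasure.ne_zero ν)
  have hp := hcomp.sInf_mem hne
  have hq := hcomp.sSup_mem hne
  refine ⟨sInf ν.support, sSup ν.support,
    csInf_le_csSup hne hcomp.bddBelow hcomp.bddAbove, ?_, ?_⟩
  · have := Metric.dist_le_diam_of_mem hcomp.isBounded hq hp
    rw [Real.dist_eq] at this
    exact (le_abs_self _).trans this
  · filter_upwards [Measure.support_mem_ae (μ := ν)] with x hx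
    exact ⟨csInf_le hcomp.bddBelow hx, le_csSup hcomp.bddAbove hx⟩

lemma integrable_cauchy_kernel [IsProbabilityMeasure ν] {R : ℝ} (hR : 0 < R) (α : ℝ) :
    Integrable (fun x : ℝ => 1 / ((α - x) ^ 2 + R ^ 2)) ν := by
  have := integrable_kernel_sq (μ := ν) (z := (α : ℂ) + (R : ℂ) * Complex.I)
    (invSq_ne_top_of_im (by simpa using hR.ne'))
  simpa only [kernel_eq] using this

lemma integral_cauchy_kernel_le_iff [IsProbabilityMeasure ν] (hs : 0 < s) {R : ℝ} (hR : 0 < R)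
    (α : ℝ) : ∫ x, 1 / ((α - x) ^ 2 + R ^ 2) ∂ν ≤ 1 / s ↔ vFun ν s α ≤ R := by
  rw [mem_vFun_set_iff hs hR, mem_regSet_iff_vFun_le hs hR.le]

/-- The function `y ↦ (y² + R²)⁻¹` lies below its tangent at `c` as long as `c² + 2 c y ≤ R²`. -/
lemma cauchy_kernel_le_tangent {R c y : ℝ} (hR : 0 < R) (h : c ^ 2 + 2 * c * y ≤ R ^ 2) :
    1 / (y ^ 2 + R ^ 2) ≤ 1 / (c ^ 2 + R ^ 2) + (y - c) * (-2 * c / (c ^ 2 + R ^ 2) ^ 2) := by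
  have h1 : 0 < y ^ 2 + R ^ 2 := by positivity
  have h2 : 0 < c ^ 2 + R ^ 2 := by positivity
  have h3 : 1 / (c ^ 2 + R ^ 2) + (y - c) * (-2 * c / (c ^ 2 + R ^ 2) ^ 2) - 1 / (y ^ 2 + R ^ 2) =
      (c - y) ^ 2 * (R ^ 2 - (c ^ 2 + 2 * c * y)) / ((c ^ 2 + R ^ 2) ^ 2 * (y ^ 2 + R ^ 2)) := by
    field_simp; ring
  have h4 : 0 ≤ (c - y) ^ 2 * (R ^ 2 - (c ^ 2 + 2 * c * y)) /
      ((c ^ 2 + R ^ 2) ^ 2 * (y ^ 2 + R ^ 2)) := by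
    have := sub_nonneg.2 h
    positivity
  linarith

/-- Quasi-concavity of v: a level R strictly between v(c) and both v(a) and v(b) would make ∫
((α-x)² + R²)⁻¹ dν at most 1/s at c but larger at a and b. -/
theorem min_vFun_le [IsProbabilityMeasure ν] (hs : 0 < s) (hpq : p ≤ q)
    (hae : ∀ᵐ x ∂ν, x ∈ Icc p q) (hsD : 4 * (q - p) ^ 2 ≤ s) {a b c : ℝ} (hac : a ≤ c)
    (hcb : c ≤ b) : min (vFun ν s a) (vFun ν s b) ≤ vFun ν s c := by
  by_contra! hlt
  obtain ⟨R, hR1, hR2⟩ := exists_between hlt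
  obtain ⟨hRa, hRb⟩ := lt_min_iff.1 hR2
  have hR : 0 < R := vFun_nonneg.trans_lt hR1
  have hFa := not_le.1 (mt (integral_cauchy_kernel_le_iff (ν := ν) hs hR a).1 (not_le.2 hRa))
  have hFb := not_le.1 (mt (integral_cauchy_kernel_le_iff (ν := ν) hs hR b).1 (not_le.2 hRb))
  have hFc := (integral_cauchy_kernel_le_iff (ν := ν) hs hR c).2 hR1.le
  have hint := integrable_cauchy_kernel (ν := ν) hR
  have hmono : ∀ e f : ℝ, (∀ x ∈ Icc p q, (e - x) ^ 2 ≤ (f - x) ^ 2) →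
      ∫ x, 1 / ((f - x) ^ 2 + R ^ 2) ∂ν ≤ ∫ x, 1 / ((e - x) ^ 2 + R ^ 2) ∂ν := fun e f h => by
    refine integral_mono_ae (hint f) (hint e) ?_
    filter_upwards [hae] with x hx
    have := h x hx
    gcongr
  rcases lt_or_ge c p with hcp | hcp
  · linarith [hmono c a fun x hx => by nlinarith [hx.1]]
  rcases lt_or_ge q c with hcq | hcq
  · linarith [hmono c b fun x hx => by nlinarith [hx.2]]
  -- The hypothesis 4D² ≤ s splits as D² + 3D², with D = q - p. If R² < 3D², the integral at c is at
  -- least 1/(D² + R²) > 1/s. Otherwise c² + 2cy ≤ 3D² ≤ R² for all differences c, y within the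
  -- hull, and the kernel lies below its tangents there.
  rcases lt_or_ge (R ^ 2) (3 * (q - p) ^ 2) with hRD | hRD
  · have hD : 0 < (q - p) ^ 2 := by nlinarith [sq_nonneg R]
    have h1 : 1 / ((q - p) ^ 2 + R ^ 2) ≤ ∫ x, 1 / ((c - x) ^ 2 + R ^ 2) ∂ν := by
      have : ∫ _, 1 / ((q - p) ^ 2 + R ^ 2) ∂ν ≤ ∫ x, 1 / ((c - x) ^ 2 + R ^ 2) ∂ν := by
        refine integral_mono_ae (integrable_const _) (hint c) ?_
        filter_upwards [hae] with x hx
        have : (c - x) ^ 2 ≤ (q - p) ^ 2 := by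
          apply sq_le_sq'; linarith [hx.1, hx.2]; linarith [hx.1, hx.2]
        gcongr
      simpa using this
    have h2 : 1 / s < 1 / ((q - p) ^ 2 + R ^ 2) :=
      one_div_lt_one_div_of_lt (by positivity) (by linarith)
    linarith
  · have htan : ∀ e : ℝ, e ∈ Icc p q → ∀ x ∈ Icc p q, 1 / ((e - x) ^ 2 + R ^ 2) ≤
        1 / ((c - x) ^ 2 + R ^ 2) + (e - c) * (-2 * (c - x) / ((c - x) ^ 2 + R ^ 2) ^ 2) := by
      intro e he x hx
      have h1 : |c - x| ≤ q - p := abs_le.2 ⟨by linarith [hx.2], by linarith [hx.1]⟩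
      have h2 : |e - x| ≤ q - p := abs_le.2 ⟨by linarith [hx.2, he.1], by linarith [hx.1, he.2]⟩
      have h3 : (c - x) * (e - x) ≤ (q - p) ^ 2 := by
        refine (le_abs_self _).trans ?_
        rw [abs_mul, sq]
        exact mul_le_mul h1 h2 (abs_nonneg _) (by linarith)
      have h4 : (c - x) ^ 2 ≤ (q - p) ^ 2 := by
        rw [← sq_abs]; exact pow_le_pow_left₀ (abs_nonneg _) h1 2
      have := cauchy_kernel_le_tangent (R := R) (c := c - x) (y := e - x) hR (by nlinarith)
      rwa [sub_sub_sub_cancel_right] at this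
    have hMint : Integrable (fun x : ℝ => -2 * (c - x) / ((c - x) ^ 2 + R ^ 2) ^ 2) ν := by
      refine Integrable.of_bound (Measurable.aestronglyMeasurable (by fun_prop)) (1 / R ^ 3)
        (ae_of_all _ fun x => ?_)
      rw [Real.norm_eq_abs, abs_div, abs_of_nonneg (sq_nonneg ((c - x) ^ 2 + R ^ 2)),
        div_le_div_iff₀ (by positivity) (by positivity), abs_mul, abs_neg, abs_two, one_mul,
        ← sq_abs (c - x)]
      set y := |c - x|
      nlinarith [mul_nonneg (sq_nonneg (y - R)) (sq_nonneg R), sq_nonneg (y ^ 2),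
        mul_nonneg (sq_nonneg y) (sq_nonneg R), sq_nonneg (y - R), abs_nonneg (c - x)]
    have hFtan : ∀ e ∈ Icc p q, ∫ x, 1 / ((e - x) ^ 2 + R ^ 2) ∂ν ≤
        ∫ x, 1 / ((c - x) ^ 2 + R ^ 2) ∂ν +
          (e - c) * ∫ x, -2 * (c - x) / ((c - x) ^ 2 + R ^ 2) ^ 2 ∂ν := fun e he => by
      rw [← integral_const_mul, ← integral_add (hint c) (hMint.const_mul _)]
      refine integral_mono_ae (hint e) ((hint c).add (hMint.const_mul _)) ?_
      filter_upwards [hae] with x hx using htan e he x hx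
    -- An outer point beyond the hull is moved to the nearest end of the hull, which only increases
    -- the integral, so that the tangent bound applies.
    have ha' := hmono (max a p) a fun x hx => by
      rcases le_total a p with h | h
      · rw [max_eq_right h]; nlinarith [hx.1]
      · rw [max_eq_left h]
    have hb' := hmono (min b q) b fun x hx => by
      rcases le_total b q with h | h
      · rw [min_eq_left h]
      · rw [min_eq_right h]; nlinarith [hx.2]
    have hca : max a p ≤ c := max_le hac hcp
    have hcb' : c ≤ min b q := le_min hcb hcq
    have h1 := hFtan (max a p) ⟨le_max_right _ _, hca.trans hcq⟩
    have h2 := hFtan (min b q) ⟨hcp.trans hcb', min_le_right _ _⟩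
    set M := ∫ x, -2 * (c - x) / ((c - x) ^ 2 + R ^ 2) ^ 2 ∂ν
    rcases le_total 0 M with hM | hM
    · nlinarith [mul_nonneg (sub_nonneg.2 hca) hM]
    · nlinarith [mul_nonneg (sub_nonneg.2 hcb') (neg_nonneg.2 hM)]

lemma vFun_eq_zero_iff [IsProbabilityMeasure ν] (hs : 0 < s) {α : ℝ} :
    vFun ν s α = 0 ↔ (α : ℂ) ∈ regSet ν s := by
  have := mem_regSet_iff_vFun_le (μ := ν) (α := α) hs (le_refl 0)
  rw [Complex.ofReal_zero, zero_mul, add_zero] at this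
  rw [this]
  exact ⟨fun h => h.le, fun h => le_antisymm h vFun_nonneg⟩

lemma vFun_eq_zero_of_far [IsProbabilityMeasure ν] (hs : 0 < s) (hae : ∀ᵐ x ∂ν, x ∈ Icc p q)
    {α : ℝ} (hα : α ≤ p - √s ∨ q + √s ≤ α) : vFun ν s α = 0 := by
  rw [vFun_eq_zero_iff hs]
  have hs' := Real.sqrt_pos.2 hs
  have hle : ∀ᵐ x : ℝ ∂ν, (‖(α : ℂ) - (x : ℂ)‖ₑ ^ 2)⁻¹ ≤ ENNReal.ofReal (1 / s) := by
    filter_upwards [hae] with x hx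
    have hd : √s ≤ |α - x| := by
      rcases hα with h | h
      · rw [abs_of_nonpos] <;> linarith [hx.1]
      · rw [abs_of_nonneg] <;> linarith [hx.2]
    have hne : (α : ℂ) - (x : ℂ) ≠ 0 := by
      rw [← Complex.ofReal_sub, Complex.ofReal_ne_zero]
      intro h; rw [h, abs_zero] at hd; linarith
    rw [← ofReal_kernel hne]
    apply ENNReal.ofReal_le_ofReal
    rw [norm_inv, inv_pow, ← Complex.ofReal_sub, Complex.norm_real, Real.norm_eq_abs, one_div]
    have : s ≤ |α - x| ^ 2 := by
      rw [← Real.sq_sqrt hs.le]; exact pow_le_pow_left₀ hs'.le hd 2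
    exact inv_anti₀ hs this
  calc invSq ν α ≤ ∫⁻ _, ENNReal.ofReal (1 / s) ∂ν := lintegral_mono_ae hle
    _ = _ := by simp

/-- If v(p) = 0 there is no atom at p, so D = q - p is positive and the integral at p is at least
1/D², contradicting s ≥ 4D². -/
lemma vFun_left_pos [IsProbabilityMeasure ν] (hs : 0 < s)
    (hae : ∀ᵐ x ∂ν, x ∈ Icc p q) (hsD : 4 * (q - p) ^ 2 ≤ s) : 0 < vFun ν s p := by
  refine lt_of_le_of_ne vFun_nonneg fun h => ?_
  have hmem := (vFun_eq_zero_iff hs).1 h.symm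
  have hfin := ne_top_of_mem_regSet hmem
  have hne := ae_ne_of_invSq hfin
  have h1 : ∀ᵐ x : ℝ ∂ν, 0 < q - p ∧ 1 / (q - p) ^ 2 ≤ ‖((p : ℂ) - (x : ℂ))⁻¹‖ ^ 2 := by
    filter_upwards [hae, hne] with x hx hxne
    rw [← Complex.ofReal_sub, Complex.ofReal_ne_zero] at hxne
    have hpx : p < x := lt_of_le_of_ne hx.1 fun h => hxne (sub_eq_zero.2 h)
    refine ⟨by linarith [hx.2], ?_⟩
    rw [norm_inv, inv_pow, ← Complex.ofReal_sub, Complex.norm_real, Real.norm_eq_abs, sq_abs,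
      one_div]
    apply inv_anti₀ (by nlinarith)
    nlinarith [hx.2]
  obtain ⟨x, hD, -⟩ := h1.exists
  have h2 : ∫ _, 1 / (q - p) ^ 2 ∂ν ≤ ∫ x : ℝ, ‖((p : ℂ) - (x : ℂ))⁻¹‖ ^ 2 ∂ν :=
    integral_mono_ae (integrable_const _) (integrable_kernel_sq hfin) (h1.mono fun x h => h.2)
  have h3 := integral_kernel_le hs hmem
  simp only [integral_const, probReal_univ, one_smul] at h2
  have h4 := h2.trans h3
  rw [one_div_le_one_div (by positivity) hs] at h4
  nlinarith [sq_pos_of_pos hD]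

/-- The positivity set of `v_{ν,s}` is a bounded open interval as soon as `s ≥ 4 D²`. -/
theorem exists_setOf_vFun_pos_eq_Ioo [IsProbabilityMeasure ν] (hs : 0 < s) (hpq : p ≤ q)
    (hae : ∀ᵐ x ∂ν, x ∈ Icc p q) (hsD : 4 * (q - p) ^ 2 ≤ s) :
    ∃ a b : ℝ, a < p ∧ p < b ∧ {α | 0 < vFun ν s α} = Ioo a b := by
  set S := {α | 0 < vFun ν s α} with hS
  have hpS : p ∈ S := vFun_left_pos hs hae hsD
  have hopen : IsOpen S := by
    have : S = ((fun α : ℝ => (α : ℂ)) ⁻¹' regSet ν s)ᶜ := by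
      ext α
      rw [mem_compl_iff, mem_preimage, ← vFun_eq_zero_iff hs]
      exact ⟨fun h => ne_of_gt h, fun h => lt_of_le_of_ne vFun_nonneg (Ne.symm h)⟩
    rw [this]
    exact (isClosed_regSet.preimage Complex.continuous_ofReal).isOpen_compl
  have hsub : S ⊆ Icc (p - √s) (q + √s) := fun α hα => by
    by_contra h
    rw [mem_Icc, not_and_or, not_le, not_le] at h
    exact (ne_of_gt hα) (vFun_eq_zero_of_far hs hae (h.imp le_of_lt le_of_lt))
  have hbb : BddBelow S := bddBelow_Icc.mono hsub
  have hba : BddAbove S := bddAbove_Icc.mono hsub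
  have hord : OrdConnected S := ⟨fun x hx y hy z hz =>
    (lt_min hx hy).trans_le (min_vFun_le hs hpq hae hsD hz.1 hz.2)⟩
  -- Openness of S keeps its infimum and supremum out of it.
  have hsubset : S ⊆ Ioo (sInf S) (sSup S) := fun x hx => by
    obtain ⟨ε, hε, hball⟩ := Metric.isOpen_iff.1 hopen x hx
    have h1 : x - ε / 2 ∈ S := hball (by
      rw [Metric.mem_ball, Real.dist_eq, abs_lt]; constructor <;> linarith)
    have h2 : x + ε / 2 ∈ S := hball (by
      rw [Metric.mem_ball, Real.dist_eq, abs_lt]; constructor <;> linarith)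
    exact ⟨by linarith [csInf_le hbb h1], by linarith [le_csSup hba h2]⟩
  refine ⟨sInf S, sSup S, (hsubset hpS).1, (hsubset hpS).2, subset_antisymm hsubset ?_⟩
  exact IsConnected.Ioo_csInf_csSup_subset ⟨⟨p, hpS⟩, hord.isPreconnected⟩ hbb hba

lemma exists_isMax_vFun [IsProbabilityMeasure ν] (hs : 0 < s) (hpq : p ≤ q)
    (hae : ∀ᵐ x ∂ν, x ∈ Icc p q) : ∃ c, ∀ α, vFun ν s α ≤ vFun ν s c := by
  have hs' := Real.sqrt_pos.2 hs
  obtain ⟨c, -, hc⟩ := (upperSemicontinuous_vFun (μ := ν) hs).upperSemicontinuousOn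
    (Icc (p - √s) (q + √s)) |>.exists_isMaxOn (nonempty_Icc.2 (by linarith)) isCompact_Icc
  refine ⟨c, fun α => ?_⟩
  by_cases h : α ∈ Icc (p - √s) (q + √s)
  · exact hc h
  · rw [mem_Icc, not_and_or, not_le, not_le] at h
    rw [vFun_eq_zero_of_far hs hae (h.imp le_of_lt le_of_lt)]
    exact vFun_nonneg

end Shape

/-! ### The domain `Ω` -/

section Domain

variable {μ ν κ : Measure ℝ} {u r : ℝ}

/-- H_{μ,-r} multiplies imaginary parts by 1 + r∫|z-x|⁻² dμ > 0, so a real value can come only from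
a real point. The real points of `regSet` are the zeros of v_{μ,r}, and these correspond to the
zeros of v_{ν,u+r}. -/
theorem SubordinateAtInfinity.omega_real [IsProbabilityMeasure μ] [IsProbabilityMeasure ν]
    (hsub : SubordinateAtInfinity μ ν u) (hu : 0 ≤ u) (hr : 0 < r)
    (hinj : Function.Injective (bdryRe ν (u + r) (u - r))) :
    {a : ℝ | (a : ℂ) ∈ Omega μ r} =
      bdryRe ν (u + r) (u - r) '' {α | 0 < vFun ν (u + r) α} := by
  have hs : 0 < u + r := by linarith
  ext a
  obtain ⟨α, rfl⟩ := surjective_bdryRe (μ := ν) hs (u - r) a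
  rw [hinj.mem_set_image, mem_ofPred_eq, mem_ofPred_eq, Omega, mem_compl_iff]
  constructor
  · intro h
    refine lt_of_le_of_ne vFun_nonneg fun hv => h ?_
    have hv' : vFun μ r (bdryRe ν (u + r) u α) = 0 := by
      rw [hsub.vFun_bdryRe hu hr, ← hv, mul_zero]
    refine ⟨bdry μ r (bdryRe ν (u + r) u α), (mem_regSet_iff_notMem_Lam hr).1 (bdry_mem hr), ?_⟩
    apply Complex.ext
    · exact hsub.aFun_bdryRe hu hr
    · rw [H_bdry_im hr, hv', mul_zero, Complex.ofReal_im]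
  · rintro hv ⟨z, hz, hza⟩
    have hz' : z ∈ regSet μ r := (mem_regSet_iff_notMem_Lam hr).2 hz
    have him := congrArg Complex.im hza
    rw [H_im (ne_top_of_mem_regSet hz'), Complex.ofReal_im] at him
    have hz0 : z.im = 0 := by
      rcases mul_eq_zero.1 him with h | h
      · exact h
      · have := integral_kernel_nonneg (μ := μ) (z := z)
        nlinarith
    obtain ⟨β, hβ⟩ := surjective_bdryRe (μ := ν) hs u z.re
    have hzre : z = (z.re : ℂ) := by apply Complex.ext <;> simp [hz0]
    have hv0 : vFun μ r z.re = 0 := (vFun_eq_zero_iff hr).2 (by rwa [← hzre])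
    have hzb : z = bdry μ r z.re := by apply Complex.ext <;> simp [hz0, hv0]
    have hre := congrArg Complex.re hza
    rw [hzb, ← hβ, Complex.ofReal_re] at hre
    have h2 := (hsub.aFun_bdryRe hu hr (α := β)).symm.trans hre
    rw [← hinj h2] at hv
    rw [← hβ, hsub.vFun_bdryRe hu hr] at hv0
    have : 0 < r / (u + r) * vFun ν (u + r) β := by positivity
    linarith

theorem SubordinateAtInfinity.bFun_bdryRe [IsProbabilityMeasure μ] [IsProbabilityMeasure ν]
    (hsub : SubordinateAtInfinity μ ν u) (hu : 0 ≤ u) (hr : 0 < r)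
    (hinj : Function.Injective (bdryRe ν (u + r) (u - r))) (α : ℝ) :
    bFun μ r (bdryRe ν (u + r) (u - r) α) = 2 * (r / (u + r)) * vFun ν (u + r) α := by
  have hs : 0 < u + r := by linarith
  have hainj : Function.Injective (aFun μ r) := fun x y hxy => by
    obtain ⟨β, rfl⟩ := surjective_bdryRe (μ := ν) hs u x
    obtain ⟨γ, rfl⟩ := surjective_bdryRe (μ := ν) hs u y
    rw [hsub.aFun_bdryRe hu hr, hsub.aFun_bdryRe hu hr] at hxy
    rw [hinj hxy]
  rw [bFun, ← hsub.aFun_bdryRe hu hr, Function.leftInverse_invFun hainj, hsub.vFun_bdryRe hu hr]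
  ring

/-- In the coordinate α the function is a positive multiple of v. A quasi-concave function is
monotone on either side of a maximum point, and the increasing reparametrization preserves this. -/
theorem SubordinateAtInfinity.isUnimodal_bFun [IsProbabilityMeasure μ] [IsProbabilityMeasure ν]
    (hsub : SubordinateAtInfinity μ ν u) (hu : 0 ≤ u) (hr : 0 < r)
    (hmono : StrictMono (bdryRe ν (u + r) (u - r))) {p q : ℝ} (hpq : p ≤ q)
    (hae : ∀ᵐ x ∂ν, x ∈ Icc p q) (hsD : 4 * (q - p) ^ 2 ≤ u + r) :
    IsUnimodal (bFun μ r) := by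
  have hs : 0 < u + r := by linarith
  obtain ⟨c, hc⟩ := exists_isMax_vFun (ν := ν) hs hpq hae
  have hsurj := surjective_bdryRe (μ := ν) hs (u - r)
  have hb := hsub.bFun_bdryRe hu hr hmono.injective
  have hpos : 0 < 2 * (r / (u + r)) := by positivity
  refine ⟨bdryRe ν (u + r) (u - r) c, fun x hx y hy hxy => ?_, fun x hx y hy hxy => ?_⟩ <;>
  · obtain ⟨α, rfl⟩ := hsurj x
    obtain ⟨β, rfl⟩ := hsurj y
    rw [hb, hb]
    refine mul_le_mul_of_nonneg_left ?_ hpos.le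
    have h1 := hmono.le_iff_le.1 hx
    have h2 := hmono.le_iff_le.1 hy
    have h3 := hmono.le_iff_le.1 hxy
    first
    | exact (min_eq_left (hc α)).symm.le.trans (min_vFun_le hs hpq hae hsD h3 h2)
    | exact (min_eq_right (hc β)).symm.le.trans (min_vFun_le hs hpq hae hsD h1 h3)

lemma cauchyTransform_conj (z : ℂ) :
    cauchyTransform μ ((starRingEnd ℂ) z) = (starRingEnd ℂ) (cauchyTransform μ z) := by
  rw [cauchyTransform, cauchyTransform, ← integral_conj]
  congr 1; ext x
  simp

lemma conj_mem_Omega {z : ℂ} (hz : z ∈ Omega μ r) : (starRingEnd ℂ) z ∈ Omega μ r := by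
  rintro ⟨w, hw, hwz⟩
  refine hz ⟨(starRingEnd ℂ) w, ?_, ?_⟩
  · simpa [Lam] using hw
  · have := congrArg (starRingEnd ℂ) hwz
    rw [Complex.conj_conj] at this
    rw [← this, H, H, cauchyTransform_conj]
    simp

/-- The second subordination, with parameter u - r, writes z as H_{ν,u-r}(w). If w were regular at
level u + r, then z would be H_{μ,-r}(H_{ν,u}(w)) and lie outside Ω. Hence Im w < √(u + r) and the
square integral at w exceeds 1/(u + r). -/
theorem SubordinateAtInfinity.im_lt_of_mem_Omega [IsProbabilityMeasure μ] [IsProbabilityMeasure ν]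
    [IsProbabilityMeasure κ] (hsub : SubordinateAtInfinity μ ν u)
    (hsub' : SubordinateAtInfinity κ ν (u - r)) (hur : r ≤ u) (hr : 0 < r) {z : ℂ}
    (hz : z ∈ Omega μ r) (him : 0 < z.im) : z.im < 2 * r / √(u + r) := by
  have hs : 0 < u + r := by linarith
  have hu : 0 ≤ u := hr.le.trans hur
  have hq : 0 ≤ u - r := sub_nonneg.2 hur
  set w := H κ (-(u - r)) z with hw
  have hwz : H ν (u - r) w = z := hsub'.H_H_neg hq him
  have hwim : 0 < w.im := H_neg_im_pos hq him
  have hfin := invSq_ne_top_of_im (μ := ν) hwim.ne'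
  have hwn : w ∉ regSet ν (u + r) := fun hreg => by
    obtain ⟨-, h2, h3⟩ := hsub.H_mem_regSet hu hr hwim hreg
    refine hz ⟨H ν u w, (mem_regSet_iff_notMem_Lam hr).1 h2, ?_⟩
    rw [H, h3, ← hwz, H, H]; push_cast; ring
  have h1 : w.im < √(u + r) := by
    by_contra! h
    refine hwn (mem_regSet_of_le_im hs ?_)
    rw [← Real.sq_sqrt hs.le]; exact pow_le_pow_left₀ (Real.sqrt_nonneg _) h 2
  rw [mem_regSet_iff hs hfin, not_le] at hwn
  have h2 := H_im hfin (u - r)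
  rw [hwz] at h2
  set F := ∫ x : ℝ, ‖(w - (x : ℂ))⁻¹‖ ^ 2 ∂ν
  have hsq := Real.sqrt_pos.2 hs
  calc z.im = w.im * (1 - (u - r) * F) := h2
    _ ≤ w.im * (1 - (u - r) * (1 / (u + r))) := by gcongr
    _ = w.im * (2 * r / (u + r)) := by field_simp; ring
    _ < √(u + r) * (2 * r / (u + r)) := by gcongr
    _ = 2 * r / √(u + r) := by
      have := Real.sq_sqrt hs.le
      field_simp; exact this

theorem SubordinateAtInfinity.abs_im_le_of_mem_Omega [IsProbabilityMeasure μ]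
    [IsProbabilityMeasure ν] [IsProbabilityMeasure κ] (hsub : SubordinateAtInfinity μ ν u)
    (hsub' : SubordinateAtInfinity κ ν (u - r)) (hur : r ≤ u) (hr : 0 < r) {z : ℂ}
    (hz : z ∈ Omega μ r) : |z.im| ≤ 2 * r / √(u + r) := by
  rcases lt_trichotomy z.im 0 with h | h | h
  · have := hsub.im_lt_of_mem_Omega hsub' hur hr (conj_mem_Omega hz) (by simpa using h)
    rw [Complex.conj_im] at this
    rw [abs_of_neg h]; exact this.le
  · rw [h, abs_zero]; positivity
  · rw [abs_of_pos h]; exact (hsub.im_lt_of_mem_Omega hsub' hur hr hz h).le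

end Domain

/-! ### Expansions at infinity -/

section Expansion

variable {ν : Measure ℝ} {m V D s : ℝ}

/-- `ν` has mean `m`, variance `V`, and is supported in `[m - D, m + D]`. -/
structure HasMoments (ν : Measure ℝ) (m V D : ℝ) : Prop where
  pos : 0 < D
  ae_le : ∀ᵐ x ∂ν, |x - m| ≤ D
  mean : ∫ x, (x - m) ∂ν = 0
  var : ∫ x, (x - m) ^ 2 ∂ν = V

lemma HasMoments.integrable [IsProbabilityMeasure ν] (h : HasMoments ν m V D) (n : ℕ) :
    Integrable (fun x => (x - m) ^ n) ν := by
  refine Integrable.of_bound (Measurable.aestronglyMeasurable (by fun_prop)) (D ^ n) ?_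
  filter_upwards [h.ae_le] with x hx
  rw [norm_pow, Real.norm_eq_abs]
  gcongr

lemma HasMoments.variance_nonneg (h : HasMoments ν m V D) : 0 ≤ V := by
  rw [← h.var]; exact integral_nonneg fun x => sq_nonneg _

lemma HasMoments.norm_cauchyTransform_sub_le [IsProbabilityMeasure ν] (h : HasMoments ν m V D)
    {w : ℂ} (hw : 2 * D ≤ ‖w - m‖) :
    ‖cauchyTransform ν w - (w - m)⁻¹ - V * ((w - m)⁻¹) ^ 3‖ ≤ 2 * D ^ 3 / ‖w - m‖ ^ 4 := by
  set z := w - (m : ℂ) with hz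
  have hD := h.pos
  have hz0 : 0 < ‖z‖ := by linarith
  have hzne : z ≠ 0 := norm_pos_iff.1 hz0
  have hi1 : Integrable (fun x : ℝ => ((x - m : ℝ) : ℂ)) ν := by
    have := h.integrable 1
    simp only [pow_one] at this
    exact this.ofReal
  have hi2 : Integrable (fun x : ℝ => (((x - m) ^ 2 : ℝ) : ℂ)) ν := (h.integrable 2).ofReal
  have hlow : ∀ x : ℝ, |x - m| ≤ D → ‖z‖ / 2 ≤ ‖w - (x : ℂ)‖ := fun x hx => by
    have h1 : w - (x : ℂ) = z - ((x - m : ℝ) : ℂ) := by rw [hz]; push_cast; ring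
    have h2 := norm_sub_norm_le z ((x - m : ℝ) : ℂ)
    rw [Complex.norm_real, Real.norm_eq_abs] at h2
    rw [h1]; linarith
  have hint : Integrable (fun x : ℝ => (w - (x : ℂ))⁻¹) ν := by
    refine Integrable.of_bound (aestronglyMeasurable_kernel w) (‖z‖ / 2)⁻¹ ?_
    filter_upwards [h.ae_le] with x hx
    rw [norm_inv]
    exact inv_anti₀ (by positivity) (hlow x hx)
  have hmean : ∫ x : ℝ, ((x - m : ℝ) : ℂ) ∂ν = 0 := by
    have h1 : ∫ x : ℝ, ((x - m : ℝ) : ℂ) ∂ν = ((∫ x : ℝ, (x - m) ∂ν : ℝ) : ℂ) := integral_ofReal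
    rw [h1, h.mean]; simp
  have hvar : ∫ x : ℝ, (((x - m) ^ 2 : ℝ) : ℂ) ∂ν = V := by
    have h1 : ∫ x : ℝ, (((x - m) ^ 2 : ℝ) : ℂ) ∂ν = ((∫ x : ℝ, (x - m) ^ 2 ∂ν : ℝ) : ℂ) :=
      integral_ofReal
    rw [h1, h.var]
  have hmain : cauchyTransform ν w - z⁻¹ - V * (z⁻¹) ^ 3 = ∫ x : ℝ, ((w - (x : ℂ))⁻¹ -
      (z⁻¹ + z⁻¹ ^ 2 * ((x - m : ℝ) : ℂ) + z⁻¹ ^ 3 * (((x - m) ^ 2 : ℝ) : ℂ))) ∂ν := by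
    have hc : Integrable (fun _ : ℝ => z⁻¹) ν := integrable_const _
    have hc1 : Integrable (fun x : ℝ => z⁻¹ + z⁻¹ ^ 2 * ((x - m : ℝ) : ℂ)) ν :=
      hc.add (hi1.const_mul _)
    have hc2 : Integrable (fun x : ℝ => z⁻¹ + z⁻¹ ^ 2 * ((x - m : ℝ) : ℂ) +
        z⁻¹ ^ 3 * (((x - m) ^ 2 : ℝ) : ℂ)) ν := hc1.add (hi2.const_mul _)
    rw [integral_sub hint hc2, integral_add hc1 (hi2.const_mul _),
      integral_add hc (hi1.const_mul _), integral_const_mul, integral_const_mul, hmean, hvar]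
    simp [cauchyTransform]; ring
  rw [hmain]
  have hb : ∀ᵐ x : ℝ ∂ν, ‖(w - (x : ℂ))⁻¹ - (z⁻¹ + z⁻¹ ^ 2 * ((x - m : ℝ) : ℂ) +
      z⁻¹ ^ 3 * (((x - m) ^ 2 : ℝ) : ℂ))‖ ≤ 2 * D ^ 3 / ‖z‖ ^ 4 := by
    filter_upwards [h.ae_le] with x hx
    have h1 := hlow x hx
    have hne : w - (x : ℂ) ≠ 0 := norm_pos_iff.1 (by linarith)
    -- The exact remainder of the geometric expansion of 1/(z - (x - m)) after three terms.
    have h2 : (w - (x : ℂ))⁻¹ - (z⁻¹ + z⁻¹ ^ 2 * ((x - m : ℝ) : ℂ) +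
        z⁻¹ ^ 3 * (((x - m) ^ 2 : ℝ) : ℂ)) =
        ((x - m : ℝ) : ℂ) ^ 3 * (z⁻¹ ^ 3 * (w - (x : ℂ))⁻¹) := by
      have hwz : w = z + m := by rw [hz]; ring
      rw [hwz] at hne ⊢
      field_simp
      push_cast
      ring
    rw [h2, norm_mul, norm_mul, norm_pow, norm_pow, norm_inv, norm_inv, Complex.norm_real,
      Real.norm_eq_abs]
    calc |x - m| ^ 3 * (‖z‖⁻¹ ^ 3 * ‖w - (x : ℂ)‖⁻¹) ≤ D ^ 3 * (‖z‖⁻¹ ^ 3 * (‖z‖ / 2)⁻¹) := by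
          gcongr
      _ = 2 * D ^ 3 / ‖z‖ ^ 4 := by field_simp
  have := norm_integral_le_of_norm_le_const hb
  simpa using this

/-- The first-order term in x - m integrates to 0, so the error is of second order; the remainder is
explicit and |b - x| ≥ |b - m|/2. -/
lemma HasMoments.abs_integral_sq_sub_le [IsProbabilityMeasure ν] (h : HasMoments ν m V D)
    {b : ℝ} (hb : 2 * D ≤ |b - m|) :
    |(∫ x : ℝ, ‖((b : ℂ) - (x : ℂ))⁻¹‖ ^ 2 ∂ν) - 1 / (b - m) ^ 2| ≤ 16 * D ^ 2 / (b - m) ^ 4 ∧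
      invSq ν b ≠ ⊤ := by
  set a := b - m with ha
  have hD := h.pos
  have ha0 : 0 < |a| := by linarith
  have hane : a ≠ 0 := abs_pos.1 ha0
  have hlow : ∀ x : ℝ, |x - m| ≤ D → |a| / 2 ≤ |b - x| := fun x hx => by
    have h1 : b - x = a - (x - m) := by rw [ha]; ring
    have h2 := abs_sub_abs_le_abs_sub a (x - m)
    rw [h1]; linarith
  have hfin : invSq ν b ≠ ⊤ := by
    have : invSq ν b ≤ ∫⁻ _, ENNReal.ofReal ((|a| / 2)⁻¹ ^ 2) ∂ν := by
      refine lintegral_mono_ae ?_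
      filter_upwards [h.ae_le] with x hx
      have h1 := hlow x hx
      have hne : (b : ℂ) - (x : ℂ) ≠ 0 := by
        rw [← Complex.ofReal_sub, Complex.ofReal_ne_zero]
        exact abs_pos.1 (by linarith)
      rw [← ofReal_kernel hne, norm_inv, ← Complex.ofReal_sub, Complex.norm_real, Real.norm_eq_abs]
      gcongr
    refine ne_top_of_le_ne_top ?_ this
    simp
  refine ⟨?_, hfin⟩
  have hi1 : Integrable (fun x : ℝ => 2 / a ^ 3 * (x - m)) ν := by
    have := h.integrable 1
    simp only [pow_one] at this
    exact this.const_mul _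
  have hk := integrable_kernel_sq hfin
  have hc : Integrable (fun _ : ℝ => 1 / a ^ 2) ν := integrable_const _
  have hmain : (∫ x : ℝ, ‖((b : ℂ) - (x : ℂ))⁻¹‖ ^ 2 ∂ν) - 1 / a ^ 2 =
      ∫ x : ℝ, (‖((b : ℂ) - (x : ℂ))⁻¹‖ ^ 2 - (1 / a ^ 2 + 2 / a ^ 3 * (x - m))) ∂ν := by
    have hc1 : Integrable (fun x : ℝ => 1 / a ^ 2 + 2 / a ^ 3 * (x - m)) ν := hc.add hi1
    rw [integral_sub hk hc1, integral_add hc hi1, integral_const_mul, h.mean]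
    simp
  rw [hmain, ← Real.norm_eq_abs]
  have hbd : ∀ᵐ x : ℝ ∂ν, ‖‖((b : ℂ) - (x : ℂ))⁻¹‖ ^ 2 - (1 / a ^ 2 + 2 / a ^ 3 * (x - m))‖ ≤
      16 * D ^ 2 / a ^ 4 := by
    filter_upwards [h.ae_le] with x hx
    have h1 := hlow x hx
    have hne : b - x ≠ 0 := abs_pos.1 (by linarith)
    set y := x - m with hy
    have hbx : b - x = a - y := by rw [ha, hy]; ring
    have h2 : ‖((b : ℂ) - (x : ℂ))⁻¹‖ ^ 2 - (1 / a ^ 2 + 2 / a ^ 3 * y) =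
        y ^ 2 * (3 * a - 2 * y) / (a ^ 3 * (b - x) ^ 2) := by
      rw [norm_inv, ← Complex.ofReal_sub, Complex.norm_real, Real.norm_eq_abs, inv_pow, sq_abs]
      rw [hbx] at hne ⊢
      field_simp; ring
    rw [h2, Real.norm_eq_abs, abs_div, abs_mul, abs_mul, abs_pow, abs_pow, abs_pow]
    have h3 : |3 * a - 2 * y| ≤ 4 * |a| := by
      have := abs_sub (3 * a) (2 * y)
      rw [abs_mul, abs_mul, abs_of_pos (by norm_num : (0 : ℝ) < 3), abs_two] at this
      linarith
    have ha4 : a ^ 4 = |a| ^ 4 := by rw [← abs_pow, abs_of_nonneg (by positivity)]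
    rw [ha4]
    calc |y| ^ 2 * |3 * a - 2 * y| / (|a| ^ 3 * |b - x| ^ 2) ≤
        D ^ 2 * (4 * |a|) / (|a| ^ 3 * (|a| / 2) ^ 2) := by gcongr
      _ = 16 * D ^ 2 / |a| ^ 4 := by field_simp; norm_num
  have := norm_integral_le_of_norm_le_const hbd
  simpa using this

/-- Almost every x is within |w - m| + D of w, so the square integral is at least (|w - m| + D)⁻².
-/
lemma HasMoments.sqrt_sub_le_norm [IsProbabilityMeasure ν] (h : HasMoments ν m V D) (hs : 0 < s)
    {w : ℂ} (hw : w ∈ regSet ν s) : √s - D ≤ ‖w - m‖ := by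
  have hD := h.pos
  have hpos : 0 < ‖w - m‖ + D := by positivity
  have hfin := ne_top_of_mem_regSet hw
  have h1 : ∫ _, 1 / (‖w - m‖ + D) ^ 2 ∂ν ≤ ∫ x : ℝ, ‖(w - (x : ℂ))⁻¹‖ ^ 2 ∂ν := by
    refine integral_mono_ae (integrable_const _) (integrable_kernel_sq hfin) ?_
    filter_upwards [h.ae_le, ae_ne_of_invSq hfin] with x hx hne
    have h2 : ‖w - (x : ℂ)‖ ≤ ‖w - m‖ + D := by
      have h3 : w - (x : ℂ) = (w - m) - ((x - m : ℝ) : ℂ) := by push_cast; ring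
      rw [h3]
      refine (norm_sub_le _ _).trans ?_
      rw [Complex.norm_real, Real.norm_eq_abs]; linarith
    have h4 : 0 < ‖w - (x : ℂ)‖ := norm_pos_iff.2 hne
    rw [norm_inv, inv_pow, one_div]
    gcongr
  have h2 := h1.trans (integral_kernel_le hs hw)
  simp only [integral_const, probReal_univ, one_smul] at h2
  rw [one_div_le_one_div (by positivity) hs] at h2
  have := (Real.sqrt_le_left hpos.le).2 h2
  linarith

/-! ### The ellipse estimate -/

/-- If `w + s G_ν(w) = m + 2 √s cos φ`, then `G_ν(w)` is close to `e^{-iφ} / √s`. -/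
theorem HasMoments.norm_cauchyTransform_sub_exp_le [IsProbabilityMeasure ν]
    (h : HasMoments ν m V D) (hs : 0 < s) (hsD : 3 * D ≤ √s) {w : ℂ} (hw : w ∈ regSet ν s)
    (him : 0 ≤ w.im) {φ κ B : ℝ} (hκ : 0 < κ) (hφ : κ ≤ Real.sin φ)
    (hH : H ν s w = ((m + 2 * √s * Real.cos φ : ℝ) : ℂ))
    (hB : V / (√s - D) ^ 2 + 2 * D ^ 3 / (√s - D) ^ 3 ≤ B) (hBκ : B / κ < 2 * κ) :
    ‖cauchyTransform ν w - ((Real.cos φ : ℂ) - (Real.sin φ : ℂ) * Complex.I) / (√s : ℂ)‖ ≤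
      B / (2 * κ - B / κ) / √s := by
  have hD := h.pos
  have hV := h.variance_nonneg
  set ρ := √s with hρ
  have hρ0 : 0 < ρ := Real.sqrt_pos.2 hs
  have hρC : (ρ : ℂ) ≠ 0 := by exact_mod_cast hρ0.ne'
  have hs2 : (s : ℂ) = (ρ : ℂ) ^ 2 := by rw [← Real.sq_sqrt hs.le]; push_cast; rfl
  set G := cauchyTransform ν w with hG
  set z := w - (m : ℂ) with hz
  have hnorm := h.sqrt_sub_le_norm hs hw
  have hρD : 0 < ρ - D := by linarith
  have hz0 : 0 < ‖z‖ := by linarith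
  have hzne : z ≠ 0 := norm_pos_iff.1 hz0
  have hexp := h.norm_cauchyTransform_sub_le (w := w) (by linarith)
  have hzG : ‖1 - z * G‖ ≤ B := by
    have h1 : 1 - z * G = -(z * (G - z⁻¹ - V * z⁻¹ ^ 3)) - V * z⁻¹ ^ 2 := by
      field_simp; ring
    rw [h1]
    refine le_trans ?_ hB
    calc ‖-(z * (G - z⁻¹ - V * z⁻¹ ^ 3)) - V * z⁻¹ ^ 2‖
        ≤ ‖z‖ * (2 * D ^ 3 / ‖z‖ ^ 4) + V * ‖z‖⁻¹ ^ 2 := by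
          refine (norm_sub_le _ _).trans ?_
          rw [norm_neg, norm_mul, norm_mul, norm_pow, norm_inv, Complex.norm_real,
            Real.norm_of_nonneg hV]
          gcongr
      _ = V / ‖z‖ ^ 2 + 2 * D ^ 3 / ‖z‖ ^ 3 := by field_simp; ring
      _ ≤ _ := by gcongr
  set e : ℂ := (Real.cos φ : ℂ) + (Real.sin φ : ℂ) * Complex.I with he
  set e' : ℂ := (Real.cos φ : ℂ) - (Real.sin φ : ℂ) * Complex.I with he'
  have hee : e * e' = 1 := by
    have := Real.sin_sq_add_cos_sq φ
    have h2 : (Real.sin φ : ℂ) ^ 2 + (Real.cos φ : ℂ) ^ 2 = 1 := by exact_mod_cast this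
    rw [he, he']
    linear_combination h2 - (Real.sin φ : ℂ) ^ 2 * Complex.I_sq
  have hsum : e + e' = 2 * (Real.cos φ : ℂ) := by rw [he, he']; ring
  set o : ℂ := z / ρ with ho
  have hoG : o + ρ * G = e + e' := by
    rw [hsum, ho]
    rw [H, ← hG, hs2] at hH
    have h2 : z + (ρ : ℂ) ^ 2 * G = 2 * ρ * (Real.cos φ : ℂ) := by
      rw [hz]; push_cast at hH ⊢; linear_combination hH
    field_simp
    linear_combination h2
  -- The numbers o and √s G have the same sum as e^{iφ} and e^{-iφ} and nearly the same product, so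
  -- o is nearly a root of the quadratic with these roots.
  have hprod : (o - e) * (o - e') = 1 - z * G := by
    have h2 : z * G = o * (ρ * G) := by rw [ho]; field_simp
    rw [h2]
    linear_combination hee + o * hoG
  set δ := ‖o - e‖ with hδ
  have hδ0 : 0 ≤ δ := norm_nonneg _
  have hpr : δ * ‖o - e'‖ ≤ B := by rw [hδ, ← norm_mul, hprod]; exact hzG
  have hoim : 0 ≤ o.im := by
    have h2 : o = ((ρ⁻¹ : ℝ) : ℂ) * z := by rw [ho]; push_cast; field_simp
    rw [h2, Complex.im_ofReal_mul, hz]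
    simp only [Complex.sub_im, Complex.ofReal_im, sub_zero]
    positivity
  -- Since o lies in the closed upper half-plane, it stays away from the lower root e^{-iφ}.
  have h1 : κ ≤ ‖o - e'‖ := by
    have h2 : (o - e').im = o.im + Real.sin φ := by
      rw [he']
      simp only [Complex.sub_im, Complex.ofReal_im, Complex.mul_im, Complex.ofReal_re, Complex.I_im,
        Complex.I_re]
      ring
    have := Complex.im_le_norm (o - e')
    linarith
  have h2 : 2 * κ - δ ≤ ‖o - e'‖ := by
    have h3 : e - e' = ((2 * Real.sin φ : ℝ) : ℂ) * Complex.I := by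
      rw [he, he']; push_cast; ring
    have h4 : ‖e - e'‖ = 2 * Real.sin φ := by
      rw [h3, norm_mul, Complex.norm_I, mul_one, Complex.norm_real, Real.norm_of_nonneg (by linarith)]
    have h5 : ‖e - e'‖ ≤ ‖o - e'‖ + δ := by
      rw [show e - e' = (o - e') - (o - e) by ring]
      exact norm_sub_le _ _
    linarith
  -- A bootstrap: the crude separation κ makes δ small, which improves the separation to 2κ - B/κ.
  -- The limiting factor 1/(2κ) is what allows every C > V/2.
  have h3 : δ ≤ B / κ := by
    rw [le_div_iff₀ hκ]
    exact (mul_le_mul_of_nonneg_left h1 hδ0).trans hpr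
  have h4 : δ ≤ B / (2 * κ - B / κ) := by
    rw [le_div_iff₀ (by linarith)]
    refine (mul_le_mul_of_nonneg_left ?_ hδ0).trans hpr
    linarith
  have h5 : G - e' / ρ = -(o - e) / ρ := by
    field_simp
    linear_combination hoG
  rw [h5, norm_div, norm_neg, Complex.norm_real, Real.norm_of_nonneg hρ0.le]
  gcongr

lemma tendsto_one_div_sqrt : Tendsto (fun s : ℝ => 1 / √s) atTop (𝓝 0) :=
  (tendsto_const_nhds (x := (1 : ℝ))).div_atTop Real.tendsto_sqrt_atTop

/-- With ε = 1/√s one takes B = ε² b(ε), where b is continuous at 0 and b(0) = V. At ε = 0 the last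
inequality reads Vκ < 2Cκ. -/
lemma eventually_ellipse_bound {κ C : ℝ} (hκ : 0 < κ) (hC : V / 2 < C) :
    ∀ᶠ s : ℝ in atTop, ∃ B, V / (√s - D) ^ 2 + 2 * D ^ 3 / (√s - D) ^ 3 ≤ B ∧ B / κ < 2 * κ ∧
      B / (2 * κ - B / κ) < C / (κ * s) := by
  set b : ℝ → ℝ := fun ε => V / (1 - D * ε) ^ 2 + 2 * D ^ 3 * ε / (1 - D * ε) ^ 3 with hb
  have hbc : ContinuousAt b 0 := by
    have h1 : ContinuousAt (fun ε : ℝ => (1 - D * ε)) 0 := by fun_prop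
    refine ContinuousAt.add (continuousAt_const.div (h1.pow 2) (by simp)) ?_
    exact ContinuousAt.div (by fun_prop) (h1.pow 3) (by simp)
  have hb0 : b 0 = V := by simp [hb]
  have hf : ContinuousAt (fun ε : ℝ => b ε * κ - C * (2 * κ - ε ^ 2 * b ε / κ)) 0 :=
    (hbc.mul continuousAt_const).sub (continuousAt_const.mul (continuousAt_const.sub
      (((continuousAt_id.pow 2).mul hbc).div_const κ)))
  have hg : ContinuousAt (fun ε : ℝ => ε ^ 2 * b ε / κ) 0 :=
    ((continuousAt_id.pow 2).mul hbc).div_const κ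
  have e1 : ∀ᶠ ε in 𝓝 (0 : ℝ), b ε * κ - C * (2 * κ - ε ^ 2 * b ε / κ) < 0 := by
    refine hf.eventually_lt continuousAt_const ?_
    simp only [hb0]
    rw [zero_pow two_ne_zero, zero_mul, zero_div, sub_zero]
    nlinarith
  have e2 : ∀ᶠ ε in 𝓝 (0 : ℝ), ε ^ 2 * b ε / κ < 2 * κ := by
    refine hg.eventually_lt continuousAt_const ?_
    simp; exact hκ
  filter_upwards [tendsto_one_div_sqrt.eventually e1, tendsto_one_div_sqrt.eventually e2,
    Real.tendsto_sqrt_atTop.eventually_gt_atTop D, eventually_gt_atTop 0] with s h1 h2 hsD hs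
  have hρ : 0 < √s := Real.sqrt_pos.2 hs
  have hs2 : √s ^ 2 = s := Real.sq_sqrt hs.le
  have hsub : √s - D ≠ 0 := by linarith
  refine ⟨(1 / √s) ^ 2 * b (1 / √s), le_of_eq ?_, h2, ?_⟩
  · have h3 : 1 - D * (1 / √s) = (√s - D) / √s := by field_simp
    simp only [hb, h3]
    field_simp
  · set bb := b (1 / √s)
    have hpos : 0 < 2 * κ - (1 / √s) ^ 2 * bb / κ := by linarith
    rw [div_lt_div_iff₀ hpos (by positivity)]
    have h4 : (1 / √s) ^ 2 * bb * (κ * s) = bb * κ := by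
      rw [one_div, inv_pow, hs2]; field_simp
    rw [h4]; linarith

/-! ### The end points of the positivity set -/

/-- `b` is the end point of the positivity set of `v_{ν,s}` on the side given by the sign `ς`. -/
structure IsEndpoint (ν : Measure ℝ) (s m D ς b : ℝ) : Prop where
  vFun_eq : vFun ν s b = 0
  side : -D ≤ ς * (b - m)
  eventually_pos : ∀ᶠ ε in 𝓝[>] (0 : ℝ), 0 < vFun ν s (b - ς * ε)

/-- At b itself v = 0 bounds the square integral above by 1/s; at nearby interior points v > 0
bounds it below. Comparing both with the expansion in b - m locates (b - m)². -/
lemma HasMoments.endpoint_bounds [IsProbabilityMeasure ν] (h : HasMoments ν m V D) (hs : 0 < s)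
    (hsD : 4 * D ≤ √s) {ς b : ℝ} (hς : ς = 1 ∨ ς = -1) (hb : IsEndpoint ν s m D ς b) :
    √s - D ≤ ς * (b - m) ∧ ς * (b - m) ≤ √s + D ∧
      |1 / s - 1 / (b - m) ^ 2| ≤ 16 * D ^ 2 / (b - m) ^ 4 := by
  have hD := h.pos
  have hς1 : |ς| = 1 := by rcases hς with rfl | rfl <;> simp
  have hmem : (b : ℂ) ∈ regSet ν s := (vFun_eq_zero_iff hs).1 hb.vFun_eq
  have h1 := h.sqrt_sub_le_norm hs hmem
  rw [← Complex.ofReal_sub, Complex.norm_real, Real.norm_eq_abs] at h1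
  have habs : |ς * (b - m)| = |b - m| := by rw [abs_mul, hς1, one_mul]
  -- The side condition excludes the opposite sign, since |b - m| ≥ √s - D ≥ 3D > D.
  have hlow : √s - D ≤ ς * (b - m) := by
    rw [← habs] at h1
    rcases abs_cases (ς * (b - m)) with ⟨h2, -⟩ | ⟨h2, -⟩
    · rwa [h2] at h1
    · rw [h2] at h1; linarith [hb.side]
  have hlim : Tendsto (fun ε : ℝ => b - ς * ε) (𝓝[>] 0) (𝓝 b) := by
    have : Tendsto (fun ε : ℝ => b - ς * ε) (𝓝 0) (𝓝 (b - ς * 0)) :=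
      Continuous.tendsto (by fun_prop) 0
    rw [mul_zero, sub_zero] at this
    exact this.mono_left nhdsWithin_le_nhds
  have hae : ∀ᵐ x ∂ν, x ∈ Icc (m - D) (m + D) := by
    filter_upwards [h.ae_le] with x hx
    have := abs_le.1 hx
    exact ⟨by linarith, by linarith⟩
  have hup : ς * (b - m) ≤ √s + D := by
    have h2 : |b - m| ≤ √s + D := by
      refine le_of_tendsto ((hlim.sub_const m).abs) ?_
      filter_upwards [hb.eventually_pos] with ε hε
      by_contra hc
      refine hε.ne' (vFun_eq_zero_of_far hs hae ?_)
      rcases abs_cases (b - ς * ε - m) with ⟨h3, -⟩ | ⟨h3, -⟩ <;> rw [h3, not_le] at hc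
      · right; linarith
      · left; linarith
    rw [← habs] at h2
    exact (le_abs_self _).trans h2
  refine ⟨hlow, hup, ?_⟩
  have hb2 : 3 * D ≤ |b - m| := by linarith
  have hbne : b - m ≠ 0 := abs_pos.1 (by linarith)
  have hb1 := abs_le.1 (h.abs_integral_sq_sub_le (b := b) (by linarith)).1
  have hb3 := integral_kernel_le hs hmem
  -- The limit is taken in the rational upper bound, so continuity of the square integral along the
  -- real axis is not needed.
  have hup2 : 1 / s ≤ 1 / (b - m) ^ 2 + 16 * D ^ 2 / (b - m) ^ 4 := by
    have hc : Tendsto (fun β : ℝ => 1 / (β - m) ^ 2 + 16 * D ^ 2 / (β - m) ^ 4) (𝓝 b)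
        (𝓝 (1 / (b - m) ^ 2 + 16 * D ^ 2 / (b - m) ^ 4)) := by
      have h2 : ContinuousAt (fun β : ℝ => β - m) b := by fun_prop
      exact ((continuousAt_const.div (h2.pow 2) (pow_ne_zero 2 hbne)).add
        (continuousAt_const.div (h2.pow 4) (pow_ne_zero 4 hbne))).tendsto
    refine ge_of_tendsto (hc.comp hlim) ?_
    have hev : ∀ᶠ β in 𝓝 b, 2 * D < |β - m| :=
      ContinuousAt.eventually_lt (by fun_prop) (by fun_prop) (by linarith)
    filter_upwards [hb.eventually_pos, hlim.eventually hev] with ε hε hε2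
    obtain ⟨h3, h4⟩ := h.abs_integral_sq_sub_le (b := b - ς * ε) hε2.le
    have h5 : ((b - ς * ε : ℝ) : ℂ) ∉ regSet ν s := fun hc => hε.ne' ((vFun_eq_zero_iff hs).2 hc)
    rw [mem_regSet_iff hs h4, not_le] at h5
    have h6 := (abs_le.1 h3).2
    simp only [Function.comp]
    linarith
  rw [abs_le]
  constructor <;> linarith

end Expansion

/-! ### Asymptotics of the end points. -/

section Endpoints

variable {ν : Measure ℝ} {m V D : ℝ}

theorem HasMoments.tendsto_endpoint [IsProbabilityMeasure ν] (h : HasMoments ν m V D) {t ς : ℝ}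
    (ht : 0 < t) (hς : ς = 1 ∨ ς = -1) {b : ℝ → ℝ}
    (hb : ∀ᶠ s in atTop, IsEndpoint ν s m D ς (b s)) :
    Tendsto (fun s => √s * (ς * (bdryRe ν s (s - t) (b s) - m) - 2 * √s)) atTop (𝓝 (V - t)) := by
  have hD := h.pos
  have hς2 : ς * ς = 1 := by rcases hς with rfl | rfl <;> norm_num
  set ε : ℝ → ℝ := fun s => 1 / √s with hε
  set X : ℝ → ℝ := fun s => ς * (b s - m) / √s with hX
  have hε0 : Tendsto ε atTop (𝓝 0) := tendsto_one_div_sqrt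
  have hbig : ∀ᶠ s : ℝ in atTop, 0 < s ∧ t ≤ s ∧ 4 * D ≤ √s ∧ IsEndpoint ν s m D ς (b s) := by
    filter_upwards [eventually_gt_atTop 0, eventually_ge_atTop t,
      Real.tendsto_sqrt_atTop.eventually_ge_atTop (4 * D), hb] with s h1 h2 h3 h4
      using ⟨h1, h2, h3, h4⟩
  have hX1 : Tendsto X atTop (𝓝 1) := by
    rw [tendsto_iff_dist_tendsto_zero]
    have hDε : Tendsto (fun s => D * ε s) atTop (𝓝 0) := by simpa using hε0.const_mul D
    refine squeeze_zero' (Eventually.of_forall fun s => dist_nonneg) ?_ hDε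
    filter_upwards [hbig] with s hs
    obtain ⟨hs0, -, hsD, hbs⟩ := hs
    obtain ⟨h1, h2, -⟩ := h.endpoint_bounds hs0 hsD hς hbs
    have hρ : 0 < √s := Real.sqrt_pos.2 hs0
    rw [Real.dist_eq, hX, hε]
    have : ς * (b s - m) / √s - 1 = (ς * (b s - m) - √s) / √s := by field_simp
    simp only [this]
    rw [abs_div, abs_of_pos hρ, mul_one_div]
    gcongr
    rw [abs_le]; constructor <;> linarith
  -- These are the terms of order 1/√s before rescaling: -t/a from the leading part of G_ν, and (s -
  -- t)V/a³ from the variance.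
  have hlim : Tendsto (fun s => -t / X s + (1 - t * ε s ^ 2) * V / X s ^ 3) atTop
      (𝓝 (-t / 1 + (1 - t * 0 ^ 2) * V / 1 ^ 3)) :=
    (tendsto_const_nhds.div hX1 one_ne_zero).add
      ((((hε0.pow 2).const_mul t).const_sub 1 |>.mul_const V).div (hX1.pow 3) (by norm_num))
  have herr : Tendsto (fun s => 256 * D ^ 4 * ε s ^ 2 / X s ^ 5 + 2 * D ^ 3 * ε s / X s ^ 4) atTop
      (𝓝 (256 * D ^ 4 * 0 ^ 2 / 1 ^ 5 + 2 * D ^ 3 * 0 / 1 ^ 4)) :=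
    (((hε0.pow 2).const_mul _).div (hX1.pow 5) (by norm_num)).add
      ((hε0.const_mul _).div (hX1.pow 4) (by norm_num))
  have e1 : -t / 1 + (1 - t * 0 ^ 2) * V / 1 ^ 3 = V - t := by ring
  have e2 : 256 * D ^ 4 * 0 ^ 2 / 1 ^ 5 + 2 * D ^ 3 * 0 / 1 ^ 4 = 0 := by ring
  rw [e1] at hlim
  rw [e2] at herr
  have hdiff : Tendsto (fun s => √s * (ς * (bdryRe ν s (s - t) (b s) - m) - 2 * √s) -
      (-t / X s + (1 - t * ε s ^ 2) * V / X s ^ 3)) atTop (𝓝 0) := by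
    refine squeeze_zero_norm' ?_ herr
    filter_upwards [hbig] with s hs
    obtain ⟨hs0, hts, hsD, hbs⟩ := hs
    obtain ⟨h1, h2, h3⟩ := h.endpoint_bounds hs0 hsD hς hbs
    set ρ := √s with hρdef
    have hρ : 0 < ρ := Real.sqrt_pos.2 hs0
    have hs2 : s = ρ ^ 2 := (Real.sq_sqrt hs0.le).symm
    set a := ς * (b s - m) with ha
    have ha0 : 0 < a := by linarith
    have hbm : b s - m = ς * a := by rw [ha, ← mul_assoc, hς2, one_mul]
    have hbm2 : (b s - m) ^ 2 = a ^ 2 := by rw [hbm]; linear_combination a ^ 2 * hς2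
    have hbm4 : (b s - m) ^ 4 = a ^ 4 := by
      rw [show (b s - m) ^ 4 = ((b s - m) ^ 2) ^ 2 by ring, hbm2]; ring
    rw [hbm2, hbm4] at h3
    have hbd : bdry ν s (b s) = (b s : ℂ) := by simp [bdry, hbs.vFun_eq]
    have hnorm : ‖(b s : ℂ) - (m : ℂ)‖ = a := by
      rw [← Complex.ofReal_sub, Complex.norm_real, Real.norm_eq_abs, hbm, abs_mul, abs_of_pos ha0]
      rcases hς with h' | h' <;> rw [h'] <;> simp
    have hG := h.norm_cauchyTransform_sub_le (w := (b s : ℂ)) (by rw [hnorm]; linarith)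
    rw [hnorm] at hG
    set g := (cauchyTransform ν (b s)).re with hg
    have hre : (cauchyTransform ν (b s) - ((b s : ℂ) - m)⁻¹ - V * (((b s : ℂ) - m)⁻¹) ^ 3).re =
        g - ς / a - V * (ς / a ^ 3) := by
      have h4 : ((b s : ℂ) - m)⁻¹ = ((ς / a : ℝ) : ℂ) := by
        rw [← Complex.ofReal_sub, ← Complex.ofReal_inv, hbm]
        congr 1
        rcases hς with h' | h' <;> rw [h'] <;> field_simp
      have h5 : (ς / a) ^ 3 = ς / a ^ 3 := by
        rw [div_pow, show ς ^ 3 = ς * (ς * ς) by ring, hς2, mul_one]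
      rw [h4, ← Complex.ofReal_pow, h5, ← Complex.ofReal_mul, Complex.sub_re, Complex.sub_re,
        Complex.ofReal_re, Complex.ofReal_re]
    have hge : |g - ς / a - V * (ς / a ^ 3)| ≤ 2 * D ^ 3 / a ^ 4 := by
      rw [← hre]; exact (Complex.abs_re_le_norm _).trans hG
    set e := g - ς / a - V * (ς / a ^ 3) with he
    have hgval : ς * g = 1 / a + V / a ^ 3 + ς * e := by
      rw [he]
      linear_combination (1 / a + V / a ^ 3) * hς2
    have hbr : ς * (bdryRe ν s (s - t) (b s) - m) = a + (s - t) * (1 / a + V / a ^ 3 + ς * e) := by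
      rw [bdryRe_eq, hbd, ← hg, ← hgval, ha]; ring
    -- The identity a + ρ²/a - 2ρ = (a - ρ)²/a makes the error in a enter quadratically.
    have hmain : ρ * (ς * (bdryRe ν s (s - t) (b s) - m) - 2 * ρ) -
        (-t / X s + (1 - t * ε s ^ 2) * V / X s ^ 3) =
        ρ * (a - ρ) ^ 2 / a + (s - t) * ρ * (ς * e) := by
      have key : ∀ s' : ℝ, s' = ρ ^ 2 →
          ρ * (a + (s' - t) * (1 / a + V / a ^ 3 + ς * e) - 2 * ρ) -
            (-t / (a / ρ) + (1 - t * (1 / ρ) ^ 2) * V / (a / ρ) ^ 3) =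
          ρ * (a - ρ) ^ 2 / a + (s' - t) * ρ * (ς * e) := by
        rintro _ rfl
        field_simp
        ring
      rw [hbr]
      exact key s hs2
    rw [hmain]
    have hXa : X s = a / ρ := rfl
    have hεa : ε s = 1 / ρ := rfl
    have hsq : (a - ρ) ^ 2 ≤ 256 * D ^ 4 * ρ ^ 2 / a ^ 4 := by
      have h4 : |a ^ 2 - ρ ^ 2| ≤ 16 * D ^ 2 * ρ ^ 2 / a ^ 2 := by
        have h5 : a ^ 2 - ρ ^ 2 = (1 / s - 1 / a ^ 2) * (a ^ 2 * ρ ^ 2) := by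
          rw [hs2]; field_simp
        rw [h5, abs_mul, abs_of_nonneg (by positivity : 0 ≤ a ^ 2 * ρ ^ 2)]
        calc _ ≤ 16 * D ^ 2 / a ^ 4 * (a ^ 2 * ρ ^ 2) := by gcongr
          _ = _ := by field_simp
      have h6 : (a ^ 2 - ρ ^ 2) ^ 2 ≤ (16 * D ^ 2 * ρ ^ 2 / a ^ 2) ^ 2 := by
        rw [← sq_abs]; exact pow_le_pow_left₀ (abs_nonneg _) h4 2
      have h7 : (a - ρ) ^ 2 * ρ ^ 2 ≤ (a ^ 2 - ρ ^ 2) ^ 2 := by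
        rw [show (a ^ 2 - ρ ^ 2) ^ 2 = (a - ρ) ^ 2 * (a + ρ) ^ 2 by ring]
        gcongr; linarith
      have h8 : (a - ρ) ^ 2 * ρ ^ 2 ≤ (256 * D ^ 4 * ρ ^ 2 / a ^ 4) * ρ ^ 2 := by
        refine (h7.trans h6).trans_eq ?_
        field_simp; ring
      exact le_of_mul_le_mul_right h8 (by positivity)
    have hςe : |ς * e| ≤ 2 * D ^ 3 / a ^ 4 := by
      rw [abs_mul]
      rcases hς with h' | h' <;> rw [h'] <;> simpa using hge
    calc ‖ρ * (a - ρ) ^ 2 / a + (s - t) * ρ * (ς * e)‖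
        ≤ ρ * (a - ρ) ^ 2 / a + (s - t) * ρ * |ς * e| := by
          refine (norm_add_le _ _).trans ?_
          rw [Real.norm_of_nonneg (by positivity), Real.norm_eq_abs, abs_mul, abs_mul,
            abs_of_nonneg (sub_nonneg.2 hts), abs_of_pos hρ]
      _ ≤ ρ * (256 * D ^ 4 * ρ ^ 2 / a ^ 4) / a + ρ ^ 2 * ρ * (2 * D ^ 3 / a ^ 4) := by
          gcongr
          rw [← hs2]; linarith
      _ = _ := by
          rw [hXa, hεa]; field_simp
  have := hdiff.add hlim
  simpa using this

/-- The extra 1 in the radius keeps it positive for a point mass. -/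
lemma hasMoments_of_ae_mem_Icc [IsProbabilityMeasure ν] {p q : ℝ} (hae : ∀ᵐ x ∂ν, x ∈ Icc p q) :
    p ≤ ∫ x, x ∂ν ∧ ∫ x, x ∂ν ≤ q ∧
      HasMoments ν (∫ x, x ∂ν) (∫ x, x ^ 2 ∂ν - (∫ x, x ∂ν) ^ 2) (q - p + 1) := by
  have habs : ∀ᵐ x ∂ν, |x| ≤ max |p| |q| := by
    filter_upwards [hae] with x hx using abs_le_max_abs_abs hx.1 hx.2
  have hi : ∀ n : ℕ, Integrable (fun x : ℝ => x ^ n) ν := fun n => by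
    refine Integrable.of_bound (Measurable.aestronglyMeasurable (by fun_prop)) (max |p| |q| ^ n) ?_
    filter_upwards [habs] with x hx
    rw [norm_pow, Real.norm_eq_abs]
    gcongr
  have hi1 : Integrable (fun x : ℝ => x) ν := by simpa using hi 1
  have hi2 := hi 2
  have hp : p ≤ ∫ x, x ∂ν := by
    have : ∫ _, p ∂ν ≤ ∫ x, x ∂ν :=
      integral_mono_ae (integrable_const _) hi1 (hae.mono fun x hx => hx.1)
    simpa using this
  have hq : ∫ x, x ∂ν ≤ q := by
    have : ∫ x, x ∂ν ≤ ∫ _, q ∂ν :=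
      integral_mono_ae hi1 (integrable_const _) (hae.mono fun x hx => hx.2)
    simpa using this
  set m := ∫ x, x ∂ν with hm
  refine ⟨hp, hq, by linarith, ?_, ?_, ?_⟩
  · filter_upwards [hae] with x hx
    rw [abs_le]; constructor <;> linarith [hx.1, hx.2]
  · rw [integral_sub hi1 (integrable_const _)]; simp [hm]
  · have h1 : ∀ x : ℝ, (x - m) ^ 2 = x ^ 2 - (2 * m) * x + m ^ 2 := fun x => by ring
    have h2 : Integrable (fun x : ℝ => x ^ 2 - (2 * m) * x) ν := hi2.sub (hi1.const_mul _)
    simp only [h1]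
    rw [integral_add h2 (integrable_const _), integral_sub hi2 (hi1.const_mul _),
      integral_const_mul, ← hm]
    simp; ring

end Endpoints

/-! ### Specialization to y₀ + σ̃_{s-t/2} and the statements of the theorem. -/

section Main

variable {A : Type*} [CStarAlgebra A] {τ : A →ₗ[ℂ] ℂ} {y₀ : A} {σ : ℝ → A} {s t : ℝ}

lemma IsLaw.mean_eq {μ : Measure ℝ} (h : IsLaw τ y₀ μ) : ∫ x, x ∂μ = mean τ y₀ := by
  have := h.moment 1
  simp only [pow_one] at this
  rw [mean, ← this, Complex.ofReal_re]

lemma IsLaw.variance_eq {μ : Measure ℝ} (h : IsLaw τ y₀ μ) :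
    ∫ x, x ^ 2 ∂μ - (∫ x, x ∂μ) ^ 2 = variance τ y₀ := by
  rw [h.mean_eq, variance, mean, ← h.moment 2, Complex.ofReal_re]

/-- A semicircular family free from `y₀`, as in the definition of `Ω_{s,t}`. -/
structure IsFreeSemicircularFamily (τ : A →ₗ[ℂ] ℂ) (y₀ : A) (σ : ℝ → A) : Prop where
  isState : IsState τ
  isSelfAdjoint : IsSelfAdjoint y₀
  isSemicircular : ∀ u : ℝ, 0 ≤ u → IsSemicircular τ u (σ u)
  free : ∀ u : ℝ, 0 ≤ u → FreelyIndependent τ ![y₀, σ u]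

namespace IsFreeSemicircularFamily

lemma isLaw (h : IsFreeSemicircularFamily τ y₀ σ) : IsLaw τ y₀ (law τ y₀) :=
  h.isState.isLaw_law h.isSelfAdjoint

lemma isProbabilityMeasure (h : IsFreeSemicircularFamily τ y₀ σ) :
    IsProbabilityMeasure (law τ y₀) := h.isLaw.isProbabilityMeasure

lemma isLaw_add (h : IsFreeSemicircularFamily τ y₀ σ) {u : ℝ} (hu : 0 ≤ u) :
    IsLaw τ (y₀ + σ u) (law τ (y₀ + σ u)) :=
  h.isState.isLaw_law (h.isSelfAdjoint.add (h.isSemicircular u hu).1)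

lemma subordinate (h : IsFreeSemicircularFamily τ y₀ σ) {u : ℝ} (hu : 0 ≤ u) :
    SubordinateAtInfinity (law τ (y₀ + σ u)) (law τ y₀) u :=
  subordinateAtInfinity_of_free h.isState hu h.isLaw (h.isSemicircular u hu) (h.isLaw_add hu)
    (h.free u hu)

/-- The condition |s - t| ≤ s is s ≥ t/2, and the degenerate case s - t = -s is s = t/2. -/
lemma strictMono_bdryRe (h : IsFreeSemicircularFamily τ y₀ σ) (ht : 0 < t) (hst : t / 2 ≤ s)
    (hpt : t / 2 < s ∨ ¬ ∃ c : ℝ, law τ y₀ = Measure.dirac c) :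
    StrictMono (bdryRe (law τ y₀) s (s - t)) := by
  have := h.isProbabilityMeasure
  refine FreeElliptic.strictMono_bdryRe (by linarith) (abs_le.2 ⟨by linarith, by linarith⟩)
    (hpt.imp_left fun h => by linarith)

/-- The set `Ω_{s,t} ∩ ℝ` is the image of the positivity set of `v_{ν,s}`. -/
theorem omegaReal_eq (h : IsFreeSemicircularFamily τ y₀ σ) (ht : 0 < t) (hst : t / 2 ≤ s)
    (hpt : t / 2 < s ∨ ¬ ∃ c : ℝ, law τ y₀ = Measure.dirac c) :
    OmegaReal τ y₀ σ s t =
      bdryRe (law τ y₀) s (s - t) '' {α | 0 < vFun (law τ y₀) s α} := by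
  have hu : 0 ≤ s - t / 2 := sub_nonneg.2 hst
  have := h.isProbabilityMeasure
  have := (h.isLaw_add hu).isProbabilityMeasure
  have e1 : s - t / 2 + t / 2 = s := by ring
  have e2 : s - t / 2 - t / 2 = s - t := by ring
  have key := (h.subordinate hu).omega_real hu (half_pos ht)
  rw [e1, e2] at key
  exact key (h.strictMono_bdryRe ht hst hpt).injective

theorem isUnimodal_bST (h : IsFreeSemicircularFamily τ y₀ σ) (ht : 0 < t) (hst : t / 2 ≤ s)
    (hpt : t / 2 < s ∨ ¬ ∃ c : ℝ, law τ y₀ = Measure.dirac c) {p q : ℝ} (hpq : p ≤ q)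
    (hae : ∀ᵐ x ∂law τ y₀, x ∈ Icc p q) (hsD : 4 * (q - p) ^ 2 ≤ s) :
    IsUnimodal (bST τ y₀ σ s t) := by
  have hu : 0 ≤ s - t / 2 := sub_nonneg.2 hst
  have := h.isProbabilityMeasure
  have := (h.isLaw_add hu).isProbabilityMeasure
  have e1 : s - t / 2 + t / 2 = s := by ring
  have e2 : s - t / 2 - t / 2 = s - t := by ring
  refine (h.subordinate hu).isUnimodal_bFun hu (half_pos ht) ?_ hpq hae (by rwa [e1])
  rw [e1, e2]
  exact h.strictMono_bdryRe ht hst hpt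

theorem exists_omegaReal_eq_Ioo (h : IsFreeSemicircularFamily τ y₀ σ) (ht : 0 < t)
    (hst : t / 2 ≤ s) (hpt : t / 2 < s ∨ ¬ ∃ c : ℝ, law τ y₀ = Measure.dirac c) {p q : ℝ}
    (hpq : p ≤ q) (hae : ∀ᵐ x ∂law τ y₀, x ∈ Icc p q) (hsD : 4 * (q - p) ^ 2 ≤ s) :
    ∃ a b : ℝ, a < p ∧ p < b ∧ {α | 0 < vFun (law τ y₀) s α} = Ioo a b ∧
      bdryRe (law τ y₀) s (s - t) a < bdryRe (law τ y₀) s (s - t) b ∧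
      OmegaReal τ y₀ σ s t =
        Ioo (bdryRe (law τ y₀) s (s - t) a) (bdryRe (law τ y₀) s (s - t) b) := by
  have := h.isProbabilityMeasure
  have hs : 0 < s := by linarith
  obtain ⟨a, b, hap, hpb, hab⟩ := exists_setOf_vFun_pos_eq_Ioo (ν := law τ y₀) hs hpq hae hsD
  have hm := h.strictMono_bdryRe ht hst hpt
  refine ⟨a, b, hap, hpb, hab, hm (hap.trans hpb), ?_⟩
  rw [h.omegaReal_eq ht hst hpt, hab]
  exact (hm.orderIsoOfSurjective _ (surjective_bdryRe hs (s - t))).image_Ioo a b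

theorem endpoints (h : IsFreeSemicircularFamily τ y₀ σ) (ht : 0 < t) {K : ℝ}
    (hK : |variance τ y₀ - t| < K) :
    ∀ᶠ s : ℝ in atTop,
      |sSup (OmegaReal τ y₀ σ s t) - (mean τ y₀ + 2 * √s)| < K / √s ∧
      |sInf (OmegaReal τ y₀ σ s t) - (mean τ y₀ - 2 * √s)| < K / √s ∧
      OmegaReal τ y₀ σ s t ⊆
        Ioo (mean τ y₀ - 2 * √s - K / √s) (mean τ y₀ + 2 * √s + K / √s) := by
  have hprob := h.isProbabilityMeasure
  obtain ⟨p, q, hpq, -, hae⟩ := exists_hull h.isLaw.exists_support_bound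
  obtain ⟨hpm, hmq, hmom⟩ := hasMoments_of_ae_mem_Icc hae
  rw [h.isLaw.variance_eq] at hmom
  rw [h.isLaw.mean_eq] at hpm hmq hmom
  set ν := law τ y₀
  set m := mean τ y₀
  have key : ∀ s : ℝ, t / 2 < s ∧ 4 * (q - p) ^ 2 ≤ s → ∃ a b : ℝ, a < p ∧ p < b ∧
      {α | 0 < vFun ν s α} = Ioo a b ∧ bdryRe ν s (s - t) a < bdryRe ν s (s - t) b ∧
      OmegaReal τ y₀ σ s t = Ioo (bdryRe ν s (s - t) a) (bdryRe ν s (s - t) b) := fun s hs =>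
    h.exists_omegaReal_eq_Ioo ht hs.1.le (Or.inl hs.1) hpq hae hs.2
  choose! a b hap hpb hab hlt hΩ using key
  have hlarge : ∀ᶠ s : ℝ in atTop, t / 2 < s ∧ 4 * (q - p) ^ 2 ≤ s :=
    (eventually_gt_atTop _).and (eventually_ge_atTop _)
  have hzero : ∀ s, (t / 2 < s ∧ 4 * (q - p) ^ 2 ≤ s) → ∀ x, x ∉ Ioo (a s) (b s) →
      vFun ν s x = 0 := fun s hs x hx => by
    rw [← hab s hs] at hx
    exact le_antisymm (not_lt.1 hx) vFun_nonneg
  have hpos : ∀ s, (t / 2 < s ∧ 4 * (q - p) ^ 2 ≤ s) → ∀ x ∈ Ioo (a s) (b s), 0 < vFun ν s x :=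
    fun s hs x hx => by rw [← hab s hs] at hx; exact hx
  have hsmall : ∀ s, (t / 2 < s ∧ 4 * (q - p) ^ 2 ≤ s) →
      ∀ᶠ ε in 𝓝[>] (0 : ℝ), 0 < ε ∧ ε < b s - a s := fun s hs => by
    filter_upwards [self_mem_nhdsWithin, mem_nhdsWithin_of_mem_nhds
      (Iio_mem_nhds (sub_pos.2 ((hap s hs).trans (hpb s hs))))] with ε h1 h2 using ⟨h1, h2⟩
  have hB : ∀ᶠ s in atTop, IsEndpoint ν s m (q - p + 1) 1 (b s) := by
    filter_upwards [hlarge] with s hs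
    refine ⟨hzero s hs _ (by simp), by linarith [hpb s hs], ?_⟩
    filter_upwards [hsmall s hs] with ε hε
    exact hpos s hs _ ⟨by linarith, by linarith⟩
  have hA : ∀ᶠ s in atTop, IsEndpoint ν s m (q - p + 1) (-1) (a s) := by
    filter_upwards [hlarge] with s hs
    refine ⟨hzero s hs _ (by simp), by linarith [hap s hs], ?_⟩
    filter_upwards [hsmall s hs] with ε hε
    exact hpos s hs _ ⟨by linarith, by linarith⟩
  have hBt := (hmom.tendsto_endpoint ht (Or.inl rfl) hB).abs.eventually_lt_const hK
  have hAt := (hmom.tendsto_endpoint ht (Or.inr rfl) hA).abs.eventually_lt_const hK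
  filter_upwards [hlarge, hBt, hAt, eventually_gt_atTop 0] with s hs h1 h2 hs0
  have hρ := Real.sqrt_pos.2 hs0
  rw [abs_mul, abs_of_pos hρ, mul_comm, ← lt_div_iff₀ hρ] at h1 h2
  have h3 : |bdryRe ν s (s - t) (b s) - (m + 2 * √s)| < K / √s := by
    rw [show bdryRe ν s (s - t) (b s) - (m + 2 * √s)
      = 1 * (bdryRe ν s (s - t) (b s) - m) - 2 * √s by ring]
    exact h1
  have h4 : |bdryRe ν s (s - t) (a s) - (m - 2 * √s)| < K / √s := by
    rw [← abs_neg, show -(bdryRe ν s (s - t) (a s) - (m - 2 * √s))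
      = -1 * (bdryRe ν s (s - t) (a s) - m) - 2 * √s by ring]
    exact h2
  rw [hΩ s hs, csSup_Ioo (hlt s hs), csInf_Ioo (hlt s hs)]
  refine ⟨h3, h4, Ioo_subset_Ioo ?_ ?_⟩
  · linarith [(abs_lt.1 h4).1]
  · linarith [(abs_lt.1 h3).2]

theorem abs_im_le (h : IsFreeSemicircularFamily τ y₀ σ) (ht : 0 < t) (hst : t ≤ s) {z : ℂ}
    (hz : z ∈ OmegaST τ y₀ σ s t) : |z.im| ≤ t / √s := by
  have hu : 0 ≤ s - t / 2 := by linarith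
  have hq : 0 ≤ s - t / 2 - t / 2 := by linarith
  have := h.isProbabilityMeasure
  have := (h.isLaw_add hu).isProbabilityMeasure
  have := (h.isLaw_add hq).isProbabilityMeasure
  have key := (h.subordinate hu).abs_im_le_of_mem_Omega (h.subordinate hq) (by linarith)
    (half_pos ht) hz
  rwa [sub_add_cancel, mul_div_cancel₀ t two_ne_zero] at key

theorem height (h : IsFreeSemicircularFamily τ y₀ σ) (ht : 0 < t) :
    (∀ᶠ s : ℝ in atTop, BddAbove ((fun z : ℂ => |z.im|) '' OmegaST τ y₀ σ s t)) ∧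
    Tendsto (fun s : ℝ => sSup ((fun z : ℂ => |z.im|) '' OmegaST τ y₀ σ s t)) atTop (𝓝 0) := by
  have hle : ∀ s : ℝ, t ≤ s → ∀ x ∈ (fun z : ℂ => |z.im|) '' OmegaST τ y₀ σ s t, x ≤ t / √s := by
    rintro s hs _ ⟨z, hz, rfl⟩
    exact h.abs_im_le ht hs hz
  refine ⟨?_, ?_⟩
  · filter_upwards [eventually_ge_atTop t] with s hs using ⟨t / √s, hle s hs⟩
  · have hlim : Tendsto (fun s : ℝ => t / √s) atTop (𝓝 0) :=
      tendsto_const_nhds.div_atTop Real.tendsto_sqrt_atTop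
    refine squeeze_zero' (Eventually.of_forall fun s => ?_) ?_ hlim
    -- The supremum of an empty or unbounded set of reals is 0 by convention, so the lower bound
    -- holds for every s.
    · refine Real.sSup_nonneg ?_
      rintro _ ⟨z, -, rfl⟩
      exact abs_nonneg _
    · filter_upwards [eventually_ge_atTop t] with s hs
      exact Real.sSup_le (hle s hs) (by positivity)

end IsFreeSemicircularFamily

/-- On the curve Im G_ν = -v/s, and the level condition eliminates α in favour of Re G_ν. The
difference is then exactly -t(G_ν - e^{-iφ}/√s). -/
lemma norm_U_bdry_sub {ν : Measure ℝ} [IsProbabilityMeasure ν] (ht : 0 < t) (hs : 0 < s)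
    {m φ α : ℝ} (hα : bdryRe ν s s α = m + 2 * √s * Real.cos φ) :
    ‖U ν s t (bdry ν s α) - (((m + (2 * s - t) / √s * Real.cos φ : ℝ) : ℂ) +
        ((t / √s * Real.sin φ : ℝ) : ℂ) * Complex.I)‖ =
      t * ‖cauchyTransform ν (bdry ν s α) -
        ((Real.cos φ : ℂ) - (Real.sin φ : ℂ) * Complex.I) / (√s : ℂ)‖ := by
  have hρ : 0 < √s := Real.sqrt_pos.2 hs
  have hs2 : √s ^ 2 = s := Real.sq_sqrt hs.le
  rw [bdryRe_eq] at hα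
  have h1 : aST ν s t α = α + (s - t) * (cauchyTransform ν (bdry ν s α)).re :=
    bdryRe_eq (t := s) (q := s - t)
  have hU : U ν s t (bdry ν s α) =
      ((α + (s - t) * (cauchyTransform ν (bdry ν s α)).re : ℝ) : ℂ) +
        ((t / s * vFun ν s α : ℝ) : ℂ) * Complex.I := by
    rw [U, bdry_re, bdry_im, h1]
  have hdiv : ((Real.cos φ : ℂ) - (Real.sin φ : ℂ) * Complex.I) / (√s : ℂ) =
      ((Real.cos φ / √s : ℝ) : ℂ) - ((Real.sin φ / √s : ℝ) : ℂ) * Complex.I := by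
    rw [Complex.ofReal_div, Complex.ofReal_div]; ring
  have him := cauchyTransform_bdry_im (μ := ν) hs (α := α)
  rw [hU, hdiv]
  set G := cauchyTransform ν (bdry ν s α)
  have key : ((α + (s - t) * G.re : ℝ) : ℂ) + ((t / s * vFun ν s α : ℝ) : ℂ) * Complex.I -
      (((m + (2 * s - t) / √s * Real.cos φ : ℝ) : ℂ) + ((t / √s * Real.sin φ : ℝ) : ℂ) * Complex.I) =
      -((t : ℝ) : ℂ) * (G - (((Real.cos φ / √s : ℝ) : ℂ) -
        ((Real.sin φ / √s : ℝ) : ℂ) * Complex.I)) := by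
    have h3 : (2 * s - t) / √s = 2 * √s - t / √s := by
      field_simp; rw [hs2]
    apply Complex.ext
    · simp only [Complex.sub_re, Complex.add_re, Complex.neg_re, Complex.mul_re, Complex.ofReal_re,
        Complex.ofReal_im, Complex.I_re, Complex.I_im, Complex.neg_im, mul_zero, zero_mul, sub_zero,
        mul_one, neg_zero, add_zero]
      rw [h3]
      linear_combination hα
    · simp only [Complex.sub_im, Complex.add_im, Complex.neg_re, Complex.mul_im, Complex.ofReal_re,
        Complex.ofReal_im, Complex.I_re, Complex.I_im, Complex.neg_im, mul_zero, zero_mul,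
        mul_one, neg_zero, add_zero, him]
      ring
  rw [key, norm_mul, norm_neg, Complex.norm_real, Real.norm_of_nonneg ht.le]

theorem IsFreeSemicircularFamily.ellipse (h : IsFreeSemicircularFamily τ y₀ σ) (ht : 0 < t)
    {φ₀ : ℝ} (hφ₀ : φ₀ ∈ Ioo (0 : ℝ) (Real.pi / 2)) {C : ℝ} (hC : variance τ y₀ / 2 < C) :
    ∀ᶠ s : ℝ in atTop, ∀ φ ∈ Icc (0 : ℝ) Real.pi, |Real.cos φ| ≤ Real.cos φ₀ →
      (∃! α : ℝ, H (law τ y₀) s (bdry (law τ y₀) s α) =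
        ((mean τ y₀ + 2 * √s * Real.cos φ : ℝ) : ℂ)) ∧
      ∀ α : ℝ, H (law τ y₀) s (bdry (law τ y₀) s α) =
          ((mean τ y₀ + 2 * √s * Real.cos φ : ℝ) : ℂ) →
        ‖U (law τ y₀) s t (bdry (law τ y₀) s α) -
          (((mean τ y₀ + (2 * s - t) / √s * Real.cos φ : ℝ) : ℂ) +
            ((t / √s * Real.sin φ : ℝ) : ℂ) * Complex.I)‖ <
          C * t / (Real.sin φ₀ * s ^ (3 / 2 : ℝ)) := by
  have hprob := h.isProbabilityMeasure
  obtain ⟨p, q, hpq, -, hae⟩ := exists_hull h.isLaw.exists_support_bound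
  obtain ⟨-, -, hmom⟩ := hasMoments_of_ae_mem_Icc hae
  rw [h.isLaw.variance_eq, h.isLaw.mean_eq] at hmom
  have hκ : 0 < Real.sin φ₀ :=
    Real.sin_pos_of_pos_of_lt_pi hφ₀.1 (by linarith [hφ₀.2, Real.pi_pos])
  filter_upwards [eventually_ellipse_bound (D := q - p + 1) hκ hC, eventually_gt_atTop 0,
    Real.tendsto_sqrt_atTop.eventually_ge_atTop (3 * (q - p + 1))] with s hB hs hsD φ hφ hcos
  obtain ⟨B, hB1, hB2, hB3⟩ := hB
  have hsin : Real.sin φ₀ ≤ Real.sin φ := by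
    have h0 := Real.sin_nonneg_of_mem_Icc hφ
    apply abs_le_of_sq_le_sq' _ h0 |>.2
    have h1 := pow_le_pow_left₀ (abs_nonneg _) hcos 2
    rw [sq_abs] at h1
    nlinarith [Real.sin_sq_add_cos_sq φ, Real.sin_sq_add_cos_sq φ₀]
  have hbij := bijective_bdryRe (μ := law τ y₀) (q := s) hs (abs_of_pos hs).le
    (Or.inl (by linarith))
  have heq : ∀ α : ℝ, H (law τ y₀) s (bdry (law τ y₀) s α) =
      ((mean τ y₀ + 2 * √s * Real.cos φ : ℝ) : ℂ) ↔
      bdryRe (law τ y₀) s s α = mean τ y₀ + 2 * √s * Real.cos φ := fun α => by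
    rw [H_bdry_self hs, Complex.ofReal_inj]
  refine ⟨?_, fun α hα => ?_⟩
  · simp only [heq]
    exact hbij.existsUnique _
  · rw [norm_U_bdry_sub ht hs ((heq α).1 hα)]
    have key := hmom.norm_cauchyTransform_sub_exp_le hs hsD (bdry_mem hs)
      (by rw [bdry_im]; exact vFun_nonneg) hκ hsin hα hB1 hB2
    have hρ := Real.sqrt_pos.2 hs
    calc _ ≤ t * (B / (2 * Real.sin φ₀ - B / Real.sin φ₀) / √s) := by gcongr
      _ < t * (C / (Real.sin φ₀ * s) / √s) := by gcongr
      _ = C * t / (Real.sin φ₀ * s ^ (3 / 2 : ℝ)) := by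
        have : s ^ (3 / 2 : ℝ) = s * √s := by
          rw [Real.sqrt_eq_rpow, ← Real.rpow_one_add' hs.le (by norm_num)]; norm_num
        rw [this]; field_simp

end Main

end FreeElliptic

theorem theorem6p3 {A : Type*} [CStarAlgebra A] (τ : A →ₗ[ℂ] ℂ) (hτ : FreeElliptic.IsState τ)
    (y₀ : A) (hy₀ : IsSelfAdjoint y₀) (σ : ℝ → A)
    (hσ : ∀ u : ℝ, 0 ≤ u → FreeElliptic.IsSemicircular τ u (σ u))
    (hfree : ∀ u : ℝ, 0 ≤ u → FreeElliptic.FreelyIndependent τ ![y₀, σ u])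
    (t : ℝ) (ht : 0 < t) :
    -- unimodality, and `Ω_{s,t} ∩ ℝ` is a nonempty bounded open interval
    (∀ s : ℝ, t / 2 ≤ s →
      (t / 2 < s ∨ ¬ ∃ c : ℝ, FreeElliptic.law τ y₀ = Measure.dirac c) →
      4 * Metric.diam (FreeElliptic.law τ y₀).support ^ 2 ≤ s →
      FreeElliptic.IsUnimodal (FreeElliptic.bST τ y₀ σ s t) ∧
      ∃ p q : ℝ, p < q ∧ FreeElliptic.OmegaReal τ y₀ σ s t = Ioo p q) ∧
    -- the endpoints of `Ω_{s,t} ∩ ℝ`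
    (∀ K : ℝ, |FreeElliptic.variance τ y₀ - t| < K → ∀ᶠ s : ℝ in atTop,
      |sSup (FreeElliptic.OmegaReal τ y₀ σ s t)
          - (FreeElliptic.mean τ y₀ + 2 * Real.sqrt s)| < K / Real.sqrt s ∧
      |sInf (FreeElliptic.OmegaReal τ y₀ σ s t)
          - (FreeElliptic.mean τ y₀ - 2 * Real.sqrt s)| < K / Real.sqrt s ∧
      FreeElliptic.OmegaReal τ y₀ σ s t ⊆
        Ioo (FreeElliptic.mean τ y₀ - 2 * Real.sqrt s - K / Real.sqrt s)
          (FreeElliptic.mean τ y₀ + 2 * Real.sqrt s + K / Real.sqrt s)) ∧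
    -- the boundary of `Ω_{s,t}` is close to an ellipse
    (∀ φ₀ ∈ Ioo (0 : ℝ) (Real.pi / 2), ∀ C : ℝ, FreeElliptic.variance τ y₀ / 2 < C →
      ∀ᶠ s : ℝ in atTop, ∀ φ ∈ Icc (0 : ℝ) Real.pi, |Real.cos φ| ≤ Real.cos φ₀ →
        (∃! α : ℝ, FreeElliptic.H (FreeElliptic.law τ y₀) s
            ((α : ℂ) + (FreeElliptic.vFun (FreeElliptic.law τ y₀) s α : ℂ) * Complex.I) =
          ((FreeElliptic.mean τ y₀ + 2 * Real.sqrt s * Real.cos φ : ℝ) : ℂ)) ∧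
        ∀ α : ℝ, FreeElliptic.H (FreeElliptic.law τ y₀) s
            ((α : ℂ) + (FreeElliptic.vFun (FreeElliptic.law τ y₀) s α : ℂ) * Complex.I) =
          ((FreeElliptic.mean τ y₀ + 2 * Real.sqrt s * Real.cos φ : ℝ) : ℂ) →
        ‖FreeElliptic.U (FreeElliptic.law τ y₀) s t
            ((α : ℂ) + (FreeElliptic.vFun (FreeElliptic.law τ y₀) s α : ℂ) * Complex.I)
          - (((FreeElliptic.mean τ y₀ + (2 * s - t) / Real.sqrt s * Real.cos φ : ℝ) : ℂ)
              + ((t / Real.sqrt s * Real.sin φ : ℝ) : ℂ) * Complex.I)‖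
          < C * t / (Real.sin φ₀ * s ^ (3 / 2 : ℝ))) ∧
    -- the maximal height of `Ω_{s,t}` tends to `0`
    (∀ᶠ s : ℝ in atTop,
      BddAbove ((fun z : ℂ => |z.im|) '' FreeElliptic.OmegaST τ y₀ σ s t)) ∧
    Tendsto (fun s : ℝ => sSup ((fun z : ℂ => |z.im|) '' FreeElliptic.OmegaST τ y₀ σ s t))
      atTop (𝓝 0) := by
  have h : FreeElliptic.IsFreeSemicircularFamily τ y₀ σ := ⟨hτ, hy₀, hσ, hfree⟩
  refine ⟨fun s hst hpt hD => ?_, fun K hK => h.endpoints ht hK,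
    fun φ₀ hφ₀ C hC => h.ellipse ht hφ₀ hC, h.height ht⟩
  have := h.isProbabilityMeasure
  obtain ⟨p, q, hpq, hdiam, hae⟩ := FreeElliptic.exists_hull h.isLaw.exists_support_bound
  have hsD : 4 * (q - p) ^ 2 ≤ s := by
    refine le_trans ?_ hD
    have := sub_nonneg.2 hpq
    gcongr
  obtain ⟨a, b, -, -, -, hlt, hΩ⟩ := h.exists_omegaReal_eq_Ioo ht hst hpt hpq hae hsD
  exact ⟨h.isUnimodal_bST ht hst hpt hpq hae hsD, _, _, hlt, hΩ⟩
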